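/- Let $G$ be a compact (Hausdorff) group with normalized Haar measure $m$. Let $(\pi_i)_{i\in I}$ be a family of continuous irreducible unitary representations $\pi_i:G\to U(d_i)$, where $d_i=\dim\pi_i$. For a complex matrix $x$ write $|x|=(x^*x)^{1/2}$. The family is called *Sidon* if there is a constant $C$ such that $$\sum_{i\in S} d_i\,\mathrm{tr}|x_i|\le C\,\Big\|\sum_{i\in S} d_i\,\mathrm{tr}(x_i\pi_i)\Big\|_{L_\infty(m)}$$ for all finite $S\subset I$ and all $x_i\in M_{d_i}(\mathbb C)$ ($i\in S$). It is called *randomly Sidon* if there is a constant $C$ such that, for all such $S$ and $(x_i)$, $$\sum_{i\in S} d_i\,\mathrm{tr}|x_i|\le C\,\mathbb E\Big\|\sum_{i\in S} d_i\,\mathrm{tr}(x_i g_i\pi_i)\Big\|_{L_\infty(m)},$$ where the $g_i$ are independent random $d_i\times d_i$ matrices whose entries are independent centred (circular) complex Gaussian variables with $\mathbb E|g_i(k,\ell)|^2=1/d_i$. A set $\Lambda$ of equivalence classes of irreducible unitary representations of $G$ is called a Sidon set (resp. a randomly Sidon set) if the family formed of one representative of each class in $\Lambda$ is Sidon (resp.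 randomly Sidon); this does not depend on the choice of the representatives. Then: 1. (Rider) A family (in particular a sequence) of distinct, that is, pairwise inequivalent, irreducible unitary representations of $G$ is Sidon if and only if it is randomly Sidon. 2. The union of finitely many randomly Sidon sets is randomly Sidon. 3. The union of two Sidon sets is Sidon. -/

import Mathlib

open MeasureTheory ProbabilityTheory
open scoped ENNReal NNReal

noncomputable section

namespace SidonRep

section TraceNorm
open scoped MatrixOrder Matrix.Norms.L2Operator

/-- The trace norm `tr |x|` of a square complex matrix, where `|x| = (x* x)^(1/2)`. -/
def traceNorm {d : ℕ} (x : Matrix (Fin d) (Fin d) ℂ) : ℝ :=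
  (Matrix.trace (CFC.abs x)).re

end TraceNorm

/-- The centred (circular) complex Gaussian law with `E |z|² = v`: real and imaginary parts are
independent real centred Gaussians of variance `v / 2`. -/
def complexGaussian (v : ℝ≥0) : Measure ℂ :=
  ((gaussianReal 0 (v / 2)).prod (gaussianReal 0 (v / 2))).map
    (fun p : ℝ × ℝ => (⟨p.1, p.2⟩ : ℂ))

instance isProbabilityMeasure_complexGaussian (v : ℝ≥0) :
    IsProbabilityMeasure (complexGaussian v) := by
  have h : Measurable (fun p : ℝ × ℝ => (⟨p.1, p.2⟩ : ℂ)) :=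
    Complex.measurableEquivRealProd.symm.measurable
  exact Measure.isProbabilityMeasure_map h.aemeasurable

/-- The law of the random `d × d` matrix `g` whose entries are independent centred complex
Gaussian variables with `E |g(i,j)|² = 1 / d`. -/
def gaussianMatrix (d : ℕ) : Measure (Fin d → Fin d → ℂ) :=
  Measure.pi fun _ => Measure.pi fun _ => complexGaussian (d : ℝ≥0)⁻¹

instance isProbabilityMeasure_gaussianMatrix (d : ℕ) :
    IsProbabilityMeasure (gaussianMatrix d) := by
  unfold gaussianMatrix; infer_instance

/-- The joint law of an independent family `(g_k)` of such random matrices, `g_k` being of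
size `d_k × d_k`. -/
def gaussianFamily {ι : Type*} (d : ι → ℕ) : Measure (∀ k, Fin (d k) → Fin (d k) → ℂ) :=
  Measure.infinitePi fun k => gaussianMatrix (d k)

instance isProbabilityMeasure_gaussianFamily {ι : Type*} (d : ι → ℕ) :
    IsProbabilityMeasure (gaussianFamily d) := by
  unfold gaussianFamily; infer_instance

section Matricial

variable {T ι : Type*} [MeasurableSpace T]

/-- The matricial system `(φ_k)` on `(T, m)` is Sidon: there is a constant `C` such that
`∑ d_k tr |x_k| ≤ C ‖∑ d_k tr (x_k φ_k)‖_∞` for all finite families of matrices `x_k`. -/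
def IsSidon (m : Measure T) {d : ι → ℕ} (φ : ∀ k, T → Matrix (Fin (d k)) (Fin (d k)) ℂ) : Prop :=
  ∃ C : ℝ≥0, ∀ (s : Finset ι) (x : ∀ k, Matrix (Fin (d k)) (Fin (d k)) ℂ),
    ENNReal.ofReal (∑ k ∈ s, (d k : ℝ) * traceNorm (x k)) ≤
      C * eLpNorm (fun t => ∑ k ∈ s, (d k : ℂ) * Matrix.trace (x k * φ k t)) ∞ m

/-- The matricial system `(φ_k)` on `(T, m)` is randomly Sidon: there is a constant `C` such that
`∑ d_k tr |x_k| ≤ C E ‖∑ d_k tr (x_k g_k φ_k)‖_∞` for all finite families of matrices `x_k`,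
where the `g_k` are the independent Gaussian random matrices above. -/
def IsRandomlySidon (m : Measure T) {d : ι → ℕ}
    (φ : ∀ k, T → Matrix (Fin (d k)) (Fin (d k)) ℂ) : Prop :=
  ∃ C : ℝ≥0, ∀ (s : Finset ι) (x : ∀ k, Matrix (Fin (d k)) (Fin (d k)) ℂ),
    ENNReal.ofReal (∑ k ∈ s, (d k : ℝ) * traceNorm (x k)) ≤
      C * ∫⁻ g, eLpNorm (fun t => ∑ k ∈ s,
        (d k : ℂ) * Matrix.trace (x k * Matrix.of (g k) * φ k t)) ∞ m ∂(gaussianFamily d)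

end Matricial

/-- The linear representation on `ℂ^d` given by a homomorphism to the unitary group `U(d)`. -/
def linearRep {G : Type*} [Group G] {d : ℕ} (u : G →* Matrix.unitaryGroup (Fin d) ℂ) :
    Representation ℂ G (Fin d → ℂ) where
  toFun g := Matrix.toLin' (u g : Matrix (Fin d) (Fin d) ℂ)
  map_one' := by simp [Module.End.one_eq_id]
  map_mul' a b := by simp [Matrix.toLin'_mul, Module.End.mul_eq_comp]

/-- Irreducible (continuous, finite-dimensional) unitary representations of `G`, in matrix form. -/
structure Irrep (G : Type*) [Group G] [TopologicalSpace G] where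
  dim : ℕ
  hom : G →* Matrix.unitaryGroup (Fin dim) ℂ
  continuous_hom : Continuous hom
  irreducible : (linearRep hom).IsIrreducible

section Dual

variable {G : Type*} [Group G] [TopologicalSpace G]

/-- The matrix `π(t)`. -/
def Irrep.mat (π : Irrep G) (t : G) : Matrix (Fin π.dim) (Fin π.dim) ℂ := (π.hom t).1

/-- Equivalence of representations: existence of an invertible intertwiner. -/
instance irrepSetoid (G : Type*) [Group G] [TopologicalSpace G] : Setoid (Irrep G) where
  r π σ := Nonempty ((linearRep π.hom).Equiv (linearRep σ.hom))
  iseqv := ⟨fun _ => ⟨.refl _⟩, fun ⟨e⟩ => ⟨e.symm⟩, fun ⟨e⟩ ⟨f⟩ => ⟨e.trans f⟩⟩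

/-- The dual object of `G`: equivalence classes of irreducible unitary representations. -/
def DualObject (G : Type*) [Group G] [TopologicalSpace G] : Type _ :=
  Quotient (irrepSetoid G)

/-- The equivalence class of a representation. -/
def Irrep.cls (π : Irrep G) : DualObject G := Quotient.mk (irrepSetoid G) π

variable [MeasurableSpace G]

/-- A set `Λ` of (classes of) irreducible representations is a Sidon set if the matricial system
formed of representatives of its elements is Sidon. -/
def IsSidonSet (m : Measure G) (Λ : Set (DualObject G)) : Prop :=
  ∀ π : Λ → Irrep G, (∀ γ, (π γ).cls = γ) → IsSidon m fun γ => (π γ).mat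

/-- A set `Λ` of (classes of) irreducible representations is a randomly Sidon set if the matricial
system formed of representatives of its elements is randomly Sidon. -/
def IsRandomlySidonSet (m : Measure G) (Λ : Set (DualObject G)) : Prop :=
  ∀ π : Λ → Irrep G, (∀ γ, (π γ).cls = γ) → IsRandomlySidon m fun γ => (π γ).mat

end Dual

end SidonRep

end

/-! Write f_x = ∑ d_k tr(x_k π_k). By density and compactness everything reduces to finite
subfamilies, continuous functions and the sup norm.

Sidon implies randomly Sidon: the Sidon inequality is applied to the coefficients x_k g_k and
averaged, so it suffices that E tr|x g| ≥ (1/2) tr|x|. The scalar inequality r ≥ (3/2) r² - (1/2) r⁴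
for r ≥ 0, applied to the singular values of g, bounds tr|x g| below by the trace of |x| against a
polynomial in g g*. The moments E g g* = 1 and E (g g*)² = 2 then give 3/2 - 1 = 1/2
(`exists_traceNorm_mul_ge`, `integral_fourth_moment`).

Randomly Sidon implies Sidon: by Hahn–Banach the functional x ↦ ∑ d_k tr x_k extends to the L¹ space
of C(G)-valued functions of the Gaussian matrices. Its densities on the matrix coefficients form
random families p(g), each acting on trigonometric polynomials as a functional of norm at most C,
with E g_k p_k(g) = 1 (`exists_dualMatrices`). Averaging over G, through Schur orthogonality, gives
p(g) the same covariances with the entries of g as g* has; this is where inequivalence is used.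
Averaging over fourth roots of unity removes the mean and the covariances with the conjugate
entries. So p(g) - g* is orthogonal to all affine functions of g (`exists_dualMatrices_orthogonal`).

Now let g and g' = c g + s h be correlated Gaussian samples with c² + s² = 1. Functionals of norm at
most C compose by multiplication of their coefficients (`norm_pairing_mul_le`), so E p(g₁) p(g') has
norm at most C², where g₁ = g* u* has the law of g. In this expectation the linear part g'* of p(g')
contributes exactly c u, since E p(g₁) g₁ = 1. The remainder is O(c²), because the Mehler operator
contracts by c² beyond the first chaos (`norm_integral_mix_le`). Taking for u the adjoint of the
unitary part of x, pairing with x gives c ∑ d_k tr|x_k| up to a relative error O(c). A small fixed c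
yields the Sidon inequality with constant of order C⁴ for large C.

Unions: enlarging the index set does not decrease the expected norm of a random polynomial, by sign
symmetry, so random Sidonicity passes to finite unions. Rider's equivalence transfers this to Sidon
sets. -/

noncomputable section

namespace SidonRep

set_option linter.unusedSectionVars false

/-! ### Polar decomposition, singular values and trace duality -/

section SingularValues
open scoped MatrixOrder Matrix.Norms.L2Operator ComplexOrder
open Matrix

variable {d : ℕ}

/-- Polar decomposition: matrices with the same Gram matrix differ by a unitary factor. -/
theorem exists_unitary_mul_eq {x h : Matrix (Fin d) (Fin d) ℂ} (hxh : xᴴ * x = hᴴ * h) :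
    ∃ v ∈ unitaryGroup (Fin d) ℂ, x = v * h := by
  have key : ∀ y : Matrix (Fin d) (Fin d) ℂ, ∀ w : EuclideanSpace ℂ (Fin d),
      ((‖y.toEuclideanLin w‖ ^ 2 : ℝ) : ℂ) = inner ℂ w ((yᴴ * y).toEuclideanLin w) := by
    intro y w
    have : (yᴴ * y).toEuclideanLin w = LinearMap.adjoint y.toEuclideanLin (y.toEuclideanLin w) := by
      rw [← Matrix.toEuclideanLin_conjTranspose_eq_adjoint]
      simp [Matrix.toLpLin_apply, Matrix.mulVec_mulVec]
    rw [this, LinearMap.adjoint_inner_right, inner_self_eq_norm_sq_to_K]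
    norm_cast
  have hnorm : ∀ w, ‖x.toEuclideanLin w‖ = ‖h.toEuclideanLin w‖ := by
    intro w
    have h1 : ((‖x.toEuclideanLin w‖ ^ 2 : ℝ) : ℂ) = ((‖h.toEuclideanLin w‖ ^ 2 : ℝ) : ℂ) := by
      rw [key, key, hxh]
    have h2 := Complex.ofReal_injective h1
    exact (sq_eq_sq₀ (norm_nonneg _) (norm_nonneg _)).1 h2
  obtain ⟨r, hr⟩ := LinearMap.exists_rightInverse_of_surjective
    (h.toEuclideanLin.rangeRestrict) (LinearMap.range_rangeRestrict _)
  have hr' : ∀ w, h.toEuclideanLin (r w) = w := fun w => by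
    have := LinearMap.congr_fun hr w
    simpa using congrArg Subtype.val this
  -- On the range of h the assignment h w ↦ x w is well defined and isometric, since ‖x w‖ = ‖h w‖.
  -- In finite dimension it extends to an isometry of the whole space, hence to a unitary.
  let L : LinearMap.range h.toEuclideanLin →ₗᵢ[ℂ] EuclideanSpace ℂ (Fin d) :=
    { toLinearMap := x.toEuclideanLin ∘ₗ r
      norm_map' := fun w => by
        simp only [LinearMap.comp_apply]
        rw [hnorm, hr']; rfl }
  have hL : ∀ w, L.extend (h.toEuclideanLin w) = x.toEuclideanLin w := by
    intro w
    have h1 := L.extend_apply ⟨h.toEuclideanLin w, LinearMap.mem_range_self _ w⟩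
    simp only at h1
    rw [h1]
    change x.toEuclideanLin (r _) = _
    rw [← sub_eq_zero, ← map_sub, ← norm_eq_zero, hnorm, map_sub, hr', sub_self, norm_zero]
  let v : Matrix (Fin d) (Fin d) ℂ := Matrix.toEuclideanLin.symm L.extend.toLinearMap
  have hv : v.toEuclideanLin = L.extend.toLinearMap := by simp [v]
  refine ⟨v, ?_, ?_⟩
  · rw [mem_unitaryGroup_iff']
    apply Matrix.toEuclideanLin.injective
    apply LinearMap.ext
    intro w
    have : (star v * v).toEuclideanLin w = LinearMap.adjoint v.toEuclideanLin (v.toEuclideanLin w) := by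
      rw [← Matrix.toEuclideanLin_conjTranspose_eq_adjoint]
      simp [Matrix.toLpLin_apply, Matrix.mulVec_mulVec, Matrix.star_eq_conjTranspose]
    rw [this, hv]
    apply ext_inner_left ℂ
    intro z
    rw [LinearMap.adjoint_inner_right]
    simp
  · apply Matrix.toEuclideanLin.injective
    apply LinearMap.ext
    intro w
    have : (v * h).toEuclideanLin w = v.toEuclideanLin (h.toEuclideanLin w) := by
      simp [Matrix.toLpLin_apply, Matrix.mulVec_mulVec]
    rw [this, hv]
    exact (hL w).symm

/-- Singular value decomposition, with the trace norm as the sum of the singular values. -/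
theorem exists_singularValue_decomposition (x : Matrix (Fin d) (Fin d) ℂ) :
    ∃ U ∈ unitaryGroup (Fin d) ℂ, ∃ V ∈ unitaryGroup (Fin d) ℂ, ∃ s : Fin d → ℝ,
      (∀ i, 0 ≤ s i) ∧ x = U * diagonal (fun i => (s i : ℂ)) * V ∧ traceNorm x = ∑ i, s i := by
  have hpos : (CFC.abs x).PosSemidef := nonneg_iff_posSemidef.1 (CFC.abs_nonneg x)
  have hherm := hpos.isHermitian
  have hsq : xᴴ * x = (CFC.abs x)ᴴ * CFC.abs x := by
    rw [hherm.eq, CFC.abs_mul_abs]; rfl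
  obtain ⟨v, hv, hx⟩ := exists_unitary_mul_eq hsq
  have hspec := hherm.spectral_theorem
  rw [Unitary.conjStarAlgAut_apply] at hspec
  refine ⟨v * hherm.eigenvectorUnitary, mul_mem hv hherm.eigenvectorUnitary.2,
    star (hherm.eigenvectorUnitary : Matrix (Fin d) (Fin d) ℂ),
    Unitary.star_mem hherm.eigenvectorUnitary.2, hherm.eigenvalues, hpos.eigenvalues_nonneg, ?_, ?_⟩
  · conv_lhs => rw [hx, hspec]
    simp only [Matrix.mul_assoc]
    rfl
  · rw [traceNorm, hherm.trace_eq_sum_eigenvalues]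
    simp

theorem traceNorm_nonneg (x : Matrix (Fin d) (Fin d) ℂ) : 0 ≤ traceNorm x := by
  obtain ⟨U, -, V, -, s, hs, -, h⟩ := exists_singularValue_decomposition x
  rw [h]; exact Finset.sum_nonneg fun i _ => hs i

theorem trace_mul_diagonal_mul (U V B : Matrix (Fin d) (Fin d) ℂ) (s : Fin d → ℂ) :
    trace (U * diagonal s * V * B) = ∑ i, s i * (V * B * U) i i := by
  rw [Matrix.mul_assoc, Matrix.mul_assoc, trace_mul_comm, Matrix.mul_assoc]
  simp [trace, diagonal_mul]

/-- With x = U diag(s) V the trace equals ∑ s_i (V B U)_ii, and the diagonal entries of the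
contraction V B U have modulus at most 1. -/
theorem norm_trace_mul_le {x B : Matrix (Fin d) (Fin d) ℂ} (hB : (1 - Bᴴ * B).PosSemidef) :
    ‖trace (x * B)‖ ≤ traceNorm x := by
  obtain ⟨U, hU, V, hV, s, hs, hx, h⟩ := exists_singularValue_decomposition x
  conv_lhs => rw [hx, trace_mul_diagonal_mul]
  rw [h]
  refine (norm_sum_le _ _).trans (Finset.sum_le_sum fun i _ => ?_)
  have hU' := mem_unitaryGroup_iff'.1 hU
  have hV' := mem_unitaryGroup_iff'.1 hV
  have h1 : 1 - (V * B * U)ᴴ * (V * B * U) = Uᴴ * (1 - Bᴴ * B) * U := by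
    have : (V * B * U)ᴴ * (V * B * U) = Uᴴ * (Bᴴ * ((star V * V) * B)) * U := by
      simp only [conjTranspose_mul, Matrix.mul_assoc, star_eq_conjTranspose]
    rw [this, hV', Matrix.one_mul, Matrix.mul_sub, Matrix.sub_mul, Matrix.mul_one]
    rw [← star_eq_conjTranspose U, hU']
  have h2 := (hB.conjTranspose_mul_mul_same U).diag_nonneg (i := i)
  rw [← h1] at h2
  have h3 : ((V * B * U)ᴴ * (V * B * U)) i i = ((∑ j, ‖(V * B * U) j i‖ ^ 2 : ℝ) : ℂ) := by
    rw [Matrix.mul_apply]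
    push_cast
    refine Finset.sum_congr rfl fun j _ => ?_
    rw [conjTranspose_apply, Complex.star_def, Complex.conj_mul']
  rw [Matrix.sub_apply, h3, one_apply_eq] at h2
  have h4 : ∑ j, ‖(V * B * U) j i‖ ^ 2 ≤ 1 := by
    have := (Complex.le_def.1 h2).1
    simp only [Complex.zero_re, Complex.sub_re, Complex.one_re, Complex.ofReal_re] at this
    linarith
  have h5 : ‖(V * B * U) i i‖ ^ 2 ≤ 1 :=
    (Finset.single_le_sum (f := fun j => ‖(V * B * U) j i‖ ^ 2) (fun j _ => sq_nonneg _)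
      (Finset.mem_univ i)).trans h4
  have h6 : ‖(V * B * U) i i‖ ≤ 1 := by
    by_contra hc
    push Not at hc
    nlinarith
  rw [norm_mul, Complex.norm_real, Real.norm_of_nonneg (hs i)]
  exact mul_le_of_le_one_right (hs i) h6

theorem norm_trace_le_traceNorm (x : Matrix (Fin d) (Fin d) ℂ) : ‖trace x‖ ≤ traceNorm x := by
  have := norm_trace_mul_le (x := x) (B := 1) (by simpa using PosSemidef.zero)
  simpa using this

end SingularValues

/-! ### Complex Gaussian matrices: unitary invariance and covariances -/

section Gaussian
open Complex

/-- The complex coefficient `a` with `L z = Re (a z)`. -/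
def dualCoeff (L : StrongDual ℝ ℂ) : ℂ := ⟨L 1, -L I⟩

theorem dualCoeff_spec (L : StrongDual ℝ ℂ) (z : ℂ) : L z = (dualCoeff L * z).re := by
  have hz : z = z.re • (1 : ℂ) + z.im • I := by
    apply Complex.ext <;> simp
  conv_lhs => rw [hz]
  rw [map_add, map_smul, map_smul]
  simp [dualCoeff]
  ring

theorem dualCoeff_eq_of_forall {L : StrongDual ℝ ℂ} {a : ℂ} (h : ∀ z, L z = (a * z).re) :
    dualCoeff L = a := by
  apply Complex.ext
  · simp [dualCoeff, h]
  · simp [dualCoeff, h]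

/-- Only the modulus of the coefficient of L enters: this circularity is the source of all the
unitary and conjugation invariances below. -/
theorem charFunDual_complexGaussian (v : ℝ≥0) (L : StrongDual ℝ ℂ) :
    charFunDual (complexGaussian v) L = cexp (-(v / 4) * ‖dualCoeff L‖ ^ 2) := by
  let e : ℝ × ℝ →L[ℝ] ℂ := Complex.equivRealProdCLM.symm.toContinuousLinearMap
  have he : (fun p : ℝ × ℝ => (⟨p.1, p.2⟩ : ℂ)) = e := by
    ext p; rfl
  rw [complexGaussian, he, charFunDual_map, charFunDual_prod,
    IsGaussian.charFunDual_eq_of_integral_eq_zero (by simp),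
    IsGaussian.charFunDual_eq_of_integral_eq_zero (by simp),
    variance_continuousLinearMap_gaussianReal, variance_continuousLinearMap_gaussianReal,
    ← Complex.exp_add]
  congr 1
  have h1 : (L.comp e).comp (.inl ℝ ℝ ℝ) 1 = L 1 := by
    simp only [ContinuousLinearMap.comp_apply]; congr 1
  have h2 : (L.comp e).comp (.inr ℝ ℝ ℝ) 1 = L I := by
    simp only [ContinuousLinearMap.comp_apply]; congr 1
  rw [h1, h2, ← Complex.ofReal_pow, Complex.sq_norm, Complex.normSq_apply]
  have h3 : ∀ r : ℝ, 0 ≤ r ^ 2 := sq_nonneg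
  simp only [Real.coe_toNNReal', NNReal.coe_div, dualCoeff,
    max_eq_left (h3 _)]
  push_cast
  ring

instance isGaussian_complexGaussian (v : ℝ≥0) : IsGaussian (complexGaussian v) := by
  have : (fun p : ℝ × ℝ => (⟨p.1, p.2⟩ : ℂ)) = Complex.equivRealProdCLM.symm := by
    ext p; rfl
  rw [complexGaussian, this]
  infer_instance

theorem isGaussian_pi {ι : Type*} [Fintype ι] {E : ι → Type*} [∀ i, NormedAddCommGroup (E i)]
    [∀ i, NormedSpace ℝ (E i)] [∀ i, MeasurableSpace (E i)] [∀ i, BorelSpace (E i)]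
    [∀ i, SecondCountableTopology (E i)] [∀ i, CompleteSpace (E i)] (μ : ∀ i, Measure (E i))
    [∀ i, IsGaussian (μ i)] : IsGaussian (Measure.pi μ) := by
  have h1 : iIndepFun (fun i (x : ∀ i, E i) => x i) (Measure.pi μ) := by
    have := iIndepFun_pi (μ := μ) (X := fun i => (id : E i → E i)) (fun i => aemeasurable_id)
    exact this
  have h2 : ∀ i, HasGaussianLaw (fun x : ∀ i, E i => x i) (Measure.pi μ) := fun i =>
    ⟨by rw [(measurePreserving_eval μ i).map_eq]; infer_instance⟩
  have := (iIndepFun.hasGaussianLaw h2 h1).isGaussian_map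
  simpa [Measure.map_id'] using this

theorem integral_complexGaussian_mul_star (v : ℝ≥0) :
    ∫ z, (z * star z) ∂(complexGaussian v) = v := by
  have : (fun p : ℝ × ℝ => (⟨p.1, p.2⟩ : ℂ)) = Complex.equivRealProdCLM.symm := by
    ext p; rfl
  rw [complexGaussian, this, integral_map (by fun_prop) (by fun_prop)]
  have hz : ∀ p : ℝ × ℝ, Complex.equivRealProdCLM.symm p * star (Complex.equivRealProdCLM.symm p)
      = ((p.1 ^ 2 + p.2 ^ 2 : ℝ) : ℂ) := fun p => by
    rw [Complex.star_def, Complex.mul_conj, Complex.normSq_apply,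
      show Complex.equivRealProdCLM.symm p = ⟨p.1, p.2⟩ from rfl]
    simp [pow_two]
  have hsq : ∫ x, x ^ 2 ∂(gaussianReal 0 (v / 2)) = (v / 2 : ℝ) := by
    have h1 := variance_fun_id_gaussianReal (μ := 0) (v := v / 2)
    rw [variance_eq_integral (by fun_prop)] at h1
    simpa using h1
  have hint : Integrable (fun x : ℝ => x ^ 2) (gaussianReal 0 (v / 2)) :=
    (memLp_id_gaussianReal' (μ := 0) (v := v / 2) 2 (by simp)).integrable_sq
  simp_rw [hz]
  rw [integral_complex_ofReal, integral_add (hint.comp_fst _) (hint.comp_snd _),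
    integral_fun_fst (μ := gaussianReal 0 (v / 2)) (ν := gaussianReal 0 (v / 2))
        (fun x : ℝ => x ^ 2), integral_fun_snd (μ := gaussianReal 0 (v / 2))
        (ν := gaussianReal 0 (v / 2)) (fun x : ℝ => x ^ 2), hsq]
  simp

theorem sum_norm_sq_mulVec {n : Type*} [Fintype n] [DecidableEq n] {U : Matrix n n ℂ}
    (hU : U ∈ Matrix.unitaryGroup n ℂ) (a : n → ℂ) :
    ∑ i, ‖(U.mulVec a) i‖ ^ 2 = ∑ i, ‖a i‖ ^ 2 := by
  have key : ∀ b : n → ℂ, ((∑ i, ‖b i‖ ^ 2 : ℝ) : ℂ) = star b ⬝ᵥ b := fun b => by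
    simp [dotProduct, Complex.conj_mul']
  apply Complex.ofReal_injective
  rw [key, key, Matrix.star_mulVec, ← Matrix.dotProduct_mulVec, Matrix.mulVec_mulVec,
    ← Matrix.star_eq_conjTranspose, Matrix.mem_unitaryGroup_iff'.1 hU, Matrix.one_mulVec]

theorem charFunDual_pi_complexGaussian {n : Type*} [Fintype n] [DecidableEq n] (v : ℝ≥0)
    (L : StrongDual ℝ (n → ℂ)) :
    charFunDual (Measure.pi fun _ : n => complexGaussian v) L =
      cexp (-(v / 4) * (∑ i, ‖dualCoeff (L.comp (.single ℝ (fun _ => ℂ) i))‖ ^ 2 : ℝ)) := by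
  rw [charFunDual_pi]
  simp_rw [charFunDual_complexGaussian]
  rw [← Complex.exp_sum, ← Finset.mul_sum]
  push_cast
  rfl

/-- The characteristic function of a Gaussian row depends only on the Euclidean norm of the
coefficient vector, which a unitary matrix preserves. -/
theorem measurePreserving_vecMul {n : Type*} [Fintype n] [DecidableEq n] (v : ℝ≥0)
    {U : Matrix n n ℂ} (hU : U ∈ Matrix.unitaryGroup n ℂ) :
    MeasurePreserving (fun r : n → ℂ => Matrix.vecMul r U)
      (Measure.pi fun _ : n => complexGaussian v) (Measure.pi fun _ : n => complexGaussian v) := by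
  let T : (n → ℂ) →L[ℝ] (n → ℂ) :=
    LinearMap.toContinuousLinearMap ((Matrix.vecMulLinear U).restrictScalars ℝ)
  have hT : (fun r : n → ℂ => Matrix.vecMul r U) = T := rfl
  rw [hT]
  refine ⟨by fun_prop, ?_⟩
  apply Measure.ext_of_charFunDual
  funext L
  rw [charFunDual_map, charFunDual_pi_complexGaussian, charFunDual_pi_complexGaussian]
  have h1 : ∀ i, dualCoeff ((L.comp T).comp (.single ℝ (fun _ => ℂ) i)) =
      U.mulVec (fun j => dualCoeff (L.comp (.single ℝ (fun _ => ℂ) j))) i := by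
    intro i
    apply dualCoeff_eq_of_forall
    intro z
    have h2 : T (ContinuousLinearMap.single ℝ (fun _ => ℂ) i z) =
        ∑ j, ContinuousLinearMap.single ℝ (fun _ => ℂ) j (z * U i j) := by
      funext j
      simp [T, Finset.sum_apply, Pi.single_apply]
    rw [ContinuousLinearMap.comp_apply, ContinuousLinearMap.comp_apply, h2, map_sum,
      Matrix.mulVec, dotProduct, Finset.sum_mul, Complex.re_sum]
    refine Finset.sum_congr rfl fun j _ => ?_
    have := dualCoeff_spec (L.comp (.single ℝ (fun _ => ℂ) j)) (z * U i j)
    rw [ContinuousLinearMap.comp_apply] at this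
    rw [this]
    congr 1
    ring
  simp_rw [h1]
  rw [sum_norm_sq_mulVec hU]

variable {d : ℕ}

theorem measurePreserving_gaussianMatrix_mul {U : Matrix (Fin d) (Fin d) ℂ}
    (hU : U ∈ Matrix.unitaryGroup (Fin d) ℂ) :
    MeasurePreserving (fun (g : Fin d → Fin d → ℂ) (i j : Fin d) => (Matrix.of g * U) i j)
      (gaussianMatrix d) (gaussianMatrix d) :=
  measurePreserving_pi _ _ fun _ => measurePreserving_vecMul _ hU

theorem measurePreserving_gaussianMatrix_conjTranspose :
    MeasurePreserving (fun (g : Fin d → Fin d → ℂ) (i j : Fin d) => star (g j i))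
      (gaussianMatrix d) (gaussianMatrix d) := by
  let T : (Fin d → Fin d → ℂ) →L[ℝ] (Fin d → Fin d → ℂ) :=
    LinearMap.toContinuousLinearMap
      { toFun := fun g i j => star (g j i)
        map_add' := fun g h => by ext; simp
        map_smul' := fun c g => by ext; simp }
  have hT : (fun (g : Fin d → Fin d → ℂ) (i j : Fin d) => star (g j i)) = T := rfl
  rw [hT]
  refine ⟨by fun_prop, ?_⟩
  apply Measure.ext_of_charFunDual
  funext L
  rw [charFunDual_map, gaussianMatrix, charFunDual_pi, charFunDual_pi]
  simp_rw [charFunDual_pi, charFunDual_complexGaussian]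
  rw [Finset.prod_comm]
  refine Finset.prod_congr rfl fun i _ => Finset.prod_congr rfl fun j _ => ?_
  have : dualCoeff (((L.comp T).comp (.single ℝ (fun _ => Fin d → ℂ) j)).comp
      (.single ℝ (fun _ => ℂ) i)) =
      star (dualCoeff ((L.comp (.single ℝ (fun _ => Fin d → ℂ) i)).comp
        (.single ℝ (fun _ => ℂ) j))) := by
    apply dualCoeff_eq_of_forall
    intro z
    have h2 : T (ContinuousLinearMap.single ℝ (fun _ => Fin d → ℂ) j
        (ContinuousLinearMap.single ℝ (fun _ => ℂ) i z)) =
        ContinuousLinearMap.single ℝ (fun _ => Fin d → ℂ) i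
        (ContinuousLinearMap.single ℝ (fun _ => ℂ) j (star z)) := by
      funext a b
      by_cases ha : a = i <;> by_cases hb : b = j <;>
        simp [T, ha, hb]
    simp only [ContinuousLinearMap.comp_apply, h2]
    have := dualCoeff_spec ((L.comp (.single ℝ (fun _ => Fin d → ℂ) i)).comp
        (.single ℝ (fun _ => ℂ) j)) (star z)
    simp only [ContinuousLinearMap.comp_apply] at this
    rw [this]
    simp
  rw [this, norm_star]

instance isGaussian_gaussianMatrix : IsGaussian (gaussianMatrix d) := by
  unfold gaussianMatrix
  have : IsGaussian (Measure.pi fun _ : Fin d => complexGaussian (d : ℝ≥0)⁻¹) := isGaussian_pi _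
  exact isGaussian_pi _

/-- The joint law of finitely many independent Gaussian matrices. -/
def gaussianProd {κ : Type*} [Fintype κ] (d : κ → ℕ) : Measure (∀ k, Fin (d k) → Fin (d k) → ℂ) :=
  Measure.pi fun k => gaussianMatrix (d k)

section Family

variable {κ : Type*} [Fintype κ] {d : κ → ℕ}

instance isGaussian_gaussianProd : IsGaussian (gaussianProd d) := isGaussian_pi _

/-- Right multiplication of each block by a matrix. -/
def blockMul (g : ∀ k, Fin (d k) → Fin (d k) → ℂ) (U : ∀ k, Matrix (Fin (d k)) (Fin (d k)) ℂ) :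
    ∀ k, Fin (d k) → Fin (d k) → ℂ := fun k i j => (Matrix.of (g k) * U k) i j

/-- Conjugate transposition of each block. -/
def blockStar (g : ∀ k, Fin (d k) → Fin (d k) → ℂ) : ∀ k, Fin (d k) → Fin (d k) → ℂ :=
  fun k i j => star (g k j i)

theorem measurePreserving_blockMul {U : ∀ k, Matrix (Fin (d k)) (Fin (d k)) ℂ}
    (hU : ∀ k, U k ∈ Matrix.unitaryGroup (Fin (d k)) ℂ) :
    MeasurePreserving (fun g => blockMul g U) (gaussianProd d) (gaussianProd d) :=
  measurePreserving_pi _ _ fun k => measurePreserving_gaussianMatrix_mul (hU k)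

theorem measurePreserving_blockStar :
    MeasurePreserving blockStar (gaussianProd d) (gaussianProd d) :=
  measurePreserving_pi _ _ fun _ => measurePreserving_gaussianMatrix_conjTranspose

theorem integral_comp_of_measurePreserving {α : Type*} [MeasurableSpace α] {μ : Measure α}
    {T : α → α} (hT : MeasurePreserving T μ μ) {f : α → ℂ} (hf : AEStronglyMeasurable f μ) :
    ∫ x, f (T x) ∂μ = ∫ x, f x ∂μ := by
  conv_rhs => rw [← hT.map_eq]
  rw [integral_map hT.measurable.aemeasurable (by rwa [hT.map_eq])]

theorem measurePreserving_smul {w : ℂ} (hw : star w * w = 1) :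
    MeasurePreserving (fun g : ∀ k, Fin (d k) → Fin (d k) → ℂ => w • g)
      (gaussianProd d) (gaussianProd d) := by
  have h := measurePreserving_blockMul (d := d) (U := fun k => w • 1) fun k => by
    rw [Matrix.mem_unitaryGroup_iff', star_smul, smul_mul_smul_comm, hw]; simp
  convert h using 1
  funext g k i j
  simp [blockMul]

/-- Multiplication by the phase w preserves the law, so the integral is equal to c times itself. -/
theorem integral_eq_zero_of_smul {f : (∀ k, Fin (d k) → Fin (d k) → ℂ) → ℂ} (hf : Measurable f)
    {w : ℂ} (hw : star w * w = 1) {c : ℂ} (hc : c ≠ 1) (h : ∀ g, f (w • g) = c * f g) :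
    ∫ g, f g ∂(gaussianProd d) = 0 := by
  have h1 := integral_comp_of_measurePreserving (measurePreserving_smul (d := d) hw)
    hf.aestronglyMeasurable
  simp_rw [h] at h1
  rw [integral_const_mul] at h1
  have h2 : (c - 1) * ∫ g, f g ∂(gaussianProd d) = 0 := by rw [sub_mul, h1, one_mul, sub_self]
  exact (mul_eq_zero.1 h2).resolve_left (sub_ne_zero.2 hc)

theorem integral_entry (k : κ) (i j : Fin (d k)) : ∫ g, g k i j ∂(gaussianProd d) = 0 :=
  integral_eq_zero_of_smul (by fun_prop) (w := -1) (c := -1) (by simp) (by norm_num) (by simp)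

theorem integral_entry_mul_star_entry_self (k : κ) (i j : Fin (d k)) :
    ∫ g, g k i j * star (g k i j) ∂(gaussianProd d) = (d k : ℂ)⁻¹ := by
  have h1 : MeasurePreserving (fun g : ∀ k, Fin (d k) → Fin (d k) → ℂ => g k i j)
      (gaussianProd d) (complexGaussian (d k : ℝ≥0)⁻¹) :=
    (measurePreserving_eval (fun _ : Fin (d k) => complexGaussian (d k : ℝ≥0)⁻¹) j).comp
    ((measurePreserving_eval (fun _ : Fin (d k) => Measure.pi fun _ : Fin (d k) =>
      complexGaussian (d k : ℝ≥0)⁻¹) i).comp (measurePreserving_eval _ k))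
  have h2 := integral_complexGaussian_mul_star ((d k : ℝ≥0)⁻¹)
  rw [← h1.map_eq, integral_map h1.measurable.aemeasurable (by fun_prop)] at h2
  rw [h2]; simp

theorem integral_entry_mul_star_entry_of_ne (k l : κ) (i j : Fin (d k)) (a b : Fin (d l))
    (h : ∀ e : k = l, e ▸ j ≠ b) :
    ∫ g, g k i j * star (g l a b) ∂(gaussianProd d) = 0 := by
  classical
  -- Flipping the sign of the single column j of block k is a unitary block multiplication. It
  -- negates the first factor and fixes the second, so the integral is its own opposite.
  let ε : ∀ k', Fin (d k') → ℂ := fun k' j' => if ∃ e : k = k', e ▸ j = j' then -1 else 1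
  have hε : ∀ k' j', star (ε k' j') * ε k' j' = 1 := fun k' j' => by
    simp only [ε]; split_ifs <;> simp
  have hU : ∀ k', Matrix.diagonal (ε k') ∈ Matrix.unitaryGroup (Fin (d k')) ℂ := fun k' => by
    rw [Matrix.mem_unitaryGroup_iff', Matrix.star_eq_conjTranspose, Matrix.diagonal_conjTranspose,
      Matrix.diagonal_mul_diagonal, ← Matrix.diagonal_one]
    congr 1
    funext j'
    exact hε k' j'
  have h1 := integral_comp_of_measurePreserving (measurePreserving_blockMul hU)
    (f := fun g => g k i j * star (g l a b)) (by fun_prop)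
  have h2 : ε k j = -1 := if_pos ⟨rfl, rfl⟩
  have h3 : ε l b = 1 := if_neg fun ⟨e, he⟩ => h e he
  simp only [blockMul, Matrix.mul_diagonal, Matrix.of_apply, h2, h3] at h1
  have h4 : ∀ g : ∀ k, Fin (d k) → Fin (d k) → ℂ,
      g k i j * -1 * star (g l a b * 1) = -(g k i j * star (g l a b)) := fun g => by
    rw [mul_one]; ring
  simp_rw [h4] at h1
  rw [integral_neg] at h1
  exact self_eq_neg.1 h1.symm

theorem integral_entry_mul_star_entry (k : κ) (i j a b : Fin (d k)) :
    ∫ g, g k i j * star (g k a b) ∂(gaussianProd d) =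
      if i = a ∧ j = b then (d k : ℂ)⁻¹ else 0 := by
  split_ifs with h
  · rw [h.1, h.2, integral_entry_mul_star_entry_self]
  · by_cases hj : j = b
    · have hi : a ≠ i := fun e => h ⟨e.symm, hj⟩
      have h1 := integral_comp_of_measurePreserving (measurePreserving_blockStar (d := d))
        (f := fun g => g k i j * star (g k a b)) (by fun_prop)
      -- The sign argument only separates columns; for entries of one column in different rows,
      -- passing to adjoints exchanges rows and columns.
      rw [← h1]
      simp only [blockStar, star_star]
      simp_rw [mul_comm (star _)]
      exact integral_entry_mul_star_entry_of_ne k k b a j i (fun _ => hi)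
    · exact integral_entry_mul_star_entry_of_ne k k i j a b (fun _ => hj)

theorem integral_id_gaussianProd : ∫ g, g ∂(gaussianProd d) = 0 := by
  have hm := measurePreserving_smul (d := d) (w := -1) (by simp)
  have h1 := integral_map (μ := gaussianProd d) hm.measurable.aemeasurable
    (f := fun g => g) (by fun_prop)
  rw [hm.map_eq] at h1
  simp only [neg_smul, one_smul] at h1
  exact self_eq_neg.1 (h1.trans (integral_neg _))

end Family

end Gaussian

/-! ### The Mehler operator and its spectral gap beyond the first chaos -/

section Mehler
open Complex

variable {E : Type*} [NormedAddCommGroup E] [NormedSpace ℝ E] [MeasurableSpace E] [BorelSpace E]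
  [SecondCountableTopology E] [CompleteSpace E] {μ : Measure E} [IsGaussian μ]

theorem norm_exp_mul_I_sub_one_sub_le (θ : ℝ) : ‖cexp (θ * I) - 1 - θ * I‖ ≤ 3 * θ ^ 2 := by
  have hn : ‖(θ : ℂ) * I‖ = |θ| := by simp
  by_cases h : |θ| ≤ 1
  · have := Complex.norm_exp_sub_one_sub_id_le (x := θ * I) (by rwa [hn])
    rw [hn, sq_abs] at this
    nlinarith [sq_nonneg θ]
  · push Not at h
    have h1 : ‖cexp (θ * I) - 1 - θ * I‖ ≤ 1 + 1 + |θ| := by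
      refine (norm_sub_le _ _).trans ?_
      rw [hn]
      gcongr
      refine (norm_sub_le _ _).trans ?_
      rw [Complex.norm_exp_ofReal_mul_I, norm_one]
    rw [← sq_abs]
    nlinarith

/-- The finite measures with densities r⁺ and r⁻ have the same characteristic function, so they
coincide. -/
theorem ae_eq_zero_of_integral_char_eq_zero (ν : Measure E) [IsFiniteMeasure ν]
    {r : E → ℝ} (hr : Integrable r ν) (hm : Measurable r)
    (h : ∀ L : StrongDual ℝ E, ∫ x, cexp (L x * I) * r x ∂ν = 0) : r =ᵐ[ν] 0 := by
  have hfin : ∀ q : E → ℝ, Integrable q ν → ∫⁻ x, ENNReal.ofReal (q x) ∂ν ≠ ∞ := fun q hq =>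
    (hq.lintegral_lt_top).ne
  have h1 : ν.withDensity (fun x => ENNReal.ofReal (r x)) =
      ν.withDensity (fun x => ENNReal.ofReal (-r x)) := by
    have := isFiniteMeasure_withDensity (hfin r hr)
    have := isFiniteMeasure_withDensity (hfin (fun x => -r x) hr.neg)
    apply Measure.ext_of_charFunDual
    funext L
    rw [charFunDual_apply, charFunDual_apply,
      integral_withDensity_eq_integral_toReal_smul (by fun_prop) (by simp),
      integral_withDensity_eq_integral_toReal_smul (by fun_prop) (by simp), ← sub_eq_zero]
    have hb : ∀ q : E → ℝ, Integrable q ν → Integrable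
        (fun x => (ENNReal.ofReal (q x)).toReal • cexp (L x * I)) ν := by
      intro q hq
      have h0 : Integrable (fun x => (ENNReal.ofReal (q x)).toReal) ν := by
        simpa [ENNReal.toReal_ofReal'] using hq.pos_part
      simp only [Complex.real_smul]
      refine h0.ofReal.mul_bdd (c := 1) (by fun_prop) (Filter.Eventually.of_forall fun x => ?_)
      rw [Complex.norm_exp_ofReal_mul_I]
    rw [← integral_sub (hb r hr) (hb (fun x => -r x) hr.neg), ← h L]
    refine integral_congr_ae (Filter.Eventually.of_forall fun x => ?_)
    simp only [ENNReal.toReal_ofReal', Complex.real_smul]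
    rw [← sub_mul, mul_comm, ← Complex.ofReal_sub]
    congr 2
    rcases le_total (r x) 0 with hx | hx
    · rw [max_eq_right hx, max_eq_left (by linarith)]; ring
    · rw [max_eq_left hx, max_eq_right (by linarith)]; ring
  rw [withDensity_eq_iff (by fun_prop) (by fun_prop) (hfin r hr)] at h1
  filter_upwards [h1] with x hx
  have h2 := congrArg ENNReal.toReal hx
  rw [ENNReal.toReal_ofReal', ENNReal.toReal_ofReal'] at h2
  rcases le_total (r x) 0 with hx | hx
  · rw [max_eq_right hx, max_eq_left (by linarith)] at h2
    simp only [Pi.zero_apply]; linarith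
  · rw [max_eq_left hx, max_eq_right (by linarith)] at h2
    simpa using h2

theorem memLp_char (ν : Measure E) [IsFiniteMeasure ν] (L : StrongDual ℝ E) :
    MemLp (fun x => cexp (L x * I)) 2 ν :=
  MemLp.of_bound (by fun_prop) 1 (Filter.Eventually.of_forall fun x => by
    rw [Complex.norm_exp_ofReal_mul_I])

/-- The character `exp (i L)` as an element of `L²`. -/
def charLp (μ : Measure E) [IsFiniteMeasure μ] (L : StrongDual ℝ E) : Lp ℂ 2 μ :=
  (memLp_char μ L).toLp _

theorem memLp_dual_complex (μ : Measure E) [IsGaussian μ] (L : StrongDual ℝ E) :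
    MemLp (fun x => (L x : ℂ)) 2 μ :=
  (IsGaussian.memLp_dual μ L 2 (by simp)).ofReal

/-- A continuous linear functional as an element of `L²`. -/
def dualLp (μ : Measure E) [IsGaussian μ] (L : StrongDual ℝ E) : Lp ℂ 2 μ :=
  (memLp_dual_complex μ L).toLp _

theorem inner_toLp {α : Type*} [MeasurableSpace α] {ν : Measure α} {f g : α → ℂ}
    (hf : MemLp f 2 ν) (hg : MemLp g 2 ν) :
    inner ℂ (hf.toLp f) (hg.toLp g) = ∫ x, star (f x) * g x ∂ν := by
  rw [L2.inner_def]
  refine integral_congr_ae ?_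
  filter_upwards [hf.coeFn_toLp, hg.coeFn_toLp] with x h1 h2
  rw [h1, h2, RCLike.inner_apply, mul_comm]
  rfl

theorem inner_charLp_eq (ν : Measure E) [IsFiniteMeasure ν] (L : StrongDual ℝ E) (f : Lp ℂ 2 ν) :
    inner ℂ (charLp ν L) f = ∫ x, cexp ((-L) x * I) * f x ∂ν := by
  have h : f = (Lp.memLp f).toLp f := (Lp.toLp_coeFn f _).symm
  conv_lhs => rw [h, charLp, inner_toLp]
  refine integral_congr_ae (Filter.Eventually.of_forall fun x => ?_)
  simp only [Complex.star_def, ← Complex.exp_conj]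
  simp

theorem eq_zero_of_inner_charLp (ν : Measure E) [IsFiniteMeasure ν] {f : Lp ℂ 2 ν}
    (h : ∀ L, inner ℂ (charLp ν L) f = 0) : f = 0 := by
  have hint : Integrable f ν := (Lp.memLp f).integrable (by norm_num)
  have hb : ∀ (L : StrongDual ℝ E) (q : E → ℂ), Integrable q ν →
      Integrable (fun x => cexp (L x * I) * q x) ν := fun L q hq =>
    hq.bdd_mul (c := 1) (by fun_prop) (Filter.Eventually.of_forall fun x => by
      rw [Complex.norm_exp_ofReal_mul_I])
  have h1 : ∀ L : StrongDual ℝ E, ∫ x, cexp (L x * I) * f x ∂ν = 0 := fun L => by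
    have := h (-L)
    rwa [inner_charLp_eq, neg_neg] at this
  have h2 : ∀ L : StrongDual ℝ E, ∫ x, cexp (L x * I) * star (f x) ∂ν = 0 := fun L => by
    have := congrArg star (h1 (-L))
    rw [Complex.star_def, ← integral_conj] at this
    rw [map_zero] at this
    rw [← this]
    refine integral_congr_ae (Filter.Eventually.of_forall fun x => ?_)
    simp only [map_mul, ← Complex.exp_conj]
    simp
  have hs : Integrable (fun x => star (f x)) ν :=
    (LinearIsometryEquiv.integrable_comp_iff Complex.conjLIE).2 hint
  have hfm : Measurable f := (Lp.stronglyMeasurable f).measurable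
  have hre : (fun x => (f x).re) =ᵐ[ν] 0 := by
    refine ae_eq_zero_of_integral_char_eq_zero ν hint.re (by fun_prop) fun L => ?_
    have : ∀ x, cexp (L x * I) * ((f x).re : ℂ) =
        (1 / 2 : ℂ) * (cexp (L x * I) * f x + cexp (L x * I) * star (f x)) := fun x => by
      rw [Complex.re_eq_add_conj, Complex.star_def]; ring
    simp_rw [this]
    rw [integral_const_mul, integral_add (hb L _ hint) (hb L _ hs), h1, h2]; simp
  have him : (fun x => (f x).im) =ᵐ[ν] 0 := by
    refine ae_eq_zero_of_integral_char_eq_zero ν hint.im (by fun_prop) fun L => ?_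
    have : ∀ x, cexp (L x * I) * ((f x).im : ℂ) =
        (1 / (2 * I) : ℂ) * (cexp (L x * I) * f x - cexp (L x * I) * star (f x)) := fun x => by
      rw [Complex.im_eq_sub_conj, Complex.star_def]; ring
    simp_rw [this]
    rw [integral_const_mul, integral_sub (hb L _ hint) (hb L _ hs), h1, h2]; simp
  rw [Lp.eq_zero_iff_ae_eq_zero]
  filter_upwards [hre, him] with x h3 h4
  exact Complex.ext h3 h4

theorem dense_span_charLp (ν : Measure E) [IsFiniteMeasure ν] :
    Dense (Submodule.span ℂ (Set.range (charLp ν)) : Set (Lp ℂ 2 ν)) := by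
  rw [Submodule.dense_iff_topologicalClosure_eq_top, Submodule.topologicalClosure_eq_top_iff,
    Submodule.eq_bot_iff]
  intro f hf
  refine eq_zero_of_inner_charLp ν fun L => ?_
  exact (Submodule.mem_orthogonal _ _).1 hf _ (Submodule.subset_span ⟨L, rfl⟩)

/-- The linear map `(x, y) ↦ c x + s y`. -/
def mixMap (E : Type*) [NormedAddCommGroup E] [NormedSpace ℝ E] (c s : ℝ) : E × E →L[ℝ] E :=
  c • ContinuousLinearMap.fst ℝ E E + s • ContinuousLinearMap.snd ℝ E E

theorem mixMap_apply (c s : ℝ) (p : E × E) : mixMap E c s p = c • p.1 + s • p.2 := rfl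

theorem variance_smul_dual (c : ℝ) (L : StrongDual ℝ E) : Var[(c • L : StrongDual ℝ E); μ] =
    c ^ 2 * Var[L; μ] := variance_smul c L μ

variable (hμ : μ[id] = 0) {c s : ℝ} (hcs : c ^ 2 + s ^ 2 = 1)
include hμ hcs

/-- The variances of c L and s L add up to (c² + s²) Var L = Var L. -/
theorem measurePreserving_mixMap : MeasurePreserving (mixMap E c s) (μ.prod μ) μ := by
  refine ⟨by fun_prop, ?_⟩
  apply Measure.ext_of_charFunDual
  funext L
  rw [charFunDual_map, charFunDual_prod]
  have h1 : (L.comp (mixMap E c s)).comp (.inl ℝ E E) = c • L := by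
    ext x; simp [mixMap]
  have h2 : (L.comp (mixMap E c s)).comp (.inr ℝ E E) = s • L := by
    ext x; simp [mixMap]
  rw [h1, h2, IsGaussian.charFunDual_eq_of_integral_eq_zero hμ,
    IsGaussian.charFunDual_eq_of_integral_eq_zero hμ,
    IsGaussian.charFunDual_eq_of_integral_eq_zero hμ, variance_smul_dual, variance_smul_dual,
    ← Complex.exp_add]
  congr 1
  have : ((c ^ 2 + s ^ 2 : ℝ) : ℂ) = 1 := by rw [hcs]; simp
  push_cast at this ⊢
  linear_combination (-(Var[L; μ] : ℂ) / 2) * this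

/-- The Mehler operator on `L²(μ)`, in weak form. -/
def mehler : Lp ℂ 2 μ →L[ℂ] Lp ℂ 2 μ :=
  (ContinuousLinearMap.adjoint (Lp.compMeasurePreservingₗᵢ (p := 2) (E := ℂ) ℂ Prod.fst
    (measurePreserving_fst (μ := μ) (ν := μ))).toContinuousLinearMap).comp
  (Lp.compMeasurePreservingₗᵢ (p := 2) (E := ℂ) ℂ (mixMap E c s)
    (measurePreserving_mixMap hμ hcs)).toContinuousLinearMap

theorem inner_mehler (a b : Lp ℂ 2 μ) : inner ℂ a (mehler hμ hcs b) =
    inner ℂ (Lp.compMeasurePreserving Prod.fst (measurePreserving_fst (μ := μ) (ν := μ)) a)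
      (Lp.compMeasurePreserving (mixMap E c s) (measurePreserving_mixMap hμ hcs) b) := by
  rw [mehler, ContinuousLinearMap.comp_apply, ContinuousLinearMap.adjoint_inner_right]
  rfl

theorem inner_mehler_toLp {a b : E → ℂ} (ha : MemLp a 2 μ) (hb : MemLp b 2 μ) :
    inner ℂ (ha.toLp a) (mehler hμ hcs (hb.toLp b)) =
      ∫ p, star (a p.1) * b (c • p.1 + s • p.2) ∂(μ.prod μ) := by
  rw [inner_mehler, Lp.toLp_compMeasurePreserving, Lp.toLp_compMeasurePreserving, inner_toLp]
  rfl

omit hcs in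
theorem inner_charLp_charLp (L M : StrongDual ℝ E) : inner ℂ (charLp μ L) (charLp μ M) =
    cexp (-(Var[L; μ] + Var[M; μ]) / 2 + cov[L, M; μ]) := by
  have h1 : inner ℂ (charLp μ L) (charLp μ M) = charFunDual μ (M - L) := by
    rw [charLp, charLp, inner_toLp, charFunDual_apply]
    refine integral_congr_ae (Filter.Eventually.of_forall fun x => ?_)
    simp only [Complex.star_def, ← Complex.exp_conj]
    rw [← Complex.exp_add]
    congr 1
    simp
    ring
  have h2 : Var[(M - L : StrongDual ℝ E); μ] = Var[M; μ] - 2 * cov[M, L; μ] + Var[L; μ] :=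
    variance_sub (IsGaussian.memLp_dual μ M 2 (by simp)) (IsGaussian.memLp_dual μ L 2 (by simp))
  rw [h1, IsGaussian.charFunDual_eq_of_integral_eq_zero hμ, h2, covariance_comm]
  congr 1
  push_cast
  ring

theorem inner_charLp_mehler (L M : StrongDual ℝ E) :
    inner ℂ (charLp μ L) (mehler hμ hcs (charLp μ M)) =
      cexp (-(Var[L; μ] + Var[M; μ]) / 2 + c * cov[L, M; μ]) := by
  have h1 : inner ℂ (charLp μ L) (mehler hμ hcs (charLp μ M)) =
      charFunDual (μ.prod μ)
        (M.comp (mixMap E c s) - L.comp (ContinuousLinearMap.fst ℝ E E)) := by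
    rw [charLp, charLp, inner_mehler_toLp, charFunDual_apply]
    refine integral_congr_ae (Filter.Eventually.of_forall fun x => ?_)
    simp only [Complex.star_def, ← Complex.exp_conj]
    rw [← Complex.exp_add]
    congr 1
    simp [mixMap_apply]
    ring
  have h2 : (M.comp (mixMap E c s) - L.comp (ContinuousLinearMap.fst ℝ E E)).comp (.inl ℝ E E) =
      c • M - L := by
    ext x; simp [mixMap]
  have h3 : (M.comp (mixMap E c s) - L.comp (ContinuousLinearMap.fst ℝ E E)).comp (.inr ℝ E E) =
      s • M := by
    ext x; simp [mixMap]
  have h4 : Var[(c • M - L : StrongDual ℝ E); μ] =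
      Var[(c • M : StrongDual ℝ E); μ] - 2 * cov[(c • M : StrongDual ℝ E), L; μ] + Var[L; μ] :=
    variance_sub (IsGaussian.memLp_dual μ (c • M) 2 (by simp))
      (IsGaussian.memLp_dual μ L 2 (by simp))
  have h5 : cov[(c • M : StrongDual ℝ E), L; μ] = c * cov[L, M; μ] := by
    rw [covariance_comm]; exact covariance_smul_right c
  rw [h1, charFunDual_prod, h2, h3, IsGaussian.charFunDual_eq_of_integral_eq_zero hμ,
    IsGaussian.charFunDual_eq_of_integral_eq_zero hμ, h4, h5, variance_smul_dual,
    variance_smul_dual, ← Complex.exp_add]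
  congr 1
  have : ((c ^ 2 + s ^ 2 : ℝ) : ℂ) = 1 := by rw [hcs]; simp
  push_cast at this ⊢
  linear_combination (-(Var[M; μ] : ℂ) / 2) * this

omit hμ hcs in
theorem eq_of_inner_charLp {f g : Lp ℂ 2 μ}
    (h : ∀ L, inner ℂ (charLp μ L) f = inner ℂ (charLp μ L) g) : f = g := by
  rw [← sub_eq_zero]
  refine eq_zero_of_inner_charLp μ fun L => ?_
  rw [inner_sub_right, h, sub_self]

/-- Characters are mapped to multiples of characters. As they span a dense subspace, symmetry and
the semigroup law need only be checked on this formula and its inner products, with no Hermite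
expansion. -/
theorem mehler_charLp (M : StrongDual ℝ E) : mehler hμ hcs (charLp μ M) =
    cexp (-(s ^ 2 * Var[M; μ]) / 2) • charLp μ (c • M) := by
  refine eq_of_inner_charLp fun L => ?_
  have h5 : cov[L, (c • M : StrongDual ℝ E); μ] = c * cov[L, M; μ] := covariance_smul_right c
  rw [inner_charLp_mehler, inner_smul_right, inner_charLp_charLp hμ, ← Complex.exp_add,
    variance_smul_dual, h5]
  congr 1
  have : ((c ^ 2 + s ^ 2 : ℝ) : ℂ) = 1 := by rw [hcs]; simp
  push_cast at this ⊢
  linear_combination ((Var[M; μ] : ℂ) / 2) * this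

theorem inner_mehler_comm (a b : Lp ℂ 2 μ) :
    inner ℂ (mehler hμ hcs a) b = inner ℂ a (mehler hμ hcs b) := by
  have h : ContinuousLinearMap.adjoint (mehler hμ hcs) = mehler hμ hcs := by
    refine ContinuousLinearMap.ext_on (dense_span_charLp μ) ?_
    rintro _ ⟨M, rfl⟩
    refine eq_of_inner_charLp fun L => ?_
    rw [ContinuousLinearMap.adjoint_inner_right, ← inner_conj_symm, inner_charLp_mehler,
      inner_charLp_mehler, ← Complex.exp_conj, covariance_comm]
    congr 1
    simp [map_ofNat]
    ring
  conv_lhs => rw [← h]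
  rw [ContinuousLinearMap.adjoint_inner_left]

theorem mehler_mehler {s' : ℝ} (hcs' : (c ^ 2) ^ 2 + s' ^ 2 = 1) (b : Lp ℂ 2 μ) :
    mehler hμ hcs (mehler hμ hcs b) = mehler hμ hcs' b := by
  have h : (mehler hμ hcs).comp (mehler hμ hcs) = mehler hμ hcs' := by
    refine ContinuousLinearMap.ext_on (dense_span_charLp μ) ?_
    rintro _ ⟨M, rfl⟩
    rw [ContinuousLinearMap.comp_apply, mehler_charLp, map_smul, mehler_charLp, mehler_charLp,
      smul_smul, smul_smul, ← pow_two, ← Complex.exp_add, variance_smul_dual]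
    congr 2
    have h1 : ((c ^ 2 + s ^ 2 : ℝ) : ℂ) = 1 := by rw [hcs]; simp
    have h2 : (((c ^ 2) ^ 2 + s' ^ 2 : ℝ) : ℂ) = 1 := by rw [hcs']; simp
    push_cast at h1 h2 ⊢
    linear_combination (Var[M; μ] / 2 : ℂ) * (h2 - h1 - c ^ 2 * h1)
  exact congrArg (fun T : Lp ℂ 2 μ →L[ℂ] Lp ℂ 2 μ => T b) h

/-- Writing T_c for the operator, symmetry and T_c T_c = T_{c²} give ‖T_c b‖² = ⟨b, T_{c²} b⟩. -/
theorem norm_mehler_sq_le {s' : ℝ} (hcs' : (c ^ 2) ^ 2 + s' ^ 2 = 1) (b : Lp ℂ 2 μ) :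
    ‖mehler hμ hcs b‖ ^ 2 ≤ ‖b‖ * ‖mehler hμ hcs' b‖ := by
  have h := norm_inner_le_norm (𝕜 := ℂ) b (mehler hμ hcs' b)
  rw [← mehler_mehler hμ hcs hcs', ← inner_mehler_comm, inner_self_eq_norm_sq_to_K, norm_pow,
    RCLike.norm_ofReal, abs_norm, mehler_mehler hμ hcs hcs'] at h
  exact h

/-- The closed subspace of `L²` orthogonal to constants and linear functionals. -/
def secondChaos (μ : Measure E) [IsGaussian μ] : Submodule ℂ (Lp ℂ 2 μ) :=
  (Submodule.span ℂ ({charLp μ 0} ∪ Set.range (dualLp μ)))ᗮ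

omit hμ hcs in
theorem mem_secondChaos_iff {w : Lp ℂ 2 μ} : w ∈ secondChaos μ ↔
    inner ℂ (charLp μ 0) w = 0 ∧ ∀ L, inner ℂ (dualLp μ L) w = 0 := by
  constructor
  · intro h
    exact ⟨(Submodule.mem_orthogonal _ _).1 h _ (Submodule.subset_span (Or.inl rfl)),
      fun L => (Submodule.mem_orthogonal _ _).1 h _ (Submodule.subset_span (Or.inr ⟨L, rfl⟩))⟩
  · rintro ⟨h1, h2⟩
    rw [secondChaos, Submodule.mem_orthogonal]
    intro u hu
    induction hu using Submodule.span_induction with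
    | mem x hx =>
      rcases hx with hx | ⟨L, rfl⟩
      · rw [Set.mem_singleton_iff.1 hx, h1]
      · exact h2 L
    | zero => simp
    | add x y _ _ hx hy => rw [inner_add_left, hx, hy, add_zero]
    | smul a x _ hx => rw [inner_smul_left, hx, mul_zero]

theorem mehler_dualLp (L : StrongDual ℝ E) : mehler hμ hcs (dualLp μ L) = (c : ℂ) • dualLp μ L := by
  refine eq_of_inner_charLp fun M => ?_
  have hi1 : Integrable (fun x => star (cexp (M x * I)) * (L x : ℂ)) μ := by
    have h := (memLp_dual_complex μ L).integrable (by norm_num)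
    refine h.bdd_mul (c := 1) (by fun_prop) (Filter.Eventually.of_forall fun x => ?_)
    rw [norm_star, Complex.norm_exp_ofReal_mul_I]
  have hi2 : Integrable (fun x => star (cexp (M x * I))) μ :=
    Integrable.of_bound (C := 1) (by fun_prop) (Filter.Eventually.of_forall fun x => by
      rw [norm_star, Complex.norm_exp_ofReal_mul_I])
  have hi3 := (memLp_dual_complex μ L).integrable (by norm_num)
  rw [inner_smul_right, charLp, dualLp, inner_mehler_toLp, inner_toLp]
  have h1 : ∀ p : E × E, star (cexp (M p.1 * I)) * ((L (c • p.1 + s • p.2) : ℝ) : ℂ) =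
      c * (star (cexp (M p.1 * I)) * (L p.1 : ℂ)) +
      s * (star (cexp (M p.1 * I)) * (L p.2 : ℂ)) := fun p => by
    rw [map_add, map_smul, map_smul]; push_cast [smul_eq_mul]; ring
  simp_rw [h1]
  rw [integral_add ((hi1.comp_fst _).const_mul _) ((hi2.mul_prod hi3).const_mul _),
    integral_const_mul, integral_const_mul, integral_prod_mul (fun x => star (cexp (M x * I)))
      (fun y => (L y : ℂ)), integral_complex_ofReal, IsGaussian.integral_dual,
      integral_fun_fst (μ := μ) (ν := μ) (fun x => star (cexp (M x * I)) * (L x : ℂ))]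
  simp only [id] at hμ
  rw [hμ]
  simp

theorem mehler_mem_secondChaos {w : Lp ℂ 2 μ} (hw : w ∈ secondChaos μ) :
    mehler hμ hcs w ∈ secondChaos μ := by
  rw [mem_secondChaos_iff] at hw ⊢
  refine ⟨?_, fun L => ?_⟩
  · rw [← inner_mehler_comm, mehler_charLp, smul_zero, inner_smul_left, hw.1, mul_zero]
  · rw [← inner_mehler_comm, mehler_dualLp, inner_smul_left, hw.2, mul_zero]

omit hμ hcs in
theorem memLp_dual_sq (L : StrongDual ℝ E) : MemLp (fun x => L x ^ 2) 2 μ := by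
  have h := IsGaussian.memLp_dual μ L 4 (by simp)
  have := h.mul h (r := 2) (hpqr := ⟨by
    rw [← two_mul, show (4 : ℝ≥0∞) = 2 * 2 by norm_num, ENNReal.mul_inv (by simp) (by simp),
      ← mul_assoc, ENNReal.mul_inv_cancel (by simp) (by simp), one_mul]⟩)
  convert this using 2 with x
  simp [pow_two]

-- The second-order Taylor remainder of exp(i c M), measured in L²: a character is affine up to
-- O(c²), and the affine part is invisible to `secondChaos`.
omit hμ hcs in
theorem exists_norm_charLp_sub_le (M : StrongDual ℝ E) : ∃ K : ℝ, ∀ c : ℝ,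
    ‖charLp μ (c • M) - charLp μ 0 - (c * I : ℂ) • dualLp μ M‖ ≤ K * c ^ 2 := by
  refine ⟨3 * ‖(memLp_dual_sq M).toLp (μ := μ) _‖, fun c => ?_⟩
  have h : ‖charLp μ (c • M) - charLp μ 0 - (c * I : ℂ) • dualLp μ M‖ ≤
      (3 * c ^ 2) * ‖(memLp_dual_sq M).toLp (μ := μ) _‖ := by
    apply Lp.norm_le_mul_norm_of_ae_le_mul
    filter_upwards [Lp.coeFn_sub (charLp μ (c • M) - charLp μ 0) ((c * I : ℂ) • dualLp μ M),
      Lp.coeFn_sub (charLp μ (c • M)) (charLp μ 0), Lp.coeFn_smul (c * I : ℂ) (dualLp μ M),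
      (memLp_char μ (c • M)).coeFn_toLp, (memLp_char μ 0).coeFn_toLp,
      (memLp_dual_complex μ M).coeFn_toLp, (memLp_dual_sq M (μ := μ)).coeFn_toLp]
      with x h1 h2 h3 h4 h5 h6 h7
    rw [h1, Pi.sub_apply, h2, Pi.sub_apply, h3, Pi.smul_apply, h7]
    simp only [charLp, dualLp] at h4 h5 h6 ⊢
    rw [h4, h5, h6]
    have := norm_exp_mul_I_sub_one_sub_le (c * M x)
    simp only [smul_apply, zero_apply, smul_eq_mul, ofReal_zero, zero_mul,
      Complex.exp_zero, norm_pow, Real.norm_eq_abs, sq_abs]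
    calc _ = ‖cexp (((c * M x : ℝ) : ℂ) * I) - 1 - ((c * M x : ℝ) : ℂ) * I‖ := by
          congr 2; push_cast; ring
      _ ≤ _ := this
      _ = _ := by ring
  linarith

-- A crude bound of the right order c², with a constant depending on w and f. It comes from the
-- Taylor expansion of the characters composing f; `le_mul_sq_of_sq_le` later removes the constant.
omit hμ hcs in
theorem exists_norm_inner_mehler_le (hμ : μ[id] = 0) {w f : Lp ℂ 2 μ} (hw : w ∈ secondChaos μ)
    (hf : f ∈ Submodule.span ℂ (Set.range (charLp μ))) : ∃ K : ℝ, ∀ (c s : ℝ)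
      (hcs : c ^ 2 + s ^ 2 = 1), ‖inner ℂ w (mehler hμ hcs f)‖ ≤ K * c ^ 2 := by
  rw [mem_secondChaos_iff] at hw
  induction hf using Submodule.span_induction with
  | mem x hx =>
    obtain ⟨M, rfl⟩ := hx
    obtain ⟨K, hK⟩ := exists_norm_charLp_sub_le (μ := μ) M
    refine ⟨‖w‖ * K, fun c s hcs => ?_⟩
    have h1 : inner ℂ w (charLp μ (c • M)) =
        inner ℂ w (charLp μ (c • M) - charLp μ 0 - (c * I : ℂ) • dualLp μ M) := by
      rw [inner_sub_right, inner_sub_right, inner_smul_right, ← inner_conj_symm w (charLp μ 0),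
        ← inner_conj_symm w (dualLp μ M), hw.1, hw.2]
      simp
    rw [mehler_charLp, inner_smul_right, norm_mul, h1]
    have h2 : ‖cexp (-(s ^ 2 * Var[M; μ]) / 2)‖ ≤ 1 := by
      have : (-(s ^ 2 * Var[M; μ]) / 2 : ℂ) = ((-(s ^ 2 * Var[M; μ]) / 2 : ℝ) : ℂ) := by
        push_cast; ring
      rw [this, Complex.norm_exp_ofReal, Real.exp_le_one_iff]
      have := mul_nonneg (sq_nonneg s) (variance_nonneg M μ)
      linarith
    calc _ ≤ 1 * (‖w‖ * ‖charLp μ (c • M) - charLp μ 0 - (c * I : ℂ) • dualLp μ M‖) := by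
          gcongr; exact norm_inner_le_norm _ _
      _ ≤ 1 * (‖w‖ * (K * c ^ 2)) := by gcongr; exact hK c
      _ = _ := by ring
  | zero => exact ⟨0, fun c s hcs => by simp⟩
  | add x y _ _ hx hy =>
    obtain ⟨K, hK⟩ := hx
    obtain ⟨K', hK'⟩ := hy
    refine ⟨K + K', fun c s hcs => ?_⟩
    rw [map_add, inner_add_right, add_mul]
    exact (norm_add_le _ _).trans (add_le_add (hK c s hcs) (hK' c s hcs))
  | smul a x _ hx =>
    obtain ⟨K, hK⟩ := hx
    refine ⟨‖a‖ * K, fun c s hcs => ?_⟩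
    rw [map_smul, inner_smul_right, norm_mul, mul_assoc]
    exact mul_le_mul_of_nonneg_left (hK c s hcs) (norm_nonneg _)

omit hμ hcs in
/-- A self-improving quadratic bound. -/
theorem le_mul_sq_of_sq_le {a : ℝ → ℝ} {N K : ℝ} (hN : 0 ≤ N) (ha : ∀ c, 0 ≤ a c)
    (h1 : ∀ c ∈ Set.Icc (0 : ℝ) 1, a c ^ 2 ≤ N * a (c ^ 2))
    (h2 : ∀ c ∈ Set.Icc (0 : ℝ) 1, a c ≤ K * c ^ 2) {c : ℝ} (hc : c ∈ Set.Icc (0 : ℝ) 1) :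
    a c ≤ N * c ^ 2 := by
  rcases hc.1.eq_or_lt with rfl | hc0
  · simpa using h2 0 hc
  rcases hN.eq_or_lt with rfl | hN0
  · have := h1 c hc
    rw [zero_mul] at this
    rw [zero_mul]
    nlinarith [ha c]
  by_contra hcon
  push Not at hcon
  -- Replacing c by c² at least squares the ratio a(c) / (N c²). If it exceeded 1 at some c,
  -- iteration would push it beyond the a priori bound K / N.
  have hpow : ∀ n : ℕ, (a c / (N * c ^ 2)) ^ (2 ^ n) ≤ a (c ^ 2 ^ n) / (N * (c ^ 2 ^ n) ^ 2) := by
    intro n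
    induction n with
    | zero => simp
    | succ n ih =>
      have hm : c ^ 2 ^ n ∈ Set.Icc (0 : ℝ) 1 := ⟨by positivity, pow_le_one₀ hc0.le hc.2⟩
      calc (a c / (N * c ^ 2)) ^ (2 ^ (n + 1)) = ((a c / (N * c ^ 2)) ^ (2 ^ n)) ^ 2 := by
            rw [← pow_mul, pow_succ 2 n]
        _ ≤ (a (c ^ 2 ^ n) / (N * (c ^ 2 ^ n) ^ 2)) ^ 2 := by
            have := ha c
            gcongr
        _ = a (c ^ 2 ^ n) ^ 2 / (N * (c ^ 2 ^ n) ^ 2) ^ 2 := by rw [div_pow]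
        _ ≤ (N * a ((c ^ 2 ^ n) ^ 2)) / (N * (c ^ 2 ^ n) ^ 2) ^ 2 := by
            gcongr; exact h1 _ hm
        _ = _ := by
            rw [← pow_mul, ← pow_succ]
            field_simp
  have hr : 1 < a c / (N * c ^ 2) := by rwa [one_lt_div (by positivity)]
  obtain ⟨n, hn⟩ := pow_unbounded_of_one_lt (K / N) hr
  have hm : c ^ 2 ^ n ∈ Set.Icc (0 : ℝ) 1 := ⟨by positivity, pow_le_one₀ hc0.le hc.2⟩
  have h3 : a (c ^ 2 ^ n) / (N * (c ^ 2 ^ n) ^ 2) ≤ K / N := by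
    rw [div_le_div_iff₀ (by positivity) hN0]
    have := h2 _ hm
    nlinarith
  have h4 : (a c / (N * c ^ 2)) ^ n ≤ (a c / (N * c ^ 2)) ^ (2 ^ n) :=
    pow_le_pow_right₀ hr.le (Nat.lt_two_pow_self).le
  linarith [hpow n]

instance : (secondChaos μ).HasOrthogonalProjection := by
  unfold secondChaos; infer_instance

-- The c² contraction on the second chaos: the crude bound is self-improved for projections of
-- combinations of characters. The resulting inequality no longer has a vector-dependent constant
-- other than the norm, so it passes to the closure.
omit hμ hcs in
theorem norm_mehler_le_of_mem (hμ : μ[id] = 0) {w : Lp ℂ 2 μ} (hw : w ∈ secondChaos μ)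
    {c s : ℝ} (hc : c ∈ Set.Icc (0 : ℝ) 1) (hcs : c ^ 2 + s ^ 2 = 1) :
    ‖mehler hμ hcs w‖ ≤ ‖w‖ * c ^ 2 := by
  have hsq : ∀ r : ℝ, |r| ≤ 1 → r ^ 2 + √(1 - r ^ 2) ^ 2 = 1 := fun r hr => by
    rw [Real.sq_sqrt (by rw [sub_nonneg, ← sq_abs]; exact pow_le_one₀ (abs_nonneg r) hr)]; ring
  have hdense : ∀ f ∈ Submodule.span ℂ (Set.range (charLp μ)),
      ‖mehler hμ hcs ((secondChaos μ).starProjection f)‖ ≤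
        ‖(secondChaos μ).starProjection f‖ * c ^ 2 := by
    intro f hf
    set w := (secondChaos μ).starProjection f with hw
    have hwm : w ∈ secondChaos μ := Submodule.starProjection_apply_mem _ f
    obtain ⟨K, hK⟩ := exists_norm_inner_mehler_le hμ hwm hf
    have hb : ∀ (c s : ℝ) (hcs : c ^ 2 + s ^ 2 = 1), ‖inner ℂ w (mehler hμ hcs w)‖ ≤ K * c ^ 2 := by
      intro c s hcs
      have h1 : inner ℂ w (mehler hμ hcs (f - w)) = 0 := by
        rw [← inner_mehler_comm]
        exact (Submodule.mem_orthogonal _ _).1 (Submodule.sub_starProjection_mem_orthogonal f) _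
          (mehler_mem_secondChaos hμ hcs hwm)
      have h2 := hK c s hcs
      rw [map_sub, inner_sub_right, sub_eq_zero] at h1
      rwa [h1] at h2
    let a : ℝ → ℝ := fun r => if hr : |r| ≤ 1 then ‖mehler hμ (hsq r hr) w‖ else 0
    -- The operator depends on s only through s² = 1 - r², so a is a function of r alone; its
    -- default value 0 for |r| > 1 is never used.
    have ha : ∀ (r s : ℝ) (hr : |r| ≤ 1) (h : r ^ 2 + s ^ 2 = 1), a r = ‖mehler hμ h w‖ := by
      intro r s hr h
      simp only [a, dif_pos hr]
      congr 1
      refine eq_of_inner_charLp fun M => ?_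
      rw [← inner_mehler_comm, ← inner_mehler_comm, mehler_charLp, mehler_charLp]
      have : √(1 - r ^ 2) ^ 2 = s ^ 2 := by linarith [hsq r hr]
      have h' : ((√(1 - r ^ 2) : ℝ) : ℂ) ^ 2 = (s : ℂ) ^ 2 := by exact_mod_cast this
      rw [h']
    have habs : ∀ r ∈ Set.Icc (0 : ℝ) 1, |r| ≤ 1 := fun r hr => by rw [abs_of_nonneg hr.1]; exact hr.2
    have hmul : ∀ r ∈ Set.Icc (0 : ℝ) 1, r ^ 2 ∈ Set.Icc (0 : ℝ) 1 := fun r hr =>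
      ⟨sq_nonneg r, pow_le_one₀ hr.1 hr.2⟩
    -- The constant √K arises from ‖T_r w‖² = ⟨w, T_{r²} w⟩ ≤ K r⁴.
    have hkey := le_mul_sq_of_sq_le (a := a) (N := ‖w‖) (K := √K) (norm_nonneg _)
      (fun r => by simp only [a]; split_ifs <;> positivity)
      (fun r hr => by
        rw [ha r _ (habs r hr) (hsq r (habs r hr)),
          ha _ _ (habs _ (hmul r hr)) (hsq _ (habs _ (hmul r hr)))]
        exact norm_mehler_sq_le hμ _ _ w)
      (fun r hr => by
        rw [ha r _ (habs r hr) (hsq r (habs r hr))]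
        have h3 := hb _ _ (hsq _ (habs _ (hmul r hr)))
        rw [← mehler_mehler hμ (hsq r (habs r hr)), ← inner_mehler_comm,
          inner_self_eq_norm_sq_to_K, norm_pow, RCLike.norm_ofReal, abs_norm] at h3
        have h4 := Real.sqrt_le_sqrt h3
        rwa [Real.sqrt_sq (norm_nonneg _), Real.sqrt_mul' _ (by positivity),
          Real.sqrt_sq (by positivity)] at h4) hc
    rwa [ha c s (habs c hc) hcs] at hkey
  have hall : ∀ f, ‖mehler hμ hcs ((secondChaos μ).starProjection f)‖ ≤
        ‖(secondChaos μ).starProjection f‖ * c ^ 2 := by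
    intro f
    have hcl : IsClosed {f : Lp ℂ 2 μ | ‖mehler hμ hcs ((secondChaos μ).starProjection f)‖ ≤
        ‖(secondChaos μ).starProjection f‖ * c ^ 2} :=
      isClosed_le (by fun_prop) (by fun_prop)
    have := hcl.closure_subset_iff.2 hdense
    exact this (dense_span_charLp μ f)
  have := hall w
  rwa [Submodule.starProjection_eq_self_iff.2 hw] at this

omit hcs in
/-- Spectral gap: correlated Gaussians have small correlation beyond the first chaos. -/
theorem norm_integral_mix_le {α b : E → ℂ} (hα : MemLp α 2 μ) (hb : MemLp b 2 μ)
    (h0 : ∫ x, b x ∂μ = 0) (h1 : ∀ L : StrongDual ℝ E, ∫ x, L x * b x ∂μ = 0)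
    {c s : ℝ} (hc : c ∈ Set.Icc (0 : ℝ) 1) (hcs : c ^ 2 + s ^ 2 = 1) :
    ‖∫ p, α p.1 * b (c • p.1 + s • p.2) ∂(μ.prod μ)‖ ≤
      c ^ 2 * √(∫ x, ‖α x‖ ^ 2 ∂μ) * √(∫ x, ‖b x‖ ^ 2 ∂μ) := by
  have hn : ∀ {f : E → ℂ} (hf : MemLp f 2 μ), ‖hf.toLp f‖ = √(∫ x, ‖f x‖ ^ 2 ∂μ) := by
    intro f hf
    rw [← Real.sqrt_sq (norm_nonneg (hf.toLp f))]
    congr 1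
    have h2 : ((‖hf.toLp f‖ ^ 2 : ℝ) : ℂ) = ((∫ x, ‖f x‖ ^ 2 ∂μ : ℝ) : ℂ) := by
      have := inner_self_eq_norm_sq_to_K (𝕜 := ℂ) (hf.toLp f)
      rw [inner_toLp] at this
      push_cast
      rw [← integral_complex_ofReal]
      refine this.symm.trans (integral_congr_ae (Filter.Eventually.of_forall fun x => ?_))
      simp [Complex.conj_mul']
    exact Complex.ofReal_injective h2
  have hmem : hb.toLp b ∈ secondChaos μ := by
    rw [mem_secondChaos_iff]
    refine ⟨?_, fun L => ?_⟩
    · rw [charLp, inner_toLp]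
      simpa using h0
    · rw [dualLp, inner_toLp, ← h1 L]
      simp
  have hle := norm_mehler_le_of_mem hμ hmem hc hcs
  have hαs : MemLp (fun x => star (α x)) 2 μ := hα.star
  have heq := inner_mehler_toLp hμ hcs hαs hb
  simp only [star_star] at heq
  have hαn : ‖hαs.toLp _‖ = √(∫ x, ‖α x‖ ^ 2 ∂μ) := by rw [hn]; simp
  calc _ = ‖inner ℂ (hαs.toLp _) (mehler hμ hcs (hb.toLp b))‖ := by rw [heq]
    _ ≤ ‖hαs.toLp _‖ * ‖mehler hμ hcs (hb.toLp b)‖ := norm_inner_le_norm _ _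
    _ ≤ ‖hαs.toLp _‖ * (‖hb.toLp b‖ * c ^ 2) := by gcongr
    _ = _ := by rw [hαn, hn]; ring

end Mehler

/-! ### Essential supremum of continuous functions -/

section Haar

/-- The set where |f| is at most its essential supremum is closed and conull, hence dense when open
sets have positive measure, hence everything. -/
theorem eLpNorm_top_continuousMap {X : Type*} [TopologicalSpace X] [CompactSpace X]
    [MeasurableSpace X] [OpensMeasurableSpace X] (m : Measure X) [m.IsOpenPosMeasure]
    (f : C(X, ℂ)) : eLpNorm f ∞ m = ‖f‖ₑ := by
  rw [eLpNorm_exponent_top]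
  apply le_antisymm
  · refine essSup_le_of_ae_le _ (Filter.Eventually.of_forall fun t => ?_)
    exact enorm_le_iff_norm_le.2 (f.norm_coe_le_norm t)
  · set c := eLpNormEssSup f m with hc
    have h0 : ∀ᵐ t ∂m, ‖f t‖ₑ ≤ c := ae_le_eLpNormEssSup
    have hd : Dense {t | ‖f t‖ₑ ≤ c} := Measure.dense_of_ae h0
    have hcl : IsClosed {t | ‖f t‖ₑ ≤ c} := isClosed_le (by fun_prop) (by fun_prop)
    have hall : ∀ t, ‖f t‖ₑ ≤ c := fun t => by
      have : t ∈ closure {t | ‖f t‖ₑ ≤ c} := hd t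
      rwa [hcl.closure_eq] at this
    by_cases htop : c = ∞
    · rw [htop]; exact le_top
    · rw [← ENNReal.ofReal_toReal htop, ← ofReal_norm]
      refine ENNReal.ofReal_le_ofReal ((ContinuousMap.norm_le _ ENNReal.toReal_nonneg).2 fun t => ?_)
      have := ENNReal.toReal_mono htop (hall t)
      simpa using this

end Haar


/-! ### Schur's lemma and Schur orthogonality -/

section Schur

variable {G : Type*} [Group G] [TopologicalSpace G]

theorem Irrep.mat_mul (π : Irrep G) (s t : G) : π.mat (s * t) = π.mat s * π.mat t := by
  simp [Irrep.mat]

theorem Irrep.mat_one (π : Irrep G) : π.mat 1 = 1 := by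
  simp [Irrep.mat]

theorem Irrep.mat_mem (π : Irrep G) (t : G) : π.mat t ∈ Matrix.unitaryGroup (Fin π.dim) ℂ :=
  (π.hom t).2

theorem Irrep.mat_mul_mat_inv (π : Irrep G) (t : G) : π.mat t * π.mat t⁻¹ = 1 := by
  rw [← π.mat_mul, mul_inv_cancel, π.mat_one]

theorem Irrep.mat_inv_mul_mat (π : Irrep G) (t : G) : π.mat t⁻¹ * π.mat t = 1 := by
  rw [← π.mat_mul, inv_mul_cancel, π.mat_one]

theorem Irrep.linearRep_apply (π : Irrep G) (t : G) :
    linearRep π.hom t = Matrix.toLin' (π.mat t) := rfl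

@[fun_prop]
theorem Irrep.continuous_mat (π : Irrep G) : Continuous π.mat :=
  continuous_subtype_val.comp π.continuous_hom

@[fun_prop]
theorem Irrep.continuous_mat_apply (π : Irrep G) (i j : Fin π.dim) :
    Continuous fun t => π.mat t i j := by
  have := π.continuous_mat
  fun_prop

/-- Schur's lemma in matrix form: no intertwiners between inequivalent representations. -/
theorem eq_zero_of_intertwines {π σ : Irrep G} (h : π.cls ≠ σ.cls)
    {M : Matrix (Fin π.dim) (Fin σ.dim) ℂ} (hM : ∀ t, π.mat t * M = M * σ.mat t) : M = 0 := by
  let f : (linearRep σ.hom).IntertwiningMap (linearRep π.hom) :=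
    { toLinearMap := Matrix.toLin' M
      isIntertwining' := fun t => by
        rw [Irrep.linearRep_apply, Irrep.linearRep_apply, ← Matrix.toLin'_mul,
          ← Matrix.toLin'_mul, hM] }
  have := π.irreducible
  have := σ.irreducible
  rcases Representation.IsIrreducible.bijective_or_eq_zero f with hf | hf
  · have hr : (irrepSetoid G).r π σ := ⟨(f.ofBijective hf).symm⟩
    exact absurd (Quotient.sound hr) h
  · have h1 : f.toLinearMap = 0 := by rw [hf]; rfl
    exact (LinearEquiv.map_eq_zero_iff Matrix.toLin').1 h1

/-- Schur's lemma in matrix form: self-intertwiners are scalar. -/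
theorem eq_smul_one_of_intertwines {π : Irrep G}
    {M : Matrix (Fin π.dim) (Fin π.dim) ℂ} (hM : ∀ t, π.mat t * M = M * π.mat t) :
    ∃ c : ℂ, M = c • 1 := by
  let f : (linearRep π.hom).IntertwiningMap (linearRep π.hom) :=
    { toLinearMap := Matrix.toLin' M
      isIntertwining' := fun t => by
        rw [Irrep.linearRep_apply, ← Matrix.toLin'_mul, ← Matrix.toLin'_mul, hM] }
  have := π.irreducible
  have hb : Function.Bijective (algebraMap ℂ ((linearRep π.hom).IntertwiningMap (linearRep π.hom))) :=
    Representation.IsIrreducible.algebraMap_intertwiningMap_bijective_of_isAlgClosed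
  obtain ⟨c, hc⟩ := hb.2 f
  refine ⟨c, Matrix.toLin'.injective ?_⟩
  have h1 : Matrix.toLin' M = f.toLinearMap := rfl
  rw [h1, ← hc, map_smul, Matrix.toLin'_one]
  rfl

variable [IsTopologicalGroup G] [CompactSpace G] [MeasurableSpace G] [BorelSpace G]
  (m : Measure G) [m.IsHaarMeasure] [IsProbabilityMeasure m]

theorem integrable_continuous (f : G → ℂ) (hf : Continuous f) : Integrable f m :=
  hf.integrable_of_hasCompactSupport (HasCompactSupport.of_compactSpace f)

/-- The averaged elementary matrix. -/
def averageSingle (π σ : Irrep G) (e : Fin π.dim) (c : Fin σ.dim) :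
    Matrix (Fin π.dim) (Fin σ.dim) ℂ :=
  Matrix.of fun i b => ∫ s, π.mat s i e * σ.mat s⁻¹ c b ∂m

/-- Left invariance of Haar measure, under s ↦ t s. -/
theorem averageSingle_intertwines (π σ : Irrep G) (e : Fin π.dim) (c : Fin σ.dim) (t : G) :
    π.mat t * averageSingle m π σ e c = averageSingle m π σ e c * σ.mat t := by
  ext i b
  simp only [Matrix.mul_apply, averageSingle, Matrix.of_apply]
  have hint : ∀ j b, Integrable (fun s => π.mat s j e * σ.mat s⁻¹ c b) m := fun j b =>
    integrable_continuous m _ (by fun_prop)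
  simp_rw [← integral_const_mul, ← integral_mul_const]
  rw [← integral_finsetSum _ fun j _ => (hint j b).const_mul _,
    ← integral_finsetSum _ fun j _ => (hint i j).mul_const _]
  conv_rhs => rw [← integral_mul_left_eq_self _ t]
  refine integral_congr_ae (Filter.Eventually.of_forall fun s => ?_)
  have h1 : π.mat (t * s) i e = ∑ j, π.mat t i j * π.mat s j e := by
    rw [π.mat_mul, Matrix.mul_apply]
  have h2 : σ.mat s⁻¹ c b = ∑ j, σ.mat (t * s)⁻¹ c j * σ.mat t j b := by
    rw [← Matrix.mul_apply, ← σ.mat_mul, mul_inv_rev, inv_mul_cancel_right]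
  simp only [← mul_assoc]
  rw [← Finset.sum_mul, ← h1, h2, Finset.mul_sum]
  refine Finset.sum_congr rfl fun j _ => by ring

theorem integral_mat_mul_mat_inv_of_ne {π σ : Irrep G} (h : π.cls ≠ σ.cls)
    (i e : Fin π.dim) (c b : Fin σ.dim) : ∫ s, π.mat s i e * σ.mat s⁻¹ c b ∂m = 0 := by
  have := eq_zero_of_intertwines h (averageSingle_intertwines m π σ e c)
  exact congrFun (congrFun this i) b

theorem integral_mat_mul_mat_inv (π : Irrep G) (i e c b : Fin π.dim) :
    ∫ s, π.mat s i e * π.mat s⁻¹ c b ∂m = if i = b ∧ c = e then (π.dim : ℂ)⁻¹ else 0 := by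
  obtain ⟨a, ha⟩ := eq_smul_one_of_intertwines (averageSingle_intertwines m π π e c)
  have hd : (π.dim : ℂ) ≠ 0 := by
    have : 0 < π.dim := (Nat.zero_le _).trans_lt i.2
    exact_mod_cast this.ne'
  -- The scalar given by Schur's lemma is read off from the trace, as π(s⁻¹) π(s) = 1.
  have h1 : ∑ j, averageSingle m π π e c j j = if c = e then 1 else 0 := by
    simp only [averageSingle, Matrix.of_apply]
    rw [← integral_finsetSum _ fun j _ => integrable_continuous m _ (by fun_prop)]
    have : ∀ s, ∑ j, π.mat s j e * π.mat s⁻¹ c j = if c = e then 1 else 0 := fun s => by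
      have h2 := congrFun (congrFun (π.mat_inv_mul_mat s) c) e
      rw [Matrix.mul_apply, Matrix.one_apply] at h2
      rw [← h2]
      exact Finset.sum_congr rfl fun j _ => mul_comm _ _
    simp_rw [this]
    simp
  have h3 : a = if c = e then (π.dim : ℂ)⁻¹ else 0 := by
    rw [ha] at h1
    simp only [Matrix.smul_apply, Matrix.one_apply_eq, smul_eq_mul, mul_one, Finset.sum_const,
      Finset.card_univ, Fintype.card_fin, nsmul_eq_mul] at h1
    split_ifs at h1 ⊢
    · field_simp; linear_combination h1
    · exact (mul_eq_zero.1 h1).resolve_left hd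
  have h4 : ∫ s, π.mat s i e * π.mat s⁻¹ c b ∂m = averageSingle m π π e c i b := rfl
  rw [h4, ha, h3, Matrix.smul_apply, Matrix.one_apply, smul_eq_mul]
  by_cases hib : i = b <;> by_cases hce : c = e <;> simp [hib, hce]

end Schur

/-! ### Trigonometric polynomials and functionals on them -/

section TrigPoly

variable {G : Type*} [Group G] [TopologicalSpace G] {κ : Type*} [Fintype κ]

/-- The coefficient families of trigonometric polynomials with spectrum in `π`. -/
abbrev Coeff (π : κ → Irrep G) : Type _ := ∀ k, Matrix (Fin (π k).dim) (Fin (π k).dim) ℂ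

/-- The bilinear pairing `∑ d_k tr (x_k y_k)`. -/
def pairing (π : κ → Irrep G) (x y : Coeff π) : ℂ :=
  ∑ k, ((π k).dim : ℂ) * Matrix.trace (x k * y k)

/-- The family of matrices `π_k(t)`. -/
def evalMat (π : κ → Irrep G) (t : G) : Coeff π := fun k => (π k).mat t

/-- The trigonometric polynomial `∑ d_k tr (x_k π_k)`. -/
def trigPoly (π : κ → Irrep G) (x : Coeff π) : C(G, ℂ) :=
  ⟨fun t => pairing π x (evalMat π t), by unfold pairing evalMat; fun_prop⟩

/-- The norm `∑ d_k tr |x_k|`. -/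
def sumTraceNorm (π : κ → Irrep G) (x : Coeff π) : ℝ :=
  ∑ k, ((π k).dim : ℝ) * traceNorm (x k)

variable {π : κ → Irrep G}

theorem pairing_mul_left (x y z : Coeff π) : pairing π (x * y) z = pairing π x (y * z) := by
  simp [pairing, Matrix.mul_assoc]

theorem pairing_mul_comm (x y z : Coeff π) : pairing π (x * y) z = pairing π y (z * x) := by
  simp only [pairing, Pi.mul_apply]
  refine Finset.sum_congr rfl fun k _ => ?_
  rw [Matrix.mul_assoc, Matrix.trace_mul_comm, Matrix.mul_assoc]

theorem pairing_comm (x y : Coeff π) : pairing π x y = pairing π y x := by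
  simp only [pairing]
  refine Finset.sum_congr rfl fun k _ => ?_
  rw [Matrix.trace_mul_comm]

theorem pairing_add_left (x y z : Coeff π) :
    pairing π (x + y) z = pairing π x z + pairing π y z := by
  simp [pairing, Matrix.add_mul, mul_add, Finset.sum_add_distrib]

theorem pairing_smul_left (c : ℂ) (x z : Coeff π) :
    pairing π (c • x) z = c * pairing π x z := by
  simp only [pairing, Pi.smul_apply, Matrix.smul_mul, Matrix.trace_smul, smul_eq_mul,
    Finset.mul_sum]
  exact Finset.sum_congr rfl fun k _ => by ring

theorem trigPoly_apply (x : Coeff π) (t : G) : trigPoly π x t = pairing π x (evalMat π t) := rfl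

theorem evalMat_mul (s t : G) : evalMat π (s * t) = evalMat π s * evalMat π t := by
  funext k; exact (π k).mat_mul s t

theorem trigPoly_add (x y : Coeff π) : trigPoly π (x + y) = trigPoly π x + trigPoly π y := by
  ext t; exact pairing_add_left _ _ _

theorem trigPoly_smul (c : ℂ) (x : Coeff π) : trigPoly π (c • x) = c • trigPoly π x := by
  ext t; exact pairing_smul_left _ _ _

variable [CompactSpace G]

theorem norm_trigPoly_mul_evalMat_le (x : Coeff π) (s : G) :
    ‖trigPoly π (x * evalMat π s)‖ ≤ ‖trigPoly π x‖ := by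
  refine (ContinuousMap.norm_le _ (norm_nonneg _)).2 fun t => ?_
  rw [trigPoly_apply, pairing_mul_left, ← evalMat_mul]
  exact (trigPoly π x).norm_coe_le_norm (s * t)

theorem norm_trigPoly_evalMat_mul_le (x : Coeff π) (s : G) :
    ‖trigPoly π (evalMat π s * x)‖ ≤ ‖trigPoly π x‖ := by
  refine (ContinuousMap.norm_le _ (norm_nonneg _)).2 fun t => ?_
  rw [trigPoly_apply, pairing_mul_comm, ← evalMat_mul]
  exact (trigPoly π x).norm_coe_le_norm (t * s)

/-- Composition of two bounded functionals on the space of trigonometric polynomials. -/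
theorem norm_pairing_mul_le {p q : Coeff π} {C : ℝ} (hC : 0 ≤ C)
    (hp : ∀ x, ‖pairing π x p‖ ≤ C * ‖trigPoly π x‖)
    (hq : ∀ x, ‖pairing π x q‖ ≤ C * ‖trigPoly π x‖) (x : Coeff π) :
    ‖pairing π x (p * q)‖ ≤ C ^ 2 * ‖trigPoly π x‖ := by
  -- The value of this polynomial at t is the functional p applied to a translate of the polynomial
  -- of x; this is the bound for convolution.
  have h1 : ‖trigPoly π (x * p)‖ ≤ C * ‖trigPoly π x‖ := by
    refine (ContinuousMap.norm_le _ (by positivity)).2 fun t => ?_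
    rw [trigPoly_apply, pairing_comm, ← pairing_mul_left]
    exact (hp _).trans (mul_le_mul_of_nonneg_left (norm_trigPoly_evalMat_mul_le x t) hC)
  rw [← pairing_mul_left]
  calc _ ≤ C * ‖trigPoly π (x * p)‖ := hq _
    _ ≤ C * (C * ‖trigPoly π x‖) := by gcongr
    _ = _ := by ring

end TrigPoly

/-! ### Reduction to finite families; monotonicity and finite covers -/

section Reduction

variable {G : Type*} [Group G] [TopologicalSpace G] [CompactSpace G]

section Finite

variable {κ : Type*} [Fintype κ] (π : κ → Irrep G)

/-- The sample space of the Gaussian matrices attached to `π`. -/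
abbrev Block : Type _ := ∀ k, Fin (π k).dim → Fin (π k).dim → ℂ

variable {π}

/-- A sample, seen as a family of matrices. -/
def toCoeff (h : Block π) : Coeff π := fun k => Matrix.of (h k)

/-- The map `h ↦ ∑ d_k tr (x_k h_k π_k)`. -/
def trigPolyCLM (x : Coeff π) : Block π →L[ℂ] C(G, ℂ) :=
  LinearMap.toContinuousLinearMap
    { toFun := fun h => trigPoly π (x * toCoeff h)
      map_add' := fun h h' => by
        rw [← trigPoly_add]; congr 1; rw [← mul_add]; rfl
      map_smul' := fun c h => by
        rw [RingHom.id_apply, ← trigPoly_smul]; congr 1; rw [← mul_smul_comm]; rfl }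

theorem trigPolyCLM_apply (x : Coeff π) (h : Block π) :
    trigPolyCLM x h = trigPoly π (x * toCoeff h) := rfl

/-- The Gaussian law attached to `π`. -/
abbrev gaussianLaw (π : κ → Irrep G) : Measure (Block π) := gaussianProd fun k => (π k).dim

theorem integrable_trigPolyCLM (x : Coeff π) :
    Integrable (fun h => trigPolyCLM x h) (gaussianLaw π) :=
  (trigPolyCLM x).integrable_comp (IsGaussian.integrable_id (μ := gaussianLaw π))

/-- The expected norm of a random trigonometric polynomial. -/
def expNorm (x : Coeff π) : ℝ := ∫ h, ‖trigPolyCLM x h‖ ∂(gaussianLaw π)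

end Finite

variable [MeasurableSpace G] [BorelSpace G] (m : Measure G) {ι : Type*} (π : ι → Irrep G)

/-- The essential supremum of a sample of a random trigonometric polynomial. -/
def randNorm (s : Finset ι) (x : ∀ k, Matrix (Fin (π k).dim) (Fin (π k).dim) ℂ)
    (g : ∀ k, Fin (π k).dim → Fin (π k).dim → ℂ) : ℝ≥0∞ :=
  eLpNorm (fun t => ∑ k ∈ s, ((π k).dim : ℂ) *
    Matrix.trace (x k * Matrix.of (g k) * (π k).mat t)) ∞ m

theorem randNorm_eq [m.IsOpenPosMeasure] (s : Finset ι)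
    (x : ∀ k, Matrix (Fin (π k).dim) (Fin (π k).dim) ℂ)
    (g : ∀ k, Fin (π k).dim → Fin (π k).dim → ℂ) :
    randNorm m π s x g =
      ‖trigPolyCLM (π := fun k : s => π k) (fun k => x k) (fun k => g k)‖ₑ := by
  rw [randNorm, ← eLpNorm_top_continuousMap m]
  congr 1
  funext t
  rw [← Finset.sum_coe_sort s]
  rfl

theorem measurable_randNorm [m.IsOpenPosMeasure] (s : Finset ι)
    (x : ∀ k, Matrix (Fin (π k).dim) (Fin (π k).dim) ℂ) : Measurable (randNorm m π s x) := by
  have h1 : Measurable fun h : Block (fun k : s => π k) =>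
      ‖trigPolyCLM (π := fun k : s => π k) (fun k => x k) h‖ₑ := by
    have : Continuous fun h : Block (fun k : s => π k) =>
      ‖trigPolyCLM (π := fun k : s => π k) (fun k => x k) h‖ₑ := by fun_prop
    exact this.measurable
  have h2 : Measurable fun (g : ∀ k, Fin (π k).dim → Fin (π k).dim → ℂ) (k : s) => g k := by
    fun_prop
  have h3 : randNorm m π s x = (fun h : Block (fun k : s => π k) =>
      ‖trigPolyCLM (π := fun k : s => π k) (fun k => x k) h‖ₑ) ∘ fun g k => g k := by
    funext g; exact randNorm_eq m π s x g
  rw [h3]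
  exact h1.comp h2

theorem map_gaussianFamily_of_injective {α : Type*} (d : ι → ℕ) {j : α → ι}
    (hj : Function.Injective j) :
    (gaussianFamily d).map (fun g k => g (j k)) = gaussianFamily (fun k => d (j k)) :=
  Measure.map_infinitePi_infinitePi_of_inj hj

theorem gaussianFamily_eq_gaussianProd {κ : Type*} [Fintype κ] (d : κ → ℕ) :
    gaussianFamily d = gaussianProd d := Measure.infinitePi_eq_pi _

theorem lintegral_randNorm [m.IsOpenPosMeasure] (s : Finset ι)
    (x : ∀ k, Matrix (Fin (π k).dim) (Fin (π k).dim) ℂ) :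
    ∫⁻ g, randNorm m π s x g ∂(gaussianFamily fun k => (π k).dim) =
      ENNReal.ofReal (expNorm (π := fun k : s => π k) fun k => x k) := by
  rw [expNorm, ofReal_integral_norm_eq_lintegral_enorm (integrable_trigPolyCLM _), gaussianLaw,
    ← gaussianFamily_eq_gaussianProd,
    ← map_gaussianFamily_of_injective (fun k => (π k).dim) (Subtype.coe_injective (p := (· ∈ s))),
    lintegral_map (Continuous.measurable (by fun_prop)) (by fun_prop)]
  simp_rw [randNorm_eq]

/-- Extension by zero of a family of matrices. -/
def extendCoeff {s : Finset ι} (x : Coeff fun k : s => π k) :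
    ∀ k, Matrix (Fin (π k).dim) (Fin (π k).dim) ℂ :=
  open Classical in fun k => if h : k ∈ s then x ⟨k, h⟩ else 0

theorem extendCoeff_coe {s : Finset ι} (x : Coeff fun k : s => π k) :
    (fun k : s => extendCoeff π x k) = x := by
  funext k
  simp [extendCoeff]

/-- Passes to real inequalities over finite index types, uniformly in the finite subfamily;
coefficients are extended by zero. -/
theorem isSidon_iff [m.IsOpenPosMeasure] : IsSidon m (fun i => (π i).mat) ↔
    ∃ C : ℝ≥0, ∀ (s : Finset ι) (x : Coeff fun k : s => π k),
      sumTraceNorm _ x ≤ C * ‖trigPoly (fun k : s => π k) x‖ := by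
  have key : ∀ (C : ℝ≥0) (s : Finset ι) (x : ∀ k, Matrix (Fin (π k).dim) (Fin (π k).dim) ℂ),
      (ENNReal.ofReal (∑ k ∈ s, ((π k).dim : ℝ) * traceNorm (x k)) ≤
      C * eLpNorm (fun t => ∑ k ∈ s, ((π k).dim : ℂ) * Matrix.trace (x k * (π k).mat t)) ∞ m) ↔
      sumTraceNorm (fun k : s => π k) (fun k => x k) ≤
        C * ‖trigPoly (fun k : s => π k) (fun k => x k)‖ := by
    intro C s x
    have h1 : eLpNorm (fun t => ∑ k ∈ s, ((π k).dim : ℂ) * Matrix.trace (x k * (π k).mat t)) ∞ m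
        = ‖trigPoly (fun k : s => π k) (fun k => x k)‖ₑ := by
      rw [← eLpNorm_top_continuousMap m]
      congr 1
      funext t
      rw [← Finset.sum_coe_sort s]
      rfl
    rw [h1, ← ofReal_norm, ← ENNReal.ofReal_coe_nnreal, ← ENNReal.ofReal_mul C.coe_nonneg,
      ENNReal.ofReal_le_ofReal_iff (by positivity), ← Finset.sum_coe_sort s]
    rfl
  constructor
  · rintro ⟨C, hC⟩
    refine ⟨C, fun s x => ?_⟩
    have := (key C s (extendCoeff π x)).1 (hC s _)
    rwa [extendCoeff_coe] at this
  · rintro ⟨C, hC⟩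
    exact ⟨C, fun s x => (key C s x).2 (hC s _)⟩

theorem isRandomlySidon_iff [m.IsOpenPosMeasure] : IsRandomlySidon m (fun i => (π i).mat) ↔
    ∃ C : ℝ≥0, ∀ (s : Finset ι) (x : Coeff fun k : s => π k),
      sumTraceNorm _ x ≤ C * expNorm x := by
  have key : ∀ (C : ℝ≥0) (s : Finset ι) (x : ∀ k, Matrix (Fin (π k).dim) (Fin (π k).dim) ℂ),
      (ENNReal.ofReal (∑ k ∈ s, ((π k).dim : ℝ) * traceNorm (x k)) ≤
      C * ∫⁻ g, randNorm m π s x g ∂(gaussianFamily fun k => (π k).dim)) ↔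
      sumTraceNorm (fun k : s => π k) (fun k => x k) ≤
        C * expNorm (π := fun k : s => π k) (fun k => x k) := by
    intro C s x
    have h0 : 0 ≤ expNorm (π := fun k : s => π k) (fun k => x k) :=
      integral_nonneg fun _ => norm_nonneg _
    rw [lintegral_randNorm, ← ENNReal.ofReal_coe_nnreal, ← ENNReal.ofReal_mul C.coe_nonneg,
      ENNReal.ofReal_le_ofReal_iff (by positivity), ← Finset.sum_coe_sort s]
    rfl
  constructor
  · rintro ⟨C, hC⟩
    refine ⟨C, fun s x => ?_⟩
    have := (key C s (extendCoeff π x)).1 (hC s _)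
    rwa [extendCoeff_coe] at this
  · rintro ⟨C, hC⟩
    exact ⟨C, fun s x => (key C s x).2 (hC s _)⟩

-- Changing the sign of the matrices with index outside s preserves the law. The partial sum over s
-- is the mean of the sum over s' and of its sign-changed copy, so the triangle inequality applies.
open Classical in
theorem lintegral_randNorm_mono [m.IsOpenPosMeasure] {s s' : Finset ι} (hs : s ⊆ s')
    (x : ∀ k, Matrix (Fin (π k).dim) (Fin (π k).dim) ℂ) :
    ∫⁻ g, randNorm m π s x g ∂(gaussianFamily fun k => (π k).dim) ≤
      ∫⁻ g, randNorm m π s' x g ∂(gaussianFamily fun k => (π k).dim) := by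
  let σ : ∀ k, (Fin (π k).dim → Fin (π k).dim → ℂ) → (Fin (π k).dim → Fin (π k).dim → ℂ) :=
    fun k g => if k ∈ s then g else -g
  have hneg : ∀ k, MeasurePreserving (σ k) (gaussianMatrix (π k).dim) (gaussianMatrix (π k).dim) := by
    intro k
    by_cases hk : k ∈ s
    · simp only [σ, hk, if_true]
      exact MeasurePreserving.id _
    · simp only [σ, hk, if_false]
      have := measurePreserving_gaussianMatrix_mul (d := (π k).dim) (U := -1) (by
        rw [Matrix.mem_unitaryGroup_iff]; simp)
      convert this using 1
      funext g i j
      simp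
  have hσ : MeasurePreserving (fun (g : ∀ k, Fin (π k).dim → Fin (π k).dim → ℂ) k => σ k (g k))
      (gaussianFamily fun k => (π k).dim) (gaussianFamily fun k => (π k).dim) := by
    refine ⟨measurable_pi_lambda _ fun k => (hneg k).measurable.comp (measurable_pi_apply k), ?_⟩
    rw [gaussianFamily, Measure.infinitePi_map_pi _ fun k => (hneg k).measurable]
    simp_rw [(hneg _).map_eq]
  have hpt : ∀ g, 2 * randNorm m π s x g ≤
      randNorm m π s' x g + randNorm m π s' x (fun k => σ k (g k)) := by
    intro g
    have hc : ∀ g' : (∀ k, Fin (π k).dim → Fin (π k).dim → ℂ), Continuous fun t => ∑ k ∈ s', ((π k).dim : ℂ) *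
        Matrix.trace (x k * Matrix.of (g' k) * (π k).mat t) := fun g' => by fun_prop
    refine le_trans (le_of_eq ?_) (eLpNorm_add_le (hc g).aestronglyMeasurable
      (hc fun k => σ k (g k)).aestronglyMeasurable le_top)
    have h2 : (2 : ℝ≥0∞) = ‖(2 : ℂ)‖ₑ := by simp [enorm, nnnorm]; rfl
    rw [randNorm, h2, ← eLpNorm_const_smul]
    congr 1
    funext t
    simp only [Pi.smul_apply, Pi.add_apply, smul_eq_mul]
    rw [← Finset.sum_add_distrib, ← Finset.sum_subset hs, Finset.mul_sum]
    · refine Finset.sum_congr rfl fun k hk => ?_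
      simp only [σ, hk, if_true]
      ring
    · intro k _ hk
      simp only [σ, hk, if_false]
      have : Matrix.of (-g k) = -Matrix.of (g k) := rfl
      rw [this, Matrix.mul_neg, Matrix.neg_mul, Matrix.trace_neg]
      ring
  have hm := measurable_randNorm m π s' x
  have h1 : 2 * ∫⁻ g, randNorm m π s x g ∂(gaussianFamily fun k => (π k).dim) ≤
      2 * ∫⁻ g, randNorm m π s' x g ∂(gaussianFamily fun k => (π k).dim) := by
    rw [← lintegral_const_mul _ (measurable_randNorm m π s x)]
    refine (lintegral_mono hpt).trans (le_of_eq ?_)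
    rw [lintegral_add_left hm, hσ.lintegral_comp hm, two_mul]
  exact (ENNReal.mul_le_mul_iff_right (by simp) (by simp)).1 h1

theorem lintegral_randNorm_comp [m.IsOpenPosMeasure] {α : Type*} {j : α → ι}
    (hj : Function.Injective j) (s : Finset α)
    (x : ∀ k, Matrix (Fin (π k).dim) (Fin (π k).dim) ℂ) :
    ∫⁻ g, randNorm m (fun k => π (j k)) s (fun k => x (j k)) g
      ∂(gaussianFamily fun k => (π (j k)).dim) =
      ∫⁻ g, randNorm m π (s.map ⟨j, hj⟩) x g ∂(gaussianFamily fun k => (π k).dim) := by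
  rw [← map_gaussianFamily_of_injective (fun k => (π k).dim) hj,
    lintegral_map (measurable_randNorm m (fun k => π (j k)) s _) (by fun_prop)]
  simp [randNorm]

/-- A family covered by finitely many randomly Sidon subfamilies is randomly Sidon. -/
theorem isRandomlySidon_of_finite_cover [m.IsOpenPosMeasure] {Φ : Type*} (F : Finset Φ)
    {α : Φ → Type*} (j : ∀ f, α f → ι) (hj : ∀ f, Function.Injective (j f))
    (hcover : ∀ i, ∃ f ∈ F, i ∈ Set.range (j f))
    (h : ∀ f ∈ F, IsRandomlySidon m fun k => (π (j f k)).mat) :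
    IsRandomlySidon m fun i => (π i).mat := by
  classical
  choose! C hC using h
  refine ⟨∑ f ∈ F, C f, fun s x => ?_⟩
  -- Overlapping subfamilies may count an index several times, but every index is counted at least
  -- once and the terms are nonnegative.
  have h1 : ∑ k ∈ s, ((π k).dim : ℝ) * traceNorm (x k) ≤ ∑ f ∈ F,
      ∑ k ∈ s.preimage (j f) ((hj f).injOn), ((π (j f k)).dim : ℝ) * traceNorm (x (j f k)) := by
    have h2 : ∀ f, ∑ k ∈ s.preimage (j f) ((hj f).injOn),
        ((π (j f k)).dim : ℝ) * traceNorm (x (j f k)) =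
        ∑ k ∈ s, if k ∈ Set.range (j f) then ((π k).dim : ℝ) * traceNorm (x k) else 0 := fun f => by
      rw [Finset.sum_preimage' (j f) s ((hj f).injOn) fun k => ((π k).dim : ℝ) * traceNorm (x k),
        Finset.sum_filter]
    simp_rw [h2]
    rw [Finset.sum_comm]
    refine Finset.sum_le_sum fun k _ => ?_
    obtain ⟨f, hf, hk⟩ := hcover k
    have h3 : ∀ f ∈ F, 0 ≤ if k ∈ Set.range (j f) then ((π k).dim : ℝ) * traceNorm (x k) else 0 :=
      fun f _ => by
        split_ifs
        · exact mul_nonneg (Nat.cast_nonneg _) (traceNorm_nonneg _)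
        · exact le_rfl
    have h4 := Finset.single_le_sum h3 hf
    rwa [if_pos hk] at h4
  calc ENNReal.ofReal (∑ k ∈ s, ((π k).dim : ℝ) * traceNorm (x k)) ≤
      ∑ f ∈ F, ENNReal.ofReal (∑ k ∈ s.preimage (j f) ((hj f).injOn),
        ((π (j f k)).dim : ℝ) * traceNorm (x (j f k))) := by
        rw [← ENNReal.ofReal_sum_of_nonneg fun f _ => Finset.sum_nonneg fun k _ =>
          mul_nonneg (Nat.cast_nonneg _) (traceNorm_nonneg _)]
        exact ENNReal.ofReal_le_ofReal h1
    _ ≤ ∑ f ∈ F, C f * ∫⁻ g, randNorm m π s x g ∂(gaussianFamily fun k => (π k).dim) := by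
        refine Finset.sum_le_sum fun f hf => ?_
        refine (hC f hf _ fun k => x (j f k)).trans ?_
        gcongr
        refine (lintegral_randNorm_comp m π (hj f) (s.preimage (j f) ((hj f).injOn)) x).le.trans
          (lintegral_randNorm_mono m π ?_ x)
        intro k hk
        simp only [Finset.mem_map, Finset.mem_preimage, Function.Embedding.coeFn_mk] at hk
        obtain ⟨a, ha, rfl⟩ := hk
        exact ha
    _ = (∑ f ∈ F, C f : ℝ≥0) * ∫⁻ g, randNorm m π s x g ∂(gaussianFamily fun k => (π k).dim) := by
        rw [← Finset.sum_mul]; push_cast; rfl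

end Reduction

/-! ### A polynomial lower bound for the trace norm of a product -/

section TraceNormLower
open scoped ComplexOrder
open Matrix

variable {d : ℕ}

theorem re_trace_mul_le_of_unitary {x B : Matrix (Fin d) (Fin d) ℂ}
    (hB : B ∈ unitaryGroup (Fin d) ℂ) : (trace (x * B)).re ≤ traceNorm x := by
  refine (Complex.re_le_norm _).trans (norm_trace_mul_le ?_)
  rw [← star_eq_conjTranspose, mem_unitaryGroup_iff'.1 hB, sub_self]
  exact PosSemidef.zero

/-- The matrix P is |x|. Testing x g against a suitable unitary gives tr|x g| ≥ Re tr(|x| |g*|), and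
|g*| dominates the polynomial (3/2) g g* - (1/2) (g g*)². A polynomial is used since its expectation
needs only second and fourth moments. -/
theorem exists_traceNorm_mul_ge (x : Matrix (Fin d) (Fin d) ℂ) :
    ∃ P : Matrix (Fin d) (Fin d) ℂ, trace P = traceNorm x ∧ ∀ g : Matrix (Fin d) (Fin d) ℂ,
      (trace (P * ((3 / 2 : ℂ) • (g * gᴴ) - (1 / 2 : ℂ) • (g * gᴴ * (g * gᴴ))))).re ≤
        traceNorm (x * g) := by
  obtain ⟨U, hU, V, hV, s, hs, hx, h⟩ := exists_singularValue_decomposition x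
  have hU1 : Uᴴ * U = 1 := mem_unitaryGroup_iff'.1 hU
  have hV2 : V * Vᴴ = 1 := mem_unitaryGroup_iff.1 hV
  refine ⟨Vᴴ * diagonal (fun i => (s i : ℂ)) * V, ?_, fun g => ?_⟩
  · rw [h, Matrix.mul_assoc, trace_mul_comm, Matrix.mul_assoc, hV2, Matrix.mul_one]
    simp [trace]
  obtain ⟨A, hA, B, hB, r, hr, hg, -⟩ := exists_singularValue_decomposition g
  have hA1 : Aᴴ * A = 1 := mem_unitaryGroup_iff'.1 hA
  have hB2 : B * Bᴴ = 1 := mem_unitaryGroup_iff.1 hB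
  have hW : (Bᴴ * Aᴴ) * (Vᴴ * Uᴴ) ∈ unitaryGroup (Fin d) ℂ :=
    mul_mem (mul_mem (Unitary.star_mem hB) (Unitary.star_mem hA))
      (mul_mem (Unitary.star_mem hV) (Unitary.star_mem hU))
  have h1 := re_trace_mul_le_of_unitary (x := x * g) hW
  have h2 : trace (x * g * ((Bᴴ * Aᴴ) * (Vᴴ * Uᴴ))) =
      trace (Vᴴ * diagonal (fun i => (s i : ℂ)) * V * (A * diagonal (fun i => (r i : ℂ)) * Aᴴ)) := by
    have h3 : x * g * ((Bᴴ * Aᴴ) * (Vᴴ * Uᴴ)) =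
        U * (diagonal (fun i => (s i : ℂ)) * V * A * diagonal (fun i => (r i : ℂ)) * (B * Bᴴ) *
          Aᴴ * Vᴴ * Uᴴ) := by
      rw [hx, hg]; simp only [Matrix.mul_assoc]
    rw [h3, trace_mul_comm, hB2, Matrix.mul_one]
    have h4 : diagonal (fun i => (s i : ℂ)) * V * A * diagonal (fun i => (r i : ℂ)) *
        Aᴴ * Vᴴ * Uᴴ * U = (diagonal (fun i => (s i : ℂ)) * V * A * diagonal (fun i => (r i : ℂ)) *
        Aᴴ) * Vᴴ := by
      rw [Matrix.mul_assoc _ Uᴴ U, hU1, Matrix.mul_one]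
    rw [h4, trace_mul_comm]
    simp only [Matrix.mul_assoc]
  have hH : g * gᴴ = A * diagonal (fun i => (r i : ℂ) ^ 2) * Aᴴ := by
    have hd : (diagonal fun i => (r i : ℂ))ᴴ = diagonal fun i => (r i : ℂ) := by
      rw [diagonal_conjTranspose]; congr 1; funext i; simp
    calc g * gᴴ = A * diagonal (fun i => (r i : ℂ)) * (B * Bᴴ) * diagonal (fun i => (r i : ℂ)) *
          Aᴴ := by rw [hg]; simp only [conjTranspose_mul, hd, Matrix.mul_assoc]
      _ = A * (diagonal (fun i => (r i : ℂ)) * diagonal (fun i => (r i : ℂ))) * Aᴴ := by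
          rw [hB2]; simp only [Matrix.mul_assoc, Matrix.one_mul]
      _ = _ := by rw [diagonal_mul_diagonal]; simp only [pow_two]
  have hH2 : g * gᴴ * (g * gᴴ) = A * diagonal (fun i => (r i : ℂ) ^ 4) * Aᴴ := by
    calc g * gᴴ * (g * gᴴ) = A * diagonal (fun i => (r i : ℂ) ^ 2) * (Aᴴ * A) *
          diagonal (fun i => (r i : ℂ) ^ 2) * Aᴴ := by rw [hH]; simp only [Matrix.mul_assoc]
      _ = A * (diagonal (fun i => (r i : ℂ) ^ 2) * diagonal (fun i => (r i : ℂ) ^ 2)) * Aᴴ := by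
          rw [hA1]; simp only [Matrix.mul_assoc, Matrix.one_mul]
      _ = _ := by
          rw [diagonal_mul_diagonal]; congr 3; funext i; ring
  have h5 : (3 / 2 : ℂ) • (g * gᴴ) - (1 / 2 : ℂ) • (g * gᴴ * (g * gᴴ)) =
      A * diagonal (fun i => ((3 / 2 * r i ^ 2 - 1 / 2 * r i ^ 4 : ℝ) : ℂ)) * Aᴴ := by
    rw [hH2, hH]
    have h6 : diagonal (fun i => ((3 / 2 * r i ^ 2 - 1 / 2 * r i ^ 4 : ℝ) : ℂ)) =
        (3 / 2 : ℂ) • diagonal (fun i => (r i : ℂ) ^ 2) -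
        (1 / 2 : ℂ) • diagonal (fun i => (r i : ℂ) ^ 4) := by
      rw [← diagonal_smul, ← diagonal_smul, diagonal_sub]
      congr 1; funext i; simp
    rw [h6, Matrix.mul_sub, Matrix.sub_mul]
    simp
  have hgen : ∀ q : Fin d → ℝ,
      (trace (Vᴴ * diagonal (fun i => (s i : ℂ)) * V * (A * diagonal (fun i => (q i : ℂ)) * Aᴴ))).re
      = ∑ i, s i * ∑ j, q j * ‖(V * A) i j‖ ^ 2 := by
    intro q
    rw [trace_mul_diagonal_mul, Complex.re_sum]
    refine Finset.sum_congr rfl fun i _ => ?_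
    rw [Complex.re_ofReal_mul]
    congr 1
    have : V * (A * diagonal (fun i => (q i : ℂ)) * Aᴴ) * Vᴴ =
        (V * A) * diagonal (fun i => (q i : ℂ)) * (V * A)ᴴ := by
      simp only [conjTranspose_mul, Matrix.mul_assoc]
    rw [this, Matrix.mul_apply, Complex.re_sum]
    refine Finset.sum_congr rfl fun j _ => ?_
    rw [mul_diagonal, conjTranspose_apply, mul_right_comm, Complex.star_def, Complex.mul_conj',
      ← Complex.ofReal_pow, ← Complex.ofReal_mul, Complex.ofReal_re, mul_comm]
  rw [h2, hgen] at h1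
  refine le_trans ?_ h1
  rw [h5, hgen]
  refine Finset.sum_le_sum fun i _ => mul_le_mul_of_nonneg_left
    (Finset.sum_le_sum fun j _ => mul_le_mul_of_nonneg_right ?_ (sq_nonneg _)) (hs i)
  -- This expression is r - (3/2) r² + (1/2) r⁴, factored.
  have h7 : 0 ≤ 1 / 2 * (r j * (r j + 2) * (r j - 1) ^ 2) := by
    have := hr j; positivity
  nlinarith

end TraceNormLower

/-! ### Second and fourth moments of Gaussian matrices -/

section FourthMoment
open Complex

variable {κ : Type*} [Fintype κ] {d : κ → ℕ}

theorem memLp_gaussianProd (e : (∀ k, Fin (d k) → Fin (d k) → ℂ) →L[ℂ] ℂ) (p : ℝ≥0∞) (hp : p ≠ ∞) :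
    MemLp (fun g => e g) p (gaussianProd d) :=
  (e.restrictScalars ℝ).comp_memLp' (IsGaussian.memLp_id (gaussianProd d) p hp)

theorem integrable_mul_star (e₁ e₂ : (∀ k, Fin (d k) → Fin (d k) → ℂ) →L[ℂ] ℂ) :
    Integrable (fun g => e₁ g * star (e₂ g)) (gaussianProd d) :=
  (memLp_gaussianProd e₁ 2 (by simp)).integrable_mul (memLp_gaussianProd e₂ 2 (by simp)).star

theorem memLp_two_mul_star (e₁ e₂ : (∀ k, Fin (d k) → Fin (d k) → ℂ) →L[ℂ] ℂ) :
    MemLp (fun g => e₁ g * star (e₂ g)) 2 (gaussianProd d) := by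
  have h := (memLp_gaussianProd e₂ 4 (by simp)).star.mul (memLp_gaussianProd e₁ 4 (by simp)) (r := 2)
    (hpqr := ⟨by
      rw [← two_mul, show (4 : ℝ≥0∞) = 2 * 2 by norm_num, ENNReal.mul_inv (by simp) (by simp),
        ← mul_assoc, ENNReal.mul_inv_cancel (by simp) (by simp), one_mul]⟩)
  exact h

theorem integrable_mul_star_mul (e₁ e₂ e₃ e₄ : (∀ k, Fin (d k) → Fin (d k) → ℂ) →L[ℂ] ℂ) :
    Integrable (fun g => (e₁ g * star (e₂ g)) * (e₃ g * star (e₄ g))) (gaussianProd d) :=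
  (memLp_two_mul_star e₁ e₂).integrable_mul (memLp_two_mul_star e₃ e₄)

/-- The complex Isserlis (Wick) formula for fourth moments. -/
theorem integral_fourth_moment (e₁ e₂ e₃ e₄ : (∀ k, Fin (d k) → Fin (d k) → ℂ) →L[ℂ] ℂ) :
    ∫ g, (e₁ g * star (e₂ g)) * (e₃ g * star (e₄ g)) ∂(gaussianProd d) =
      (∫ g, e₁ g * star (e₂ g) ∂(gaussianProd d)) * (∫ g, e₃ g * star (e₄ g) ∂(gaussianProd d)) +
      (∫ g, e₁ g * star (e₄ g) ∂(gaussianProd d)) * (∫ g, e₃ g * star (e₂ g) ∂(gaussianProd d)) := by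
  set μ := gaussianProd d with hμ
  set f : (∀ k, Fin (d k) → Fin (d k) → ℂ) → ℂ :=
    fun g => (e₁ g * star (e₂ g)) * (e₃ g * star (e₄ g)) with hf
  have hfi : Integrable f μ := integrable_mul_star_mul e₁ e₂ e₃ e₄
  -- For independent samples x and y and each fourth root of unity w, the variable (x + w y)/√2 has
  -- the original law. Averaging over w will keep only the terms with as many conjugated as
  -- unconjugated factors in y.
  let c : ℝ := 1 / √2
  have hc2 : c ^ 2 = 1 / 2 := by simp [c]
  have hcs : c ^ 2 + c ^ 2 = 1 := by rw [hc2]; norm_num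
  have hmix := measurePreserving_mixMap (μ := μ) (by simpa using integral_id_gaussianProd) hcs
  have hT : ∀ w : ℂ, star w * w = 1 → MeasurePreserving
      (fun p : (∀ k, Fin (d k) → Fin (d k) → ℂ) × (∀ k, Fin (d k) → Fin (d k) → ℂ) =>
        mixMap _ c c (p.1, w • p.2)) (μ.prod μ) μ := fun w hw =>
    hmix.comp ((MeasurePreserving.id μ).prod (measurePreserving_smul hw))
  have hw : ∀ w : ℂ, star w * w = 1 → Integrable (fun p => f (mixMap _ c c (p.1, w • p.2))) (μ.prod μ) ∧
      ∫ p, f (mixMap _ c c (p.1, w • p.2)) ∂(μ.prod μ) = ∫ g, f g ∂μ := fun w hw' =>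
    ⟨(hT w hw').integrable_comp_of_integrable hfi, by
      conv_rhs => rw [← (hT w hw').map_eq]
      rw [integral_map (hT w hw').measurable.aemeasurable (by
        rw [(hT w hw').map_eq]; exact hfi.aestronglyMeasurable)]⟩
  have h1 := hw 1 (by simp)
  have h2 := hw (-1) (by simp)
  have h3 := hw I (by simp)
  have h4 := hw (-I) (by simp)
  have hsum : 4 * ∫ g, f g ∂μ = ∫ p, (f (mixMap _ c c (p.1, (1 : ℂ) • p.2)) +
      f (mixMap _ c c (p.1, (-1 : ℂ) • p.2)) + f (mixMap _ c c (p.1, I • p.2)) +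
      f (mixMap _ c c (p.1, (-I) • p.2))) ∂(μ.prod μ) := by
    rw [integral_add ((h1.1.fun_add h2.1).fun_add h3.1) h4.1, integral_add (h1.1.fun_add h2.1) h3.1,
      integral_add h1.1 h2.1, h1.2, h2.2, h3.2, h4.2]
    ring
  have hc2' : (c : ℂ) ^ 2 = 1 / 2 := by rw [← Complex.ofReal_pow, hc2]; simp
  have hc4 : (c : ℂ) ^ 4 = 1 / 4 := by
    rw [show (c : ℂ) ^ 4 = ((c : ℂ) ^ 2) ^ 2 by ring, hc2']; norm_num
  -- The sum over four phases cancels c⁴ = 1/4. The integrated identity reads 4F = 2F + 2A + 2B,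
  -- with A and B the two Wick pairings.
  have hexp : ∀ p : (∀ k, Fin (d k) → Fin (d k) → ℂ) × (∀ k, Fin (d k) → Fin (d k) → ℂ),
      f (mixMap _ c c (p.1, (1 : ℂ) • p.2)) +
      f (mixMap _ c c (p.1, (-1 : ℂ) • p.2)) + f (mixMap _ c c (p.1, I • p.2)) +
      f (mixMap _ c c (p.1, (-I) • p.2)) =
      f p.1 + f p.2 + (e₁ p.1 * star (e₂ p.1)) * (e₃ p.2 * star (e₄ p.2)) +
      (e₃ p.1 * star (e₄ p.1)) * (e₁ p.2 * star (e₂ p.2)) +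
      (e₁ p.1 * star (e₄ p.1)) * (e₃ p.2 * star (e₂ p.2)) +
      (e₃ p.1 * star (e₂ p.1)) * (e₁ p.2 * star (e₄ p.2)) := by
    intro p
    have hcs : ∀ x : (∀ k, Fin (d k) → Fin (d k) → ℂ), c • x = (c : ℂ) • x := fun x => rfl
    simp only [hf, mixMap_apply, hcs, map_add, map_smul, smul_eq_mul, Complex.star_def, map_mul,
      Complex.conj_ofReal, Complex.conj_I, map_neg, map_one]
    have hI4 : I ^ 4 = 1 := Complex.I_pow_four
    ring_nf
    simp only [hc4, hI4, Complex.I_sq]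
    ring
  have i12 := integrable_mul_star (d := d) e₁ e₂
  have i34 := integrable_mul_star (d := d) e₃ e₄
  have i14 := integrable_mul_star (d := d) e₁ e₄
  have i32 := integrable_mul_star (d := d) e₃ e₂
  have a1 := hfi.comp_fst μ
  have a2 := hfi.comp_snd μ
  have a3 := i12.mul_prod i34
  have a4 := i34.mul_prod i12
  have a5 := i14.mul_prod i32
  have a6 := i32.mul_prod i14
  simp_rw [hexp] at hsum
  rw [integral_add ((((a1.fun_add a2).fun_add a3).fun_add a4).fun_add a5) a6,
    integral_add (((a1.fun_add a2).fun_add a3).fun_add a4) a5,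
    integral_add ((a1.fun_add a2).fun_add a3) a4, integral_add (a1.fun_add a2) a3, integral_add a1 a2, integral_fun_fst f, integral_fun_snd f,
    integral_prod_mul (fun g => e₁ g * star (e₂ g)) (fun g => e₃ g * star (e₄ g)),
    integral_prod_mul (fun g => e₃ g * star (e₄ g)) (fun g => e₁ g * star (e₂ g)),
    integral_prod_mul (fun g => e₁ g * star (e₄ g)) (fun g => e₃ g * star (e₂ g)),
    integral_prod_mul (fun g => e₃ g * star (e₂ g)) (fun g => e₁ g * star (e₄ g))] at hsum
  simp only [probReal_univ, one_smul] at hsum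
  linear_combination (1 / 2 : ℂ) * hsum

/-- The entry functionals. -/
def entryCLM (k : κ) (i j : Fin (d k)) : (∀ k, Fin (d k) → Fin (d k) → ℂ) →L[ℂ] ℂ :=
  (ContinuousLinearMap.proj j).comp
    ((ContinuousLinearMap.proj (R := ℂ) (φ := fun _ : Fin (d k) => Fin (d k) → ℂ) i).comp
      (ContinuousLinearMap.proj k))

theorem entryCLM_apply (k : κ) (i j : Fin (d k)) (g : ∀ k, Fin (d k) → Fin (d k) → ℂ) :
    entryCLM k i j g = g k i j := rfl

open Matrix in
theorem mul_conjTranspose_entry (k : κ) (i j : Fin (d k)) (g : ∀ k, Fin (d k) → Fin (d k) → ℂ) :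
    (of (g k) * (of (g k))ᴴ) i j = ∑ l, entryCLM k i l g * star (entryCLM k j l g) := by
  simp [Matrix.mul_apply, entryCLM_apply]

theorem integral_entryCLM (k : κ) (i j a b : Fin (d k)) :
    ∫ g, entryCLM k i j g * star (entryCLM k a b g) ∂(gaussianProd d) =
      if i = a ∧ j = b then (d k : ℂ)⁻¹ else 0 :=
  integral_entry_mul_star_entry k i j a b

open Matrix in
theorem integral_gram (k : κ) (i j : Fin (d k)) :
    Integrable (fun g => (of (g k) * (of (g k))ᴴ) i j) (gaussianProd d) ∧
    ∫ g, (of (g k) * (of (g k))ᴴ) i j ∂(gaussianProd d) = (1 : Matrix _ _ ℂ) i j := by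
  have hd : (d k : ℂ) ≠ 0 := by
    have : 0 < d k := (Nat.zero_le _).trans_lt i.2
    exact_mod_cast this.ne'
  simp_rw [mul_conjTranspose_entry]
  refine ⟨integrable_finsetSum _ fun l _ => integrable_mul_star _ _, ?_⟩
  rw [integral_finsetSum _ fun l _ => integrable_mul_star _ _]
  simp_rw [integral_entryCLM]
  rw [Matrix.one_apply]
  by_cases h : i = j <;> simp [h, hd]

-- Each of the two Wick pairings contributes one identity matrix.
open Matrix in
theorem integral_gram_sq (k : κ) (i j : Fin (d k)) :
    Integrable (fun g => (of (g k) * (of (g k))ᴴ * (of (g k) * (of (g k))ᴴ)) i j)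
      (gaussianProd d) ∧
    ∫ g, (of (g k) * (of (g k))ᴴ * (of (g k) * (of (g k))ᴴ)) i j ∂(gaussianProd d) =
      2 * (1 : Matrix _ _ ℂ) i j := by
  have hd : (d k : ℂ) ≠ 0 := by
    have : 0 < d k := (Nat.zero_le _).trans_lt i.2
    exact_mod_cast this.ne'
  simp_rw [Matrix.mul_apply (M := of _ * _), mul_conjTranspose_entry, Finset.sum_mul_sum]
  have hi := fun a l b n => integrable_mul_star_mul (entryCLM (d := d) k i l) (entryCLM k a l)
    (entryCLM k a n) (entryCLM k b n)
  refine ⟨integrable_finsetSum _ fun a _ => integrable_finsetSum _ fun l _ =>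
    integrable_finsetSum _ fun n _ => hi a l j n, ?_⟩
  rw [integral_finsetSum _ fun a _ => integrable_finsetSum _ fun l _ =>
    integrable_finsetSum _ fun n _ => hi a l j n]
  have hswap := fun a : Fin (d k) => integral_finsetSum (μ := gaussianProd d) Finset.univ fun l _ =>
    integrable_finsetSum Finset.univ fun n _ => hi a l j n
  have hswap' := fun a l : Fin (d k) => integral_finsetSum (μ := gaussianProd d) Finset.univ
    fun n _ => hi a l j n
  simp_rw [hswap, hswap', integral_fourth_moment, integral_entryCLM]
  rw [Matrix.one_apply]
  simp_rw [Finset.sum_add_distrib]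
  have h1 : ∑ a : Fin (d k), ∑ l : Fin (d k), ∑ n : Fin (d k), ((if i = a ∧ l = l then (d k : ℂ)⁻¹ else 0) *
      if a = j ∧ n = n then (d k : ℂ)⁻¹ else 0) = if i = j then 1 else 0 := by
    simp only [and_true, Finset.sum_const, Finset.card_univ, Fintype.card_fin, nsmul_eq_mul]
    rw [← Finset.mul_sum, ← Finset.mul_sum]
    simp only [ite_mul, zero_mul, Finset.sum_ite_eq, Finset.mem_univ, if_true]
    split_ifs
    · field_simp
    · simp
  have h2 : ∑ a : Fin (d k), ∑ l : Fin (d k), ∑ n : Fin (d k), ((if i = j ∧ l = n then (d k : ℂ)⁻¹ else 0) *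
      if a = a ∧ n = l then (d k : ℂ)⁻¹ else 0) = if i = j then 1 else 0 := by
    by_cases h : i = j
    · simp only [h, true_and, Finset.sum_const, Finset.card_univ, Fintype.card_fin, nsmul_eq_mul,
        ite_mul, zero_mul, Finset.sum_ite_eq, Finset.mem_univ, if_true]
      field_simp
    · simp [h]
  simp only [and_true, true_and] at h1 h2 ⊢
  rw [h1, h2]
  ring

end FourthMoment

/-! ### Sidon implies randomly Sidon -/

section SidonToRandom

variable {G : Type*} [Group G] [TopologicalSpace G] [CompactSpace G]
  {κ : Type*} [Fintype κ] {π : κ → Irrep G}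

-- The hypothesis is applied to x g and integrated. The factor 2 is the inverse of 3/2 · 1 - 1/2 · 2
-- = 1/2, the expectation of the polynomial in g g*.
open Matrix in
theorem sumTraceNorm_le_expNorm_of_forall {C : ℝ}
    (h : ∀ x : Coeff π, sumTraceNorm π x ≤ C * ‖trigPoly π x‖) (x : Coeff π) :
    sumTraceNorm π x ≤ 2 * C * expNorm x := by
  choose P hP hPg using fun k => exists_traceNorm_mul_ge (x k)
  let Q : ∀ k, Block π → Matrix (Fin (π k).dim) (Fin (π k).dim) ℂ := fun k g =>
    (3 / 2 : ℂ) • (of (g k) * (of (g k))ᴴ) -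
      (1 / 2 : ℂ) • (of (g k) * (of (g k))ᴴ * (of (g k) * (of (g k))ᴴ))
  have hQ : ∀ k i j, Integrable (fun g => Q k g i j) (gaussianLaw π) ∧
      ∫ g, Q k g i j ∂(gaussianLaw π) = (1 / 2 : ℂ) * (1 : Matrix _ _ ℂ) i j := by
    intro k i j
    have h1 := integral_gram (d := fun k => (π k).dim) k i j
    have h2 := integral_gram_sq (d := fun k => (π k).dim) k i j
    refine ⟨(h1.1.const_mul _).sub (h2.1.const_mul _), ?_⟩
    simp only [Q, Matrix.sub_apply, Matrix.smul_apply, smul_eq_mul]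
    rw [integral_sub (h1.1.const_mul _) (h2.1.const_mul _), integral_const_mul,
      integral_const_mul, h1.2, h2.2]
    ring
  have htr : ∀ k, Integrable (fun g => trace (P k * Q k g)) (gaussianLaw π) ∧
      ∫ g, trace (P k * Q k g) ∂(gaussianLaw π) = (1 / 2 : ℂ) * traceNorm (x k) := by
    intro k
    have hi : ∀ i j, Integrable (fun g => P k i j * Q k g j i) (gaussianLaw π) :=
      fun i j => (hQ k j i).1.const_mul _
    simp only [trace, diag_apply, Matrix.mul_apply]
    refine ⟨integrable_finsetSum _ fun i _ => integrable_finsetSum _ fun j _ => hi i j, ?_⟩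
    rw [integral_finsetSum _ fun i _ => integrable_finsetSum _ fun j _ => hi i j]
    simp_rw [integral_finsetSum Finset.univ fun j _ => hi _ j, integral_const_mul, (hQ k _ _).2]
    rw [← hP k, trace, Finset.mul_sum]
    refine Finset.sum_congr rfl fun i _ => ?_
    simp [Matrix.one_apply, mul_comm]
  let Y : Block π → ℝ := fun g => ∑ k, ((π k).dim : ℝ) * (trace (P k * Q k g)).re
  have hre : ∀ k, Integrable (fun g => ((π k).dim : ℝ) * (trace (P k * Q k g)).re)
      (gaussianLaw π) := fun k => (htr k).1.re.const_mul _
  have hYi : Integrable Y (gaussianLaw π) := integrable_finsetSum _ fun k _ => hre k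
  have hYint : ∫ g, Y g ∂(gaussianLaw π) = (1 / 2) * sumTraceNorm π x := by
    simp only [Y]
    rw [integral_finsetSum _ fun k _ => hre k, sumTraceNorm, Finset.mul_sum]
    refine Finset.sum_congr rfl fun k _ => ?_
    have h3 : ∫ g, (trace (P k * Q k g)).re ∂(gaussianLaw π) =
        (∫ g, trace (P k * Q k g) ∂(gaussianLaw π)).re := integral_re (htr k).1
    rw [integral_const_mul, h3, (htr k).2]
    have : ((1 / 2 : ℂ) * (traceNorm (x k) : ℂ)) = ((1 / 2 * traceNorm (x k) : ℝ) : ℂ) := by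
      push_cast; ring
    rw [this, Complex.ofReal_re]
    ring
  have hle : ∫ g, Y g ∂(gaussianLaw π) ≤ ∫ g, C * ‖trigPolyCLM x g‖ ∂(gaussianLaw π) := by
    refine integral_mono hYi ((integrable_trigPolyCLM x).norm.const_mul C) fun g => ?_
    refine le_trans ?_ (h (x * toCoeff g))
    exact Finset.sum_le_sum fun k _ =>
      mul_le_mul_of_nonneg_left (hPg k (of (g k))) (Nat.cast_nonneg _)
  rw [hYint, integral_const_mul] at hle
  rw [expNorm]
  linarith

end SidonToRandom

/-! ### Extension of functionals to vector-valued L¹ and their densities -/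

section HahnBanach

/-- The bound forces f to vanish on the kernel of Λ, so f descends to the range and Hahn–Banach
applies there. -/
theorem exists_strongDual_of_norm_le {V E : Type*} [AddCommGroup V] [Module ℂ V]
    [NormedAddCommGroup E] [NormedSpace ℂ E] (Λ : V →ₗ[ℂ] E) (f : V →ₗ[ℂ] ℂ) {C : ℝ} (hC : 0 ≤ C)
    (h : ∀ x, ‖f x‖ ≤ C * ‖Λ x‖) :
    ∃ Φ : StrongDual ℂ E, ‖Φ‖ ≤ C ∧ ∀ x, Φ (Λ x) = f x := by
  have hker : LinearMap.ker Λ ≤ LinearMap.ker f := fun x hx => by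
    have := h x
    rw [LinearMap.mem_ker.1 hx, norm_zero, mul_zero] at this
    exact norm_le_zero_iff.1 this
  let φ : LinearMap.range Λ →ₗ[ℂ] ℂ :=
    ((LinearMap.ker Λ).liftQ f hker).comp (Λ.quotKerEquivRange.symm : _ →ₗ[ℂ] _)
  have hφ : ∀ x, φ ⟨Λ x, LinearMap.mem_range_self Λ x⟩ = f x := fun x => by
    have : Λ.quotKerEquivRange.symm ⟨Λ x, LinearMap.mem_range_self Λ x⟩ =
        (LinearMap.ker Λ).mkQ x := LinearMap.quotKerEquivRange_symm_apply_image _ _ _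
    simp only [φ, LinearMap.comp_apply, LinearEquiv.coe_coe, this]
    simp
  let ψ : StrongDual ℂ (LinearMap.range Λ) := φ.mkContinuous C (by
    rintro ⟨_, x, rfl⟩
    rw [hφ]
    exact h x)
  obtain ⟨Φ, hΦ, hn⟩ := exists_extension_norm_eq (𝕜 := ℂ) (LinearMap.range Λ) ψ
  refine ⟨Φ, hn.trans_le (LinearMap.mkContinuous_norm_le _ hC _), fun x => ?_⟩
  exact (hΦ ⟨Λ x, LinearMap.mem_range_self Λ x⟩).trans (hφ x)

variable {Ω E : Type*} [MeasurableSpace Ω] {μ : Measure Ω} [IsProbabilityMeasure μ]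
  [NormedAddCommGroup E] [NormedSpace ℂ E]

theorem ae_norm_le_of_forall_integral_mul_le {q : Ω → ℂ} (hq : Integrable q μ)
    (hqm : Measurable q) {K : ℝ}
    (h : ∀ ψ : Ω → ℂ, Measurable ψ → (∀ ω, ‖ψ ω‖ ≤ 1) →
      ‖∫ ω, ψ ω * q ω ∂μ‖ ≤ K * ∫ ω, ‖ψ ω‖ ∂μ) : ∀ᵐ ω ∂μ, ‖q ω‖ ≤ K := by
  refine ae_le_of_forall_setIntegral_le hq.norm (integrable_const K) fun s hs _ => ?_
  -- The conjugate phase of q on s turns the hypothesis into an estimate for the integral of |q|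
  -- over s. Where q vanishes the quotient is 0, which is harmless.
  let ψ : Ω → ℂ := s.indicator fun ω => star (q ω) / ‖q ω‖
  have hψm : Measurable ψ := by
    refine Measurable.indicator ?_ hs
    exact (continuous_star.measurable.comp hqm).div (Complex.measurable_ofReal.comp hqm.norm)
  have hψ : ∀ ω, ‖ψ ω‖ ≤ s.indicator 1 ω := fun ω => by
    by_cases hω : ω ∈ s
    · simp only [ψ, Set.indicator_of_mem hω, norm_div, norm_star, Complex.norm_real, norm_norm,
        Pi.one_apply]
      exact div_self_le_one _
    · simp [ψ, hω]
  have h1 : ∀ ω, ‖ψ ω‖ ≤ 1 := fun ω => (hψ ω).trans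
    (Set.indicator_le_self' (fun _ _ => zero_le_one) ω)
  have h2 : ∀ ω, ψ ω * q ω = ((s.indicator (fun ω => ‖q ω‖) ω : ℝ) : ℂ) := fun ω => by
    by_cases hω : ω ∈ s
    · simp only [ψ, Set.indicator_of_mem hω]
      rcases eq_or_ne (q ω) 0 with h0 | h0
      · simp [h0]
      · have : (‖q ω‖ : ℂ) ≠ 0 := by simpa using h0
        rw [div_mul_eq_mul_div, Complex.star_def, Complex.conj_mul']
        field_simp
    · simp [ψ, hω]
  have h3 := h ψ hψm h1
  simp_rw [h2] at h3
  rw [integral_complex_ofReal, Complex.norm_real, integral_indicator hs, Real.norm_of_nonneg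
    (integral_nonneg fun _ => norm_nonneg _)] at h3
  have hK : 0 ≤ K := by
    have := (norm_nonneg _).trans (h 1 measurable_one (by simp))
    simpa using this
  refine h3.trans ?_
  calc K * ∫ ω, ‖ψ ω‖ ∂μ ≤ K * ∫ ω, s.indicator 1 ω ∂μ := by
        refine mul_le_mul_of_nonneg_left (integral_mono_of_nonneg
          (Filter.Eventually.of_forall fun _ => norm_nonneg _)
          ((integrable_const (1 : ℝ)).indicator hs) (Filter.Eventually.of_forall hψ)) hK
    _ = ∫ ω in s, K ∂μ := by
        rw [integral_indicator_one hs]; simp [mul_comm]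

theorem integrable_smul_const_of_memLp {ψ : Ω → ℂ} (hψ : MemLp ψ 2 μ) (f : E) :
    Integrable (fun ω => ψ ω • f) μ := (hψ.integrable (by norm_num)).smul_const f

open Classical in
/-- A functional on `L¹(μ; E)`, evaluated at functions. -/
def applyL1 (Φ : StrongDual ℂ (Lp E 1 μ)) (F : Ω → E) : ℂ :=
  if h : Integrable F μ then Φ h.toL1 else 0

theorem applyL1_of_integrable (Φ : StrongDual ℂ (Lp E 1 μ)) {F : Ω → E} (h : Integrable F μ) :
    applyL1 Φ F = Φ h.toL1 := dif_pos h

theorem applyL1_congr (Φ : StrongDual ℂ (Lp E 1 μ)) {F F' : Ω → E} (h : Integrable F μ)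
    (h' : F =ᵐ[μ] F') : applyL1 Φ F = applyL1 Φ F' := by
  rw [applyL1_of_integrable Φ h, applyL1_of_integrable Φ (h.congr h'),
    (Integrable.toL1_eq_toL1_iff _ _ h (h.congr h')).2 h']

theorem applyL1_add (Φ : StrongDual ℂ (Lp E 1 μ)) {F F' : Ω → E} (h : Integrable F μ)
    (h' : Integrable F' μ) :
    applyL1 Φ (fun ω => F ω + F' ω) = applyL1 Φ F + applyL1 Φ F' := by
  rw [applyL1_of_integrable Φ h, applyL1_of_integrable Φ h',
    applyL1_of_integrable Φ (h.fun_add h'), ← map_add, ← Integrable.toL1_add]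
  rfl

theorem applyL1_smul (Φ : StrongDual ℂ (Lp E 1 μ)) (c : ℂ) {F : Ω → E} (h : Integrable F μ) :
    applyL1 Φ (fun ω => c • F ω) = c * applyL1 Φ F := by
  rw [applyL1_of_integrable Φ h, applyL1_of_integrable Φ (h.fun_smul c), ← smul_eq_mul, ← map_smul,
    ← Integrable.toL1_smul]

theorem applyL1_sum (Φ : StrongDual ℂ (Lp E 1 μ)) {α : Type*} (s : Finset α) {F : α → Ω → E}
    (h : ∀ i, Integrable (F i) μ) :
    applyL1 Φ (fun ω => ∑ i ∈ s, F i ω) = ∑ i ∈ s, applyL1 Φ (F i) := by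
  classical
  induction s using Finset.induction_on with
  | empty =>
    simp only [Finset.sum_empty]
    rw [show (fun _ : Ω => (0 : E)) = 0 from rfl,
      applyL1_of_integrable Φ (integrable_zero Ω E μ), Integrable.toL1_zero, map_zero]
  | insert a s ha ih =>
    simp only [Finset.sum_insert ha]
    rw [applyL1_add Φ (h a) (integrable_finsetSum s fun i _ => h i), ih]

theorem norm_applyL1_le (Φ : StrongDual ℂ (Lp E 1 μ)) {F : Ω → E} (h : Integrable F μ) :
    ‖applyL1 Φ F‖ ≤ ‖Φ‖ * ∫ ω, ‖F ω‖ ∂μ := by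
  rw [applyL1_of_integrable Φ h]
  refine (Φ.le_opNorm _).trans_eq ?_
  rw [Integrable.norm_toL1_eq_lintegral_norm, ← integral_eq_lintegral_of_nonneg_ae
    (Filter.Eventually.of_forall fun _ => norm_nonneg _) h.norm.aestronglyMeasurable]

/-- The function `q` represents the functional `ψ ↦ Φ (ψ f)`. -/
structure IsDensity (Φ : StrongDual ℂ (Lp E 1 μ)) (q : Ω → ℂ) (f : E) : Prop where
  measurable : Measurable q
  memLp : MemLp q 2 μ
  apply_eq : ∀ ψ : Ω → ℂ, MemLp ψ 2 μ → applyL1 Φ (fun ω => ψ ω • f) = ∫ ω, ψ ω * q ω ∂μ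

theorem IsDensity.smul {Φ : StrongDual ℂ (Lp E 1 μ)} {q : Ω → ℂ} {f : E} (h : IsDensity Φ q f)
    (c : ℂ) : IsDensity Φ (fun ω => c * q ω) (c • f) where
  measurable := h.measurable.const_mul c
  memLp := h.memLp.const_mul c
  apply_eq := fun ψ hψ => by
    simp_rw [smul_comm _ c f]
    rw [applyL1_smul Φ c (integrable_smul_const_of_memLp hψ f), h.apply_eq ψ hψ,
      ← integral_const_mul]
    congr 1; funext ω; ring

theorem IsDensity.sum {Φ : StrongDual ℂ (Lp E 1 μ)} {α : Type*} (s : Finset α) {q : α → Ω → ℂ}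
    {f : α → E} (h : ∀ i, IsDensity Φ (q i) (f i)) :
    IsDensity Φ (fun ω => ∑ i ∈ s, q i ω) (∑ i ∈ s, f i) where
  measurable := Finset.measurable_fun_sum s fun i _ => (h i).measurable
  memLp := memLp_finsetSum s fun i _ => (h i).memLp
  apply_eq := fun ψ hψ => by
    have hi : ∀ i, Integrable (fun ω => ψ ω * q i ω) μ := fun i => hψ.integrable_mul (h i).memLp
    simp_rw [Finset.smul_sum, Finset.mul_sum]
    rw [applyL1_sum Φ s fun i => integrable_smul_const_of_memLp hψ (f i),
      integral_finsetSum s fun i _ => hi i]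
    exact Finset.sum_congr rfl fun i _ => (h i).apply_eq ψ hψ

theorem IsDensity.ae_norm_le {Φ : StrongDual ℂ (Lp E 1 μ)} {q : Ω → ℂ} {f : E}
    (h : IsDensity Φ q f) : ∀ᵐ ω ∂μ, ‖q ω‖ ≤ ‖Φ‖ * ‖f‖ := by
  refine ae_norm_le_of_forall_integral_mul_le (h.memLp.integrable (by norm_num)) h.measurable ?_
  intro ψ hψ hψ1
  have hψm : MemLp ψ 2 μ := MemLp.of_bound hψ.aestronglyMeasurable 1
    (Filter.Eventually.of_forall hψ1)
  rw [← h.apply_eq ψ hψm]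
  refine (norm_applyL1_le Φ (integrable_smul_const_of_memLp hψm f)).trans_eq ?_
  simp_rw [norm_smul]
  rw [integral_mul_const, mul_assoc, mul_comm ‖f‖]

/-- On scalar multiples of the fixed vector f the functional is bounded for the L¹ norm, a fortiori
for the L² norm on a probability space, so Riesz representation in L² suffices. The uniform bound is
recovered in `IsDensity.ae_norm_le`. -/
theorem exists_isDensity (Φ : StrongDual ℂ (Lp E 1 μ)) (f : E) : ∃ q, IsDensity Φ q f := by
  have hint : ∀ ψ : Lp ℂ 2 μ, Integrable (fun ω => ψ ω • f) μ := fun ψ =>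
    integrable_smul_const_of_memLp (Lp.memLp ψ) f
  let A : Lp ℂ 2 μ →ₗ[ℂ] ℂ :=
    { toFun := fun ψ => applyL1 Φ fun ω => ψ ω • f
      map_add' := fun ψ φ => by
        rw [← applyL1_add Φ (hint ψ) (hint φ)]
        refine applyL1_congr Φ (hint _) ?_
        filter_upwards [Lp.coeFn_add ψ φ] with ω hω
        rw [hω, Pi.add_apply, add_smul]
      map_smul' := fun c ψ => by
        rw [RingHom.id_apply, smul_eq_mul, ← applyL1_smul Φ c (hint ψ)]
        refine applyL1_congr Φ (hint _) ?_
        filter_upwards [Lp.coeFn_smul c ψ] with ω hω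
        rw [hω, Pi.smul_apply, smul_assoc] }
  have hA : ∀ ψ, ‖A ψ‖ ≤ ‖Φ‖ * ‖f‖ * ‖ψ‖ := fun ψ => by
    refine (norm_applyL1_le Φ (hint ψ)).trans ?_
    simp_rw [norm_smul]
    rw [integral_mul_const, mul_comm _ ‖f‖, ← mul_assoc]
    refine mul_le_mul_of_nonneg_left ?_ (by positivity)
    have h1 := eLpNorm_le_eLpNorm_of_exponent_le (p := 1) (q := 2) (by norm_num)
      (Lp.aestronglyMeasurable ψ)
    have h2 := ENNReal.toReal_mono (Lp.memLp ψ).2.ne h1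
    rw [Lp.norm_def]
    rwa [toReal_eLpNorm (Lp.aestronglyMeasurable ψ), lpNorm_one_eq_integral_norm
      (Lp.aestronglyMeasurable ψ)] at h2
  let B : StrongDual ℂ (Lp ℂ 2 μ) := A.mkContinuous _ hA
  let r : Lp ℂ 2 μ := (InnerProductSpace.toDual ℂ (Lp ℂ 2 μ)).symm B
  obtain ⟨q₀, hq₀, hrq⟩ := (Lp.memLp r).1.aemeasurable
  have hq₀m : MemLp q₀ 2 μ := (memLp_congr_ae hrq).1 (Lp.memLp r)
  refine ⟨fun ω => star (q₀ ω), continuous_star.measurable.comp hq₀, hq₀m.star, fun ψ hψ => ?_⟩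
  have h1 : applyL1 Φ (fun ω => ψ ω • f) = B hψ.toLp := by
    refine applyL1_congr Φ (integrable_smul_const_of_memLp hψ f) ?_
    filter_upwards [hψ.coeFn_toLp] with ω hω
    rw [hω]
  rw [h1, ← InnerProductSpace.toDual_symm_apply, L2.inner_def]
  refine integral_congr_ae ?_
  filter_upwards [hψ.coeFn_toLp, hrq] with ω hω hω'
  rw [hω]
  change inner ℂ (r ω) (ψ ω) = _
  rw [hω']
  simp

theorem applyL1_sum_sum_smul {κ : Type*} [Fintype κ] {n : κ → ℕ} (Φ : StrongDual ℂ (Lp E 1 μ))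
    {ψ q : ∀ k, Fin (n k) → Fin (n k) → Ω → ℂ} {f : ∀ k, Fin (n k) → Fin (n k) → E}
    (hψ : ∀ k i j, MemLp (ψ k i j) 2 μ) (hq : ∀ k i j, IsDensity Φ (q k i j) (f k i j)) :
    applyL1 Φ (fun ω => ∑ k, ∑ i, ∑ j, ψ k i j ω • f k i j) =
      ∫ ω, ∑ k, ∑ i, ∑ j, ψ k i j ω * q k i j ω ∂μ := by
  have hi1 : ∀ k i j, Integrable (fun ω => ψ k i j ω • f k i j) μ :=
    fun k i j => integrable_smul_const_of_memLp (hψ k i j) (f k i j)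
  have hi2 : ∀ k i j, Integrable (fun ω => ψ k i j ω * q k i j ω) μ :=
    fun k i j => (hψ k i j).integrable_mul (hq k i j).memLp
  rw [applyL1_sum Φ _ fun l => integrable_finsetSum _ fun a _ => integrable_finsetSum _
      fun b _ => hi1 l a b,
    integral_finsetSum _ fun l _ => integrable_finsetSum _ fun a _ => integrable_finsetSum _
      fun b _ => hi2 l a b]
  refine Finset.sum_congr rfl fun l _ => ?_
  rw [applyL1_sum Φ _ fun a => integrable_finsetSum _ fun b _ => hi1 l a b,
    integral_finsetSum _ fun a _ => integrable_finsetSum _ fun b _ => hi2 l a b]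
  refine Finset.sum_congr rfl fun a _ => ?_
  rw [applyL1_sum Φ _ fun b => hi1 l a b, integral_finsetSum _ fun b _ => hi2 l a b]
  exact Finset.sum_congr rfl fun b _ => (hq l a b).apply_eq _ (hψ l a b)

end HahnBanach

/-! ### Random functionals dual to the Gaussian matrices -/

section DualMatrices

variable {G : Type*} [Group G] [TopologicalSpace G] [CompactSpace G]
  {κ : Type*} [Fintype κ] {π : κ → Irrep G}

/-- The matrix entries of a representation. -/
def Irrep.entry (π : Irrep G) (i j : Fin π.dim) : C(G, ℂ) :=
  ⟨fun t => π.mat t i j, by fun_prop⟩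

theorem pairing_eq_sum (x y : Coeff π) :
    pairing π x y = ∑ k, ∑ i, ∑ j, (((π k).dim : ℂ) * x k i j) * y k j i := by
  simp only [pairing, Matrix.trace, Matrix.diag_apply, Matrix.mul_apply, Finset.mul_sum, mul_assoc]

theorem trigPoly_eq_sum (x : Coeff π) :
    trigPoly π x = ∑ k, ∑ i, ∑ j, (((π k).dim : ℂ) * x k i j) • (π k).entry j i := by
  ext t
  rw [trigPoly_apply, pairing_eq_sum]
  simp [ContinuousMap.sum_apply, Irrep.entry, evalMat]

theorem pairing_single [DecidableEq κ] (k : κ) (i j : Fin (π k).dim) (c : ℂ) (y : Coeff π) :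
    pairing π (Pi.single k (Matrix.single i j c)) y = (π k).dim * (c * y k j i) := by
  rw [pairing, Finset.sum_eq_single k]
  · simp [Matrix.trace_single_mul]
  · intro l _ hl
    simp [Pi.single_eq_of_ne hl]
  · simp

theorem continuous_pairing_toCoeff (y : Coeff π) :
    Continuous fun h : Block π => pairing π (toCoeff h) y := by
  simp_rw [pairing_eq_sum]
  unfold toCoeff
  simp only [Matrix.of_apply]
  fun_prop

theorem measurable_pairing {Ω : Type*} [MeasurableSpace Ω] {x p : Ω → Coeff π}
    (hx : ∀ k i j, Measurable fun g => x g k i j) (hp : ∀ k i j, Measurable fun g => p g k i j) :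
    Measurable fun g => pairing π (x g) (p g) := by
  simp_rw [pairing_eq_sum]
  fun_prop

/-- This bound depends on π and serves only to ensure integrability; it does not enter the final
constant. -/
theorem exists_entry_bound {C : ℝ} (hC : 0 ≤ C) : ∃ K : ℝ, ∀ p : Coeff π,
    (∀ x, ‖pairing π x p‖ ≤ C * ‖trigPoly π x‖) → ∀ k i j, ‖p k i j‖ ≤ K := by
  classical
  refine ⟨∑ k, ∑ i, ∑ j, C * ‖trigPoly π (Pi.single k (Matrix.single i j 1))‖,
    fun p hp k i j => ?_⟩
  have h1 := hp (Pi.single k (Matrix.single j i 1))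
  rw [pairing_single, one_mul, norm_mul, Complex.norm_natCast] at h1
  have hd : (1 : ℝ) ≤ (π k).dim := by
    have : 0 < (π k).dim := (Nat.zero_le _).trans_lt i.2
    exact_mod_cast this
  have hn : ∀ k i j, 0 ≤ C * ‖trigPoly π (Pi.single k (Matrix.single i j 1))‖ :=
    fun k i j => by positivity
  calc ‖p k i j‖ ≤ (π k).dim * ‖p k i j‖ := le_mul_of_one_le_left (norm_nonneg _) hd
    _ ≤ C * ‖trigPoly π (Pi.single k (Matrix.single j i 1))‖ := h1
    _ ≤ ∑ i', C * ‖trigPoly π (Pi.single k (Matrix.single j i' 1))‖ :=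
      Finset.single_le_sum (f := fun i' => C * ‖trigPoly π (Pi.single k (Matrix.single j i' 1))‖)
        (fun i' _ => hn k j i') (Finset.mem_univ i)
    _ ≤ ∑ j', ∑ i', C * ‖trigPoly π (Pi.single k (Matrix.single j' i' 1))‖ :=
      Finset.single_le_sum
        (f := fun j' => ∑ i', C * ‖trigPoly π (Pi.single k (Matrix.single j' i' 1))‖)
        (fun j' _ => Finset.sum_nonneg fun i' _ => hn k j' i') (Finset.mem_univ j)
    _ ≤ _ := Finset.single_le_sum
        (f := fun k => ∑ j', ∑ i', C * ‖trigPoly π (Pi.single k (Matrix.single j' i' 1))‖)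
        (fun k _ => Finset.sum_nonneg fun j' _ => Finset.sum_nonneg fun i' _ => hn k j' i')
        (Finset.mem_univ k)

/-- The trace functional is dominated by the trace norms, hence by C times the L¹ norm of the random
polynomial, which makes Hahn–Banach applicable. -/
theorem exists_functional_trigPolyCLM {C : ℝ} (hC : 0 ≤ C)
    (h : ∀ x : Coeff π, sumTraceNorm π x ≤ C * expNorm x) :
    ∃ Φ : StrongDual ℂ (Lp C(G, ℂ) 1 (gaussianLaw π)), ‖Φ‖ ≤ C ∧
      ∀ x : Coeff π, applyL1 Φ (fun g => trigPolyCLM x g) = pairing π x 1 := by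
  let Λ : Coeff π →ₗ[ℂ] Lp C(G, ℂ) 1 (gaussianLaw π) :=
    { toFun := fun x => (integrable_trigPolyCLM x).toL1
      map_add' := fun x y => by
        rw [← Integrable.toL1_add]
        congr 1
        funext g
        rw [Pi.add_apply, trigPolyCLM_apply, add_mul, trigPoly_add]; rfl
      map_smul' := fun c x => by
        rw [RingHom.id_apply, ← Integrable.toL1_smul]
        congr 1
        funext g
        rw [trigPolyCLM_apply, smul_mul_assoc, trigPoly_smul]; rfl }
  let f : Coeff π →ₗ[ℂ] ℂ :=
    { toFun := fun x => pairing π x 1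
      map_add' := fun x y => pairing_add_left x y 1
      map_smul' := fun c x => pairing_smul_left c x 1 }
  have hf : ∀ x, ‖f x‖ ≤ C * ‖Λ x‖ := fun x => by
    have h1 : ‖Λ x‖ = expNorm x := by
      change ‖(integrable_trigPolyCLM x).toL1‖ = _
      rw [Integrable.norm_toL1_eq_lintegral_norm, expNorm, ← integral_eq_lintegral_of_nonneg_ae
        (Filter.Eventually.of_forall fun _ => norm_nonneg _)
        (integrable_trigPolyCLM x).norm.aestronglyMeasurable]
    rw [h1]
    refine le_trans ?_ (h x)
    refine (norm_sum_le _ _).trans (Finset.sum_le_sum fun k _ => ?_)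
    rw [norm_mul, Complex.norm_natCast, Pi.one_apply, mul_one]
    exact mul_le_mul_of_nonneg_left (norm_trace_le_traceNorm _) (Nat.cast_nonneg _)
  obtain ⟨Φ, hΦ, hΦΛ⟩ := exists_strongDual_of_norm_le Λ f hC hf
  exact ⟨Φ, hΦ, fun x => (applyL1_of_integrable Φ (integrable_trigPolyCLM x)).trans (hΦΛ x)⟩

theorem applyL1_trigPolyCLM (Φ : StrongDual ℂ (Lp C(G, ℂ) 1 (gaussianLaw π)))
    {p : Block π → Coeff π} (hp : ∀ k i j, IsDensity Φ (fun g => p g k i j) ((π k).entry i j))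
    (x : Coeff π) :
    applyL1 Φ (fun g => trigPolyCLM x g) =
      ∫ g, pairing π (x * toCoeff g) (p g) ∂(gaussianLaw π) := by
  have hmem : ∀ l a b, MemLp (fun g : Block π => ((π l).dim : ℂ) * (x * toCoeff g) l a b) 2
      (gaussianLaw π) := by
    intro l a b
    simp only [Pi.mul_apply, Matrix.mul_apply, toCoeff, Matrix.of_apply]
    have h1 : ∀ c, MemLp (fun g : Block π => g l c b) 2 (gaussianLaw π) := fun c =>
      memLp_gaussianProd (d := fun k => (π k).dim) (entryCLM l c b) 2 (by simp)
    have h2 : MemLp (fun g : Block π => ∑ c, x l a c * g l c b) 2 (gaussianLaw π) :=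
      memLp_finsetSum _ fun c _ => (h1 c).const_mul _
    exact h2.const_mul _
  simp_rw [trigPolyCLM_apply, trigPoly_eq_sum, pairing_eq_sum]
  exact applyL1_sum_sum_smul Φ hmem fun k i j => hp k j i

theorem IsDensity.pairing {Φ : StrongDual ℂ (Lp C(G, ℂ) 1 (gaussianLaw π))}
    {p : Block π → Coeff π} (hp : ∀ k i j, IsDensity Φ (fun g => p g k i j) ((π k).entry i j))
    (x : Coeff π) : IsDensity Φ (fun g => pairing π x (p g)) (trigPoly π x) := by
  simp_rw [pairing_eq_sum, trigPoly_eq_sum]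
  exact IsDensity.sum _ fun k => IsDensity.sum _ fun i => IsDensity.sum _ fun j => (hp k j i).smul _

/-- Almost sure bounds for each polynomial can be turned into a simultaneous bound. -/
theorem exists_measurableSet_forall_norm_le {Ω : Type*} [MeasurableSpace Ω] {μ : Measure Ω} {C : ℝ}
    {p : Ω → Coeff π} (hp : ∀ k i j, Measurable fun g => p g k i j)
    (h : ∀ x, ∀ᵐ g ∂μ, ‖pairing π x (p g)‖ ≤ C * ‖trigPoly π x‖) :
    ∃ A : Set Ω, MeasurableSet A ∧ (∀ᵐ g ∂μ, g ∈ A) ∧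
      ∀ g ∈ A, ∀ x, ‖pairing π x (p g)‖ ≤ C * ‖trigPoly π x‖ := by
  -- The exceptional null set depends on x. A countable dense set of coefficients gives a single
  -- null set, and continuity covers the remaining x.
  let D : ℕ → Block π := TopologicalSpace.denseSeq (Block π)
  refine ⟨⋂ n, {g | ‖pairing π (toCoeff (D n)) (p g)‖ ≤ C * ‖trigPoly π (toCoeff (D n))‖},
    MeasurableSet.iInter fun n => ?_, ?_, fun g hg x => ?_⟩
  · have h1 : Measurable fun g => pairing π (toCoeff (D n)) (p g) :=
      measurable_pairing (x := fun _ => toCoeff (D n)) (fun _ _ _ => measurable_const) hp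
    exact measurableSet_le h1.norm measurable_const
  · simp only [Set.mem_iInter]
    exact ae_all_iff.2 fun n => h _
  · have hcl : IsClosed {y : Block π | ‖pairing π (toCoeff y) (p g)‖ ≤
        C * ‖trigPoly π (toCoeff y)‖} := by
      refine isClosed_le (continuous_pairing_toCoeff _).norm ?_
      have : ∀ y : Block π, trigPoly π (toCoeff y) = trigPolyCLM 1 y := fun y => by
        rw [trigPolyCLM_apply, one_mul]
      simp_rw [this]
      exact continuous_const.mul (trigPolyCLM 1).continuous.norm
    have hr : Set.range D ⊆ {y : Block π | ‖pairing π (toCoeff y) (p g)‖ ≤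
        C * ‖trigPoly π (toCoeff y)‖} := by
      rintro _ ⟨n, rfl⟩
      exact Set.mem_iInter.1 hg n
    have hcl2 := hcl.closure_subset_iff.2 hr
    rw [(TopologicalSpace.denseRange_denseSeq (Block π)).closure_range] at hcl2
    exact hcl2 (Set.mem_univ fun k i j => x k i j)

theorem exists_ae_eq_forall_norm_le {Ω : Type*} [MeasurableSpace Ω] {μ : Measure Ω} {C : ℝ}
    (hC : 0 ≤ C) {p : Ω → Coeff π}
    (hp : ∀ k i j, Measurable fun g => p g k i j)
    (h : ∀ x, ∀ᵐ g ∂μ, ‖pairing π x (p g)‖ ≤ C * ‖trigPoly π x‖) :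
    ∃ p' : Ω → Coeff π, (∀ᵐ g ∂μ, p' g = p g) ∧
      (∀ k i j, Measurable fun g => p' g k i j) ∧
      ∀ g x, ‖pairing π x (p' g)‖ ≤ C * ‖trigPoly π x‖ := by
  classical
  obtain ⟨A, hA, hAae, hAle⟩ := exists_measurableSet_forall_norm_le hp h
  refine ⟨fun g => if g ∈ A then p g else 0, ?_, fun k i j => ?_, fun g x => ?_⟩
  · filter_upwards [hAae] with g hg
    exact if_pos hg
  · have : (fun g => (if g ∈ A then p g else 0) k i j) =
        fun g => if g ∈ A then p g k i j else 0 := by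
      funext g
      split_ifs <;> rfl
    rw [this]
    exact Measurable.ite hA (hp k i j) measurable_const
  · by_cases hg : g ∈ A
    · simp only [if_pos hg]
      exact hAle g hg x
    · simp only [if_neg hg, SidonRep.pairing, Pi.zero_apply, Matrix.trace_zero, mul_zero,
        Finset.sum_const_zero, norm_zero]
      positivity

/-- The densities of the Hahn–Banach functional on the matrix coefficients, corrected on a null set
so that the bound holds everywhere. Testing on elementary matrices gives E g_k p_k(g) = 1. -/
theorem exists_dualMatrices {C : ℝ} (hC : 0 ≤ C)
    (h : ∀ x : Coeff π, sumTraceNorm π x ≤ C * expNorm x) :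
    ∃ p : Block π → Coeff π, (∀ k i j, Measurable fun g => p g k i j) ∧
      (∀ g x, ‖pairing π x (p g)‖ ≤ C * ‖trigPoly π x‖) ∧
      ∀ k i j, ∫ g, (Matrix.of (g k) * p g k) i j ∂(gaussianLaw π) =
        (1 : Matrix _ _ ℂ) i j := by
  classical
  obtain ⟨Φ, hΦ, hΦΛ⟩ := exists_functional_trigPolyCLM hC h
  choose q hq using fun (k : κ) (i j : Fin (π k).dim) => exists_isDensity Φ ((π k).entry i j)
  let p₀ : Block π → Coeff π := fun g k => Matrix.of fun i j => q k i j g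
  have hp₀ : ∀ k i j, IsDensity Φ (fun g => p₀ g k i j) ((π k).entry i j) := hq
  obtain ⟨p, hpae, hpm, hpb⟩ := exists_ae_eq_forall_norm_le (μ := gaussianLaw π) hC
    (fun k i j => (hp₀ k i j).measurable) fun x => by
      filter_upwards [(IsDensity.pairing hp₀ x).ae_norm_le] with g hg
      exact hg.trans (mul_le_mul_of_nonneg_right hΦ (norm_nonneg _))
  refine ⟨p, hpm, hpb, fun k i j => ?_⟩
  have hd : ((π k).dim : ℂ) ≠ 0 := by
    have : 0 < (π k).dim := (Nat.zero_le _).trans_lt i.2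
    exact_mod_cast this.ne'
  have h2 := applyL1_trigPolyCLM Φ hp₀ (Pi.single k (Matrix.single j i 1))
  have h3 : ∫ g, pairing π (Pi.single k (Matrix.single j i 1) * toCoeff g) (p₀ g) ∂gaussianLaw π =
      (π k).dim * ∫ g, (Matrix.of (g k) * p g k) i j ∂gaussianLaw π := by
    rw [← integral_const_mul]
    refine integral_congr_ae ?_
    filter_upwards [hpae] with g hg
    rw [hg, pairing_mul_left, pairing_single, one_mul]
    rfl
  rw [hΦΛ, h3, pairing_single, one_mul] at h2
  exact (mul_left_cancel₀ hd h2).symm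

end DualMatrices

/-! ### Averaging over the group -/

section Averaging

variable {G : Type*} [Group G] [TopologicalSpace G] [CompactSpace G]
  {κ : Type*} [Fintype κ] {π : κ → Irrep G}

theorem norm_pairing_evalMat_mul_le {C : ℝ} (hC : 0 ≤ C) {p : Coeff π}
    (hp : ∀ x, ‖pairing π x p‖ ≤ C * ‖trigPoly π x‖) (s : G) (x : Coeff π) :
    ‖pairing π x (evalMat π s * p)‖ ≤ C * ‖trigPoly π x‖ := by
  rw [← pairing_mul_left]
  exact (hp _).trans (mul_le_mul_of_nonneg_left (norm_trigPoly_mul_evalMat_le x s) hC)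

theorem pairing_integral {Ω : Type*} [MeasurableSpace Ω] {μ : Measure Ω} {q : Ω → Coeff π}
    (hq : ∀ k i j, Integrable (fun ω => q ω k i j) μ) (x : Coeff π) :
    pairing π x (fun k => Matrix.of fun i j => ∫ ω, q ω k i j ∂μ) = ∫ ω, pairing π x (q ω) ∂μ := by
  simp_rw [pairing_eq_sum]
  have hi : ∀ k i j, Integrable (fun ω => (((π k).dim : ℂ) * x k i j) * q ω k j i) μ :=
    fun k i j => (hq k j i).const_mul _
  rw [integral_finsetSum _ fun l _ => integrable_finsetSum _ fun a _ => integrable_finsetSum _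
      fun b _ => hi l a b]
  refine Finset.sum_congr rfl fun l _ => ?_
  rw [integral_finsetSum _ fun a _ => integrable_finsetSum _ fun b _ => hi l a b]
  refine Finset.sum_congr rfl fun a _ => ?_
  rw [integral_finsetSum _ fun b _ => hi l a b]
  exact Finset.sum_congr rfl fun b _ => (integral_const_mul _ _).symm

theorem integrable_of_bounded {Ω : Type*} [MeasurableSpace Ω] {μ : Measure Ω} [IsFiniteMeasure μ]
    {f : Ω → ℂ} (hf : Measurable f) {K : ℝ} (hK : ∀ ω, ‖f ω‖ ≤ K) : Integrable f μ :=
  Integrable.of_bound hf.aestronglyMeasurable K (Filter.Eventually.of_forall hK)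

theorem integrable_entry (k : κ) (i j : Fin (π k).dim) :
    Integrable (fun g : Block π => g k i j) (gaussianLaw π) :=
  (memLp_gaussianProd (d := fun k => (π k).dim) (entryCLM k i j) 2 (by simp)).integrable
    (by norm_num)

theorem integrable_bounded_mul_entry {f : Block π → ℂ} (hf : Measurable f) {K : ℝ}
    (hK : ∀ g, ‖f g‖ ≤ K) (k : κ) (i j : Fin (π k).dim) :
    Integrable (fun g : Block π => f g * g k i j) (gaussianLaw π) :=
  (integrable_entry k i j).bdd_mul hf.aestronglyMeasurable (Filter.Eventually.of_forall hK)

variable [MeasurableSpace G] [BorelSpace G]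

theorem measurable_mat_apply (σ : Irrep G) (i j : Fin σ.dim) : Measurable fun t => σ.mat t i j :=
  Continuous.measurable (by fun_prop)

/-- The integrand of the group average. -/
def twist (p : Block π → Coeff π) (g : Block π) (s : G) : Coeff π :=
  evalMat π s * p (blockMul g (evalMat π s))

theorem measurable_twist {p : Block π → Coeff π} (hp : ∀ k i j, Measurable fun g => p g k i j)
    (k : κ) (i j : Fin (π k).dim) :
    Measurable fun z : Block π × G => twist p z.1 z.2 k i j := by
  have h1 : Measurable fun z : Block π × G => blockMul z.1 (evalMat π z.2) := by
    refine measurable_pi_iff.2 fun l => measurable_pi_iff.2 fun a => measurable_pi_iff.2 fun b => ?_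
    simp only [blockMul, Matrix.mul_apply, Matrix.of_apply, evalMat]
    have h2 : ∀ c, Measurable fun z : Block π × G => (π l).mat z.2 c b := fun c =>
      (measurable_mat_apply (π l) c b).comp measurable_snd
    refine Finset.measurable_fun_sum _ fun c _ => ?_
    refine Measurable.mul ?_ (h2 c)
    fun_prop
  simp only [twist, Pi.mul_apply, Matrix.mul_apply, evalMat]
  exact Finset.measurable_fun_sum _ fun c _ =>
    ((measurable_mat_apply (π k) i c).comp measurable_snd).mul ((hp k c j).comp h1)

variable (m : Measure G) [IsProbabilityMeasure m]

/-- The group average. -/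
def groupAverage (p : Block π → Coeff π) (g : Block π) : Coeff π :=
  fun k => Matrix.of fun i j => ∫ s, twist p g s k i j ∂m

theorem measurable_groupAverage {p : Block π → Coeff π}
    (hp : ∀ k i j, Measurable fun g => p g k i j) (k : κ) (i j : Fin (π k).dim) :
    Measurable fun g => groupAverage m p g k i j :=
  ((measurable_twist hp k i j).stronglyMeasurable.integral_prod_right).measurable

variable {C : ℝ} {p : Block π → Coeff π}

theorem norm_pairing_twist_le (hC : 0 ≤ C)
    (hb : ∀ g x, ‖pairing π x (p g)‖ ≤ C * ‖trigPoly π x‖) (g : Block π) (s : G) (x : Coeff π) :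
    ‖pairing π x (twist p g s)‖ ≤ C * ‖trigPoly π x‖ :=
  norm_pairing_evalMat_mul_le hC (hb _) s x

theorem integrable_twist (hC : 0 ≤ C) (hp : ∀ k i j, Measurable fun g => p g k i j)
    (hb : ∀ g x, ‖pairing π x (p g)‖ ≤ C * ‖trigPoly π x‖) (g : Block π) (k : κ)
    (i j : Fin (π k).dim) : Integrable (fun s => twist p g s k i j) m := by
  obtain ⟨K, hK⟩ := exists_entry_bound (π := π) hC
  have h1 := fun (f : Block π × G → ℂ) (hf : Measurable f) =>
    hf.comp (measurable_prodMk_left (x := g))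
  exact integrable_of_bounded (h1 _ (measurable_twist hp k i j)) fun s => hK _ (norm_pairing_twist_le hC hb g s) k i j

theorem norm_pairing_groupAverage_le (hC : 0 ≤ C)
    (hp : ∀ k i j, Measurable fun g => p g k i j)
    (hb : ∀ g x, ‖pairing π x (p g)‖ ≤ C * ‖trigPoly π x‖) (g : Block π) (x : Coeff π) :
    ‖pairing π x (groupAverage m p g)‖ ≤ C * ‖trigPoly π x‖ := by
  have h1 : pairing π x (groupAverage m p g) = ∫ s, pairing π x (twist p g s) ∂m :=
    pairing_integral (integrable_twist m hC hp hb g) x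
  have h2 := norm_integral_le_of_norm_le_const (μ := m) (f := fun s => pairing π x (twist p g s))
    (Filter.Eventually.of_forall fun s => norm_pairing_twist_le hC hb g s x)
  rwa [probReal_univ, mul_one, ← h1] at h2

/-- Invariance of the law under g ↦ g π(s) turns the covariance into a Haar average of products of
matrix coefficients of π_k(s) and π_l(s⁻¹), with weights M. Schur orthogonality kills it for k ≠ l;
for k = l it leaves the trace of M, which is known from E g p = 1. -/
theorem integral_groupAverage_mul_entry [IsTopologicalGroup G] [m.IsHaarMeasure] (hC : 0 ≤ C)
    (hπ : Function.Injective fun k => (π k).cls)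
    (hp : ∀ k i j, Measurable fun g => p g k i j)
    (hb : ∀ g x, ‖pairing π x (p g)‖ ≤ C * ‖trigPoly π x‖)
    (h1 : ∀ k i j, ∫ g, (Matrix.of (g k) * p g k) i j ∂(gaussianLaw π) = (1 : Matrix _ _ ℂ) i j)
    (k l : κ) (i j : Fin (π k).dim) (a b : Fin (π l).dim) :
    ∫ g, groupAverage m p g k i j * g l a b ∂(gaussianLaw π) =
      ∫ g, star (g k j i) * g l a b ∂(gaussianLaw π) := by
  obtain ⟨K, hK⟩ := exists_entry_bound (π := π) hC
  let M : Fin (π k).dim → Fin (π l).dim → ℂ := fun e c =>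
    ∫ g, p g k e j * g l a c ∂(gaussianLaw π)
  have hpi : ∀ e c, Integrable (fun g : Block π => p g k e j * g l a c) (gaussianLaw π) :=
    fun e c => integrable_bounded_mul_entry (hp k e j) (fun g => hK _ (hb g) k e j) l a c
  have hinner : ∀ s, ∫ g, twist p g s k i j * g l a b ∂(gaussianLaw π) =
      ∑ e, ∑ c, ((π k).mat s i e * (π l).mat s⁻¹ c b) * M e c := by
    intro s
    let F : Block π → ℂ := fun h => ∑ e, ∑ c,
      ((π k).mat s i e * (π l).mat s⁻¹ c b) * (p h k e j * h l a c)
    have hFm : Measurable F := by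
      refine Finset.measurable_fun_sum _ fun e _ => Finset.measurable_fun_sum _ fun c _ => ?_
      exact ((hp k e j).mul (by fun_prop)).const_mul _
    have hF : ∀ g : Block π, twist p g s k i j * g l a b = F (blockMul g (evalMat π s)) := by
      intro g
      -- Writing g = (g π(s)) π(s⁻¹) makes the integrand a function of g π(s) alone for fixed s.
      have h2 : g l a b = ∑ c, blockMul g (evalMat π s) l a c * (π l).mat s⁻¹ c b := by
        have : Matrix.of (g l) = Matrix.of (blockMul g (evalMat π s) l) * (π l).mat s⁻¹ := by
          change _ = Matrix.of (g l) * (π l).mat s * (π l).mat s⁻¹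
          rw [Matrix.mul_assoc, Irrep.mat_mul_mat_inv, Matrix.mul_one]
        exact (congrFun (congrFun this a) b).trans (Matrix.mul_apply)
      rw [h2]
      simp only [twist, Pi.mul_apply, Matrix.mul_apply, evalMat, F, Finset.sum_mul_sum]
      refine Finset.sum_congr rfl fun e _ => Finset.sum_congr rfl fun c _ => ?_
      ring
    simp_rw [hF]
    have hT : MeasurePreserving (fun g : Block π => blockMul g (evalMat π s)) (gaussianLaw π)
        (gaussianLaw π) := measurePreserving_blockMul fun k => (π k).mat_mem s
    rw [integral_comp_of_measurePreserving hT hFm.aestronglyMeasurable]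
    simp only [F]
    rw [integral_finsetSum _ fun e _ => integrable_finsetSum _ fun c _ => (hpi e c).const_mul _]
    refine Finset.sum_congr rfl fun e _ => ?_
    rw [integral_finsetSum _ fun c _ => (hpi e c).const_mul _]
    exact Finset.sum_congr rfl fun c _ => integral_const_mul _ _
  have hswap : ∫ g, groupAverage m p g k i j * g l a b ∂(gaussianLaw π) =
      ∫ s, ∫ g, twist p g s k i j * g l a b ∂(gaussianLaw π) ∂m := by
    rw [integral_integral_swap]
    · refine integral_congr_ae (Filter.Eventually.of_forall fun g => ?_)
      exact (integral_mul_const _ _).symm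
    · have h3 := ((integrable_entry l a b).comp_fst m).bdd_mul
        (measurable_twist hp k i j).aestronglyMeasurable
        (Filter.Eventually.of_forall fun z => hK _ (norm_pairing_twist_le hC hb z.1 z.2) k i j)
      exact h3.swap
  have hsm : ∀ e c, Integrable (fun s => ((π k).mat s i e * (π l).mat s⁻¹ c b) * M e c) m :=
    fun e c => integrable_continuous m _ (by fun_prop)
  rw [hswap]
  simp_rw [hinner]
  rw [integral_finsetSum _ fun e _ => integrable_finsetSum _ fun c _ => hsm e c]
  simp_rw [integral_finsetSum Finset.univ fun c _ => hsm _ c, integral_mul_const]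
  by_cases hkl : k = l
  · subst hkl
    simp_rw [integral_mat_mul_mat_inv]
    have h4 : ∀ g : Block π, star (g k j i) * g k a b = g k a b * star (g k j i) :=
      fun g => mul_comm _ _
    simp_rw [h4]
    rw [integral_entry_mul_star_entry (d := fun k => (π k).dim)]
    have h5 : ∑ e, M e e = if a = j then 1 else 0 := by
      simp only [M]
      rw [← integral_finsetSum _ fun e _ => hpi e e, ← Matrix.one_apply, ← h1 k a j]
      refine integral_congr_ae (Filter.Eventually.of_forall fun g => ?_)
      simp only [Matrix.mul_apply, Matrix.of_apply]
      exact Finset.sum_congr rfl fun e _ => mul_comm _ _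
    by_cases hib : i = b
    · have h6 : ∀ e, ∑ c, (if i = b ∧ c = e then ((π k).dim : ℂ)⁻¹ else 0) * M e c =
          ((π k).dim : ℂ)⁻¹ * M e e := fun e => by
        simp [hib]
      simp_rw [h6]
      rw [← Finset.mul_sum, h5]
      by_cases haj : a = j <;> simp [hib, haj]
    · have h7 : b ≠ i := fun h => hib h.symm
      simp [hib, h7]
  · have hne : (π k).cls ≠ (π l).cls := fun h => hkl (hπ h)
    simp_rw [integral_mat_mul_mat_inv_of_ne m hne]
    have h4 : ∀ g : Block π, star (g k j i) * g l a b = g l a b * star (g k j i) :=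
      fun g => mul_comm _ _
    simp_rw [h4]
    rw [integral_entry_mul_star_entry_of_ne (d := fun k => (π k).dim) l k a b j i
      fun e => absurd e.symm hkl]
    simp

end Averaging

/-! ### Averaging over fourth roots of unity -/

section Phase
open Complex

variable {G : Type*} [Group G] [TopologicalSpace G] [CompactSpace G]
  {κ : Type*} [Fintype κ] {π : κ → Irrep G} {C : ℝ} {p : Block π → Coeff π}

/-- The average over the fourth roots of unity. -/
def phaseAverage (p : Block π → Coeff π) (g : Block π) : Coeff π :=
  (1 / 4 : ℂ) • (p g + I • p (I • g) + (-1 : ℂ) • p ((-1 : ℂ) • g) + (-I) • p ((-I) • g))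

theorem phaseAverage_apply (p : Block π → Coeff π) (g : Block π) (k : κ) (i j : Fin (π k).dim) :
    phaseAverage p g k i j = (1 / 4 : ℂ) * (p g k i j + I * p (I • g) k i j +
      (-1 : ℂ) * p ((-1 : ℂ) • g) k i j + (-I) * p ((-I) • g) k i j) := rfl

/-- The averaged family transforms under g ↦ i g exactly as g* does. This forces its mean and its
covariances with conjugate entries to vanish. -/
theorem phaseAverage_I_smul (p : Block π → Coeff π) (g : Block π) (k : κ) (i j : Fin (π k).dim) :
    phaseAverage p (I • g) k i j = -I * phaseAverage p g k i j := by
  have h1 : I • I • g = (-1 : ℂ) • g := by rw [smul_smul, I_mul_I]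
  have h2 : (-1 : ℂ) • I • g = (-I) • g := by rw [smul_smul, neg_one_mul]
  have h3 : (-I) • I • g = g := by rw [smul_smul, neg_mul, I_mul_I, neg_neg, one_smul]
  rw [phaseAverage_apply, phaseAverage_apply, h1, h2, h3]
  linear_combination (1 / 4 : ℂ) * (p (I • g) k i j - p ((-I) • g) k i j) * I_mul_I

theorem measurable_phaseAverage (hp : ∀ k i j, Measurable fun g => p g k i j) (k : κ)
    (i j : Fin (π k).dim) : Measurable fun g => phaseAverage p g k i j := by
  simp_rw [phaseAverage_apply]
  have h : ∀ w : ℂ, Measurable fun g : Block π => p (w • g) k i j := fun w =>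
    (hp k i j).comp (measurable_const_smul w)
  exact ((((hp k i j).add ((h I).const_mul _)).add ((h (-1)).const_mul _)).add
    ((h (-I)).const_mul _)).const_mul _

theorem norm_pairing_phaseAverage_le
    (hb : ∀ g x, ‖pairing π x (p g)‖ ≤ C * ‖trigPoly π x‖) (g : Block π) (x : Coeff π) :
    ‖pairing π x (phaseAverage p g)‖ ≤ C * ‖trigPoly π x‖ := by
  have h1 : pairing π x (phaseAverage p g) = (1 / 4 : ℂ) * (pairing π x (p g) +
      I * pairing π x (p (I • g)) + (-1 : ℂ) * pairing π x (p ((-1 : ℂ) • g)) +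
      (-I) * pairing π x (p ((-I) • g))) := by
    simp only [pairing_comm x, phaseAverage, pairing_smul_left, pairing_add_left]
  rw [h1, norm_mul]
  have h2 : ∀ w : ℂ, ‖w‖ = 1 → ‖w * pairing π x (p (w • g))‖ ≤ C * ‖trigPoly π x‖ :=
    fun w hw => by rw [norm_mul, hw, one_mul]; exact hb _ _
  have e1 := hb g x
  have e2 := h2 I (by simp)
  have e3 := h2 (-1) (by simp)
  have e4 := h2 (-I) (by simp)
  have e5 : ‖(1 / 4 : ℂ)‖ = 1 / 4 := by simp
  have e6 := norm_add_le (pairing π x (p g) + I * pairing π x (p (I • g)) +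
    (-1 : ℂ) * pairing π x (p ((-1 : ℂ) • g))) ((-I) * pairing π x (p ((-I) • g)))
  have e7 := norm_add_le (pairing π x (p g) + I * pairing π x (p (I • g)))
    ((-1 : ℂ) * pairing π x (p ((-1 : ℂ) • g)))
  have e8 := norm_add_le (pairing π x (p g)) (I * pairing π x (p (I • g)))
  rw [e5]
  linarith

/-- Each of the four terms has the original covariance, because w p(w g) g is p(w g) (w g),
evaluated along a law-preserving map. -/
theorem integral_phaseAverage_mul_entry (hC : 0 ≤ C)
    (hp : ∀ k i j, Measurable fun g => p g k i j)
    (hb : ∀ g x, ‖pairing π x (p g)‖ ≤ C * ‖trigPoly π x‖)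
    (k l : κ) (i j : Fin (π k).dim) (a b : Fin (π l).dim) :
    ∫ g, phaseAverage p g k i j * g l a b ∂(gaussianLaw π) =
      ∫ g, p g k i j * g l a b ∂(gaussianLaw π) := by
  obtain ⟨K, hK⟩ := exists_entry_bound (π := π) hC
  have hi : Integrable (fun g : Block π => p g k i j * g l a b) (gaussianLaw π) :=
    integrable_bounded_mul_entry (hp k i j) (fun g => hK _ (hb g) k i j) l a b
  have hw : ∀ w : ℂ, star w * w = 1 →
      Integrable (fun g : Block π => w * p (w • g) k i j * g l a b) (gaussianLaw π) ∧
      ∫ g, w * p (w • g) k i j * g l a b ∂(gaussianLaw π) =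
        ∫ g, p g k i j * g l a b ∂(gaussianLaw π) := by
    intro w hw
    have hT := measurePreserving_smul (d := fun k => (π k).dim) hw
    have h1 : (fun g : Block π => w * p (w • g) k i j * g l a b) =
        fun g => (fun g : Block π => p g k i j * g l a b) (w • g) := by
      funext g
      simp only [Pi.smul_apply, smul_eq_mul]
      ring
    rw [h1]
    exact ⟨hT.integrable_comp_of_integrable hi,
      integral_comp_of_measurePreserving hT hi.aestronglyMeasurable⟩
  have h2 := hw I (by simp)
  have h3 := hw (-1) (by simp)
  have h4 := hw (-I) (by simp)
  have h5 : ∀ g : Block π, phaseAverage p g k i j * g l a b = (1 / 4 : ℂ) *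
      (p g k i j * g l a b + I * p (I • g) k i j * g l a b +
      (-1 : ℂ) * p ((-1 : ℂ) • g) k i j * g l a b + (-I) * p ((-I) • g) k i j * g l a b) := by
    intro g
    rw [phaseAverage_apply]
    ring
  simp_rw [h5]
  rw [integral_const_mul, integral_add ((hi.fun_add h2.1).fun_add h3.1) h4.1,
    integral_add (hi.fun_add h2.1) h3.1, integral_add hi h2.1, h2.2, h3.2, h4.2]
  ring

theorem exists_coeff_strongDual (L : StrongDual ℝ (Block π)) :
    ∃ c : ∀ k, Fin (π k).dim → Fin (π k).dim → ℂ, ∀ g : Block π,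
      (L g : ℂ) = ∑ k, ∑ i, ∑ j, (1 / 2 : ℂ) * (c k i j * g k i j + star (c k i j) *
        star (g k i j)) := by
  classical
  let e : ∀ k (i j : Fin (π k).dim), ℂ →L[ℝ] Block π := fun k i j =>
    ((ContinuousLinearMap.single ℝ (fun k => Fin (π k).dim → Fin (π k).dim → ℂ) k).comp
      (ContinuousLinearMap.single ℝ (fun _ => Fin (π k).dim → ℂ) i)).comp
      (ContinuousLinearMap.single ℝ (fun _ => ℂ) j)
  refine ⟨fun k i j => dualCoeff (L.comp (e k i j)), fun g => ?_⟩
  have hg : g = ∑ k, ∑ i, ∑ j, e k i j (g k i j) := by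
    funext l a b
    simp only [Finset.sum_apply]
    rw [Finset.sum_eq_single l, Finset.sum_eq_single a, Finset.sum_eq_single b]
    · simp [e]
    · intro j _ hj; simp [e, Pi.single_eq_of_ne hj.symm]
    · simp
    · intro i _ hi
      refine Finset.sum_eq_zero fun j _ => ?_
      simp [e, Pi.single_eq_of_ne hi.symm]
    · simp
    · intro k _ hk
      refine Finset.sum_eq_zero fun i _ => Finset.sum_eq_zero fun j _ => ?_
      simp [e, Pi.single_eq_of_ne hk.symm]
    · simp
  conv_lhs => rw [hg]
  simp only [map_sum, Complex.ofReal_sum]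
  refine Finset.sum_congr rfl fun k _ => Finset.sum_congr rfl fun i _ =>
    Finset.sum_congr rfl fun j _ => ?_
  have h1 := dualCoeff_spec (L.comp (e k i j)) (g k i j)
  rw [ContinuousLinearMap.comp_apply] at h1
  rw [h1, Complex.re_eq_add_conj, map_mul]
  change _ = (1 / 2 : ℂ) * (_ + (starRingEnd ℂ) _ * (starRingEnd ℂ) _)
  ring

end Phase

/-! ### Dual matrices that agree with g* up to higher chaos -/

section Orthogonality
open Complex

variable {G : Type*} [Group G] [TopologicalSpace G] [IsTopologicalGroup G] [CompactSpace G]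
  [MeasurableSpace G] [BorelSpace G] {κ : Type*} [Fintype κ] {π : κ → Irrep G}

/-- The functionals dual to the Gaussian matrices can be chosen so that their difference with the
adjoint matrices is orthogonal to all affine functions. -/
theorem exists_dualMatrices_orthogonal (m : Measure G) [m.IsHaarMeasure] [IsProbabilityMeasure m]
    {C : ℝ} (hC : 0 ≤ C)
    (hπ : Function.Injective fun k => (π k).cls)
    (h : ∀ x : Coeff π, sumTraceNorm π x ≤ C * expNorm x) :
    ∃ p : Block π → Coeff π, (∀ k i j, Measurable fun g => p g k i j) ∧
      (∀ g x, ‖pairing π x (p g)‖ ≤ C * ‖trigPoly π x‖) ∧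
      (∀ k i j a b, ∫ g, p g k i j * g k a b ∂(gaussianLaw π) =
        if a = j ∧ b = i then ((π k).dim : ℂ)⁻¹ else 0) ∧
      (∀ k i j, ∫ g, (p g k i j - star (g k j i)) ∂(gaussianLaw π) = 0) ∧
      ∀ (L : StrongDual ℝ (Block π)) k i j,
        ∫ g, (L g : ℂ) * (p g k i j - star (g k j i)) ∂(gaussianLaw π) = 0 := by
  obtain ⟨p₀, hm₀, hb₀, h₀⟩ := exists_dualMatrices hC h
  let p₁ := groupAverage m p₀
  have hm₁ : ∀ k i j, Measurable fun g => p₁ g k i j := measurable_groupAverage m hm₀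
  have hb₁ : ∀ g x, ‖pairing π x (p₁ g)‖ ≤ C * ‖trigPoly π x‖ :=
    norm_pairing_groupAverage_le m hC hm₀ hb₀
  let p := phaseAverage p₁
  have hm : ∀ k i j, Measurable fun g => p g k i j := measurable_phaseAverage hm₁
  have hb : ∀ g x, ‖pairing π x (p g)‖ ≤ C * ‖trigPoly π x‖ := norm_pairing_phaseAverage_le hb₁
  have hcov : ∀ (k l : κ) (i j : Fin (π k).dim) (a b : Fin (π l).dim),
      ∫ g, p g k i j * g l a b ∂(gaussianLaw π) =
      ∫ g, star (g k j i) * g l a b ∂(gaussianLaw π) := fun k l i j a b => by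
    rw [integral_phaseAverage_mul_entry hC hm₁ hb₁]
    exact integral_groupAverage_mul_entry m hC hπ hm₀ hb₀ h₀ k l i j a b
  have hI : ∀ g k i j, p (I • g) k i j = -I * p g k i j := phaseAverage_I_smul p₁
  obtain ⟨K, hK⟩ := exists_entry_bound (π := π) hC
  have hp2 : ∀ k i j, MemLp (fun g => p g k i j) 2 (gaussianLaw π) := fun k i j =>
    MemLp.of_bound (hm k i j).aestronglyMeasurable K
      (Filter.Eventually.of_forall fun g => hK _ (hb g) k i j)
  have hg2 : ∀ k (i j : Fin (π k).dim), MemLp (fun g : Block π => g k i j) 2 (gaussianLaw π) :=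
    fun k i j => memLp_gaussianProd (d := fun k => (π k).dim) (entryCLM k i j) 2 (by simp)
  have hd2 : ∀ k i j, MemLp (fun g => p g k i j - star (g k j i)) 2 (gaussianLaw π) :=
    fun k i j => (hp2 k i j).sub (hg2 k j i).star
  have hdm : ∀ k i j, Measurable fun g => p g k i j - star (g k j i) := fun k i j =>
    (hm k i j).sub (continuous_star.measurable.comp (by fun_prop))
  have hsI : star I = -I := Complex.conj_I
  have hw : star I * I = 1 := by simp
  have hI1 : -I ≠ 1 := fun h => by simpa using congrArg Complex.re h
  have hdI : ∀ (g : Block π) k i j, p (I • g) k i j - star ((I • g) k j i) =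
      -I * (p g k i j - star (g k j i)) := fun g k i j => by
    rw [hI, Pi.smul_apply, Pi.smul_apply, Pi.smul_apply, smul_eq_mul, star_mul', hsI]
    ring
  have horth1 : ∀ k l (i j : Fin (π k).dim) (a b : Fin (π l).dim),
      ∫ g, g l a b * (p g k i j - star (g k j i)) ∂(gaussianLaw π) = 0 := fun k l i j a b => by
    have h1 : ∀ g : Block π, g l a b * (p g k i j - star (g k j i)) =
        p g k i j * g l a b - star (g k j i) * g l a b := fun g => by ring
    have i1 : Integrable (fun g : Block π => p g k i j * g l a b) (gaussianLaw π) :=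
      (hp2 k i j).integrable_mul (hg2 l a b)
    have i2 : Integrable (fun g : Block π => star (g k j i) * g l a b) (gaussianLaw π) :=
      (hg2 k j i).star.integrable_mul (hg2 l a b)
    simp_rw [h1]
    rw [integral_sub i1 i2, hcov, sub_self]
  -- Both factors are multiplied by -i under g ↦ i g, so the integrand changes sign.
  have horth2 : ∀ k l (i j : Fin (π k).dim) (a b : Fin (π l).dim),
      ∫ g, star (g l a b) * (p g k i j - star (g k j i)) ∂(gaussianLaw π) = 0 :=
    fun k l i j a b => by
    refine integral_eq_zero_of_smul (d := fun k => (π k).dim) ?_ hw (c := -1) (by norm_num) ?_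
    · exact (continuous_star.measurable.comp (by fun_prop)).mul (hdm k i j)
    · intro g
      have h1 := hdI g k i j
      rw [h1, Pi.smul_apply, Pi.smul_apply, Pi.smul_apply, smul_eq_mul, star_mul',
        hsI]
      linear_combination (star (g l a b) * (p g k i j - star (g k j i))) * I_mul_I
  refine ⟨p, hm, hb, fun k i j a b => ?_, fun k i j => ?_, fun L k i j => ?_⟩
  · rw [hcov]
    have h4 : ∀ g : Block π, star (g k j i) * g k a b = g k a b * star (g k j i) :=
      fun g => mul_comm _ _
    simp_rw [h4]
    rw [integral_entry_mul_star_entry (d := fun k => (π k).dim)]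
  · exact integral_eq_zero_of_smul (d := fun k => (π k).dim) (hdm k i j) hw hI1
      fun g => hdI g k i j
  -- A real-linear functional is a combination of entries and conjugate entries, which `horth1` and
  -- `horth2` treat respectively.
  · obtain ⟨c, hc⟩ := exists_coeff_strongDual L
    have h1 : ∀ g : Block π, (L g : ℂ) * (p g k i j - star (g k j i)) = ∑ l, ∑ a, ∑ b,
        ((c l a b / 2) * (g l a b * (p g k i j - star (g k j i))) +
          (star (c l a b) / 2) * (star (g l a b) * (p g k i j - star (g k j i)))) := fun g => by
      rw [hc]
      simp_rw [Finset.sum_mul]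
      refine Finset.sum_congr rfl fun l _ => Finset.sum_congr rfl fun a _ =>
        Finset.sum_congr rfl fun b _ => ?_
      ring
    have i1 : ∀ l a b, Integrable (fun g : Block π => (c l a b / 2) *
        (g l a b * (p g k i j - star (g k j i)))) (gaussianLaw π) := fun l a b =>
      ((hg2 l a b).integrable_mul (hd2 k i j)).const_mul _
    have i2 : ∀ l a b, Integrable (fun g : Block π => (star (c l a b) / 2) *
        (star (g l a b) * (p g k i j - star (g k j i)))) (gaussianLaw π) := fun l a b =>
      ((hg2 l a b).star.integrable_mul (hd2 k i j)).const_mul _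
    have i3 : ∀ l a b, Integrable (fun g : Block π => (c l a b / 2) *
        (g l a b * (p g k i j - star (g k j i))) + (star (c l a b) / 2) *
        (star (g l a b) * (p g k i j - star (g k j i)))) (gaussianLaw π) := fun l a b =>
      (i1 l a b).fun_add (i2 l a b)
    simp_rw [h1]
    rw [integral_finsetSum _ fun l _ => integrable_finsetSum _ fun a _ => integrable_finsetSum _
      fun b _ => i3 l a b]
    refine Finset.sum_eq_zero fun l _ => ?_
    rw [integral_finsetSum _ fun a _ => integrable_finsetSum _ fun b _ => i3 l a b]
    refine Finset.sum_eq_zero fun a _ => ?_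
    rw [integral_finsetSum _ fun b _ => i3 l a b]
    refine Finset.sum_eq_zero fun b _ => ?_
    rw [integral_add (i1 l a b) (i2 l a b), integral_const_mul, integral_const_mul, horth1, horth2,
      mul_zero, mul_zero, add_zero]

end Orthogonality

/-! ### First-order expansion of a correlated expectation -/

section MixEstimate

variable {E : Type*} [NormedAddCommGroup E] [NormedSpace ℝ E] [MeasurableSpace E] [BorelSpace E]
  [SecondCountableTopology E] [CompleteSpace E] {μ : Measure E} [IsGaussian μ]

theorem memLp_comp_mix (hμ : μ[id] = 0) {c s : ℝ} (hcs : c ^ 2 + s ^ 2 = 1) {f : E → ℂ}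
    (hf : MemLp f 2 μ) : MemLp (fun z : E × E => f (c • z.1 + s • z.2)) 2 (μ.prod μ) :=
  hf.comp_measurePreserving (measurePreserving_mixMap hμ hcs)

theorem memLp_comp_fst {f : E → ℂ} (hf : MemLp f 2 μ) :
    MemLp (fun z : E × E => f z.1) 2 (μ.prod μ) :=
  hf.comp_measurePreserving measurePreserving_fst

/-- The linear part γ of η contributes exactly c: its term in the independent variable has mean
zero. The rest η - γ lies beyond the first chaos and is controlled by the c² contraction, with √a √b
≤ (a + b)/2. -/
theorem norm_integral_sum_mix_sub_le (hμ : μ[id] = 0) {n : Type*} [Fintype n]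
    {α η γ : n → E → ℂ} (hα : ∀ j, MemLp (α j) 2 μ) (hη : ∀ j, MemLp (η j) 2 μ)
    (hγ : ∀ j, MemLp (γ j) 2 μ)
    (hγl : ∀ j (c s : ℝ) x y, γ j (c • x + s • y) = c * γ j x + s * γ j y)
    (hγ0 : ∀ j, ∫ x, γ j x ∂μ = 0) (h0 : ∀ j, ∫ x, (η j x - γ j x) ∂μ = 0)
    (hL : ∀ j (L : StrongDual ℝ E), ∫ x, L x * (η j x - γ j x) ∂μ = 0)
    (h1 : ∑ j, ∫ x, α j x * γ j x ∂μ = 1) {A B : ℝ}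
    (hA : ∑ j, ∫ x, ‖α j x‖ ^ 2 ∂μ ≤ A) (hB : ∑ j, ∫ x, ‖η j x - γ j x‖ ^ 2 ∂μ ≤ B)
    {c s : ℝ} (hc : c ∈ Set.Icc (0 : ℝ) 1) (hcs : c ^ 2 + s ^ 2 = 1) :
    ‖∫ z, ∑ j, α j z.1 * η j (c • z.1 + s • z.2) ∂(μ.prod μ) - c‖ ≤ c ^ 2 * ((A + B) / 2) := by
  have hi1 : ∀ j, Integrable (fun z : E × E => α j z.1 * (η j (c • z.1 + s • z.2) -
      γ j (c • z.1 + s • z.2))) (μ.prod μ) := fun j =>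
    (memLp_comp_fst (hα j)).integrable_mul (memLp_comp_mix hμ hcs ((hη j).sub (hγ j)))
  have hi2 : ∀ j, Integrable (fun z : E × E => (c : ℂ) * (α j z.1 * γ j z.1)) (μ.prod μ) :=
    fun j => (((hα j).integrable_mul (hγ j)).comp_fst μ).const_mul _
  have hi3 : ∀ j, Integrable (fun z : E × E => (s : ℂ) * (α j z.1 * γ j z.2)) (μ.prod μ) :=
    fun j => (((hα j).integrable (by norm_num)).mul_prod ((hγ j).integrable
      (by norm_num))).const_mul _
  have hsplit : ∀ j (z : E × E), α j z.1 * η j (c • z.1 + s • z.2) =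
      α j z.1 * (η j (c • z.1 + s • z.2) - γ j (c • z.1 + s • z.2)) +
        (c : ℂ) * (α j z.1 * γ j z.1) + (s : ℂ) * (α j z.1 * γ j z.2) := fun j z => by
    have := hγl j c s z.1 z.2
    linear_combination α j z.1 * this
  have hterm : ∀ j, ∫ z, α j z.1 * η j (c • z.1 + s • z.2) ∂(μ.prod μ) =
      ∫ z, α j z.1 * (η j (c • z.1 + s • z.2) - γ j (c • z.1 + s • z.2)) ∂(μ.prod μ) +
        c * ∫ x, α j x * γ j x ∂μ := fun j => by
    simp_rw [hsplit j]
    rw [integral_add ((hi1 j).fun_add (hi2 j)) (hi3 j), integral_add (hi1 j) (hi2 j),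
      integral_const_mul, integral_const_mul, integral_prod_mul (α j) (γ j), hγ0 j,
      integral_fun_fst (fun x => α j x * γ j x)]
    simp
  have hi : ∀ j, Integrable (fun z : E × E => α j z.1 * η j (c • z.1 + s • z.2)) (μ.prod μ) :=
    fun j => (memLp_comp_fst (hα j)).integrable_mul (memLp_comp_mix hμ hcs (hη j))
  rw [integral_finsetSum _ fun j _ => hi j]
  simp_rw [hterm]
  rw [Finset.sum_add_distrib, ← Finset.mul_sum, h1, mul_one, add_sub_cancel_right]
  calc _ ≤ ∑ j, c ^ 2 * ((∫ x, ‖α j x‖ ^ 2 ∂μ + ∫ x, ‖η j x - γ j x‖ ^ 2 ∂μ) / 2) := by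
        refine (norm_sum_le _ _).trans (Finset.sum_le_sum fun j _ => ?_)
        have h2 := norm_integral_mix_le hμ (hα j) ((hη j).sub (hγ j)) (h0 j) (hL j) hc hcs
        refine h2.trans ?_
        rw [mul_assoc]
        refine mul_le_mul_of_nonneg_left ?_ (sq_nonneg c)
        have h3 : 0 ≤ ∫ x, ‖α j x‖ ^ 2 ∂μ := integral_nonneg fun _ => sq_nonneg _
        have h4 : 0 ≤ ∫ x, ‖η j x - γ j x‖ ^ 2 ∂μ := integral_nonneg fun _ => sq_nonneg _
        have h5 := two_mul_le_add_sq (√(∫ x, ‖α j x‖ ^ 2 ∂μ)) (√(∫ x, ‖η j x - γ j x‖ ^ 2 ∂μ))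
        rw [Real.sq_sqrt h3, Real.sq_sqrt h4] at h5
        change _ * √(∫ x, ‖η j x - γ j x‖ ^ 2 ∂μ) ≤ _
        linarith
    _ = c ^ 2 * ((∑ j, ∫ x, ‖α j x‖ ^ 2 ∂μ + ∑ j, ∫ x, ‖η j x - γ j x‖ ^ 2 ∂μ) / 2) := by
        rw [← Finset.mul_sum, ← Finset.sum_div, Finset.sum_add_distrib]
    _ ≤ _ := by gcongr

end MixEstimate

/-! ### Row and column bounds for bounded functionals -/

section RowBounds

variable {G : Type*} [Group G] [TopologicalSpace G] [CompactSpace G]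
  {κ : Type*} [Fintype κ] {π : κ → Irrep G}

open Matrix

theorem norm_dotProduct_le {n : Type*} [Fintype n] (a b : n → ℂ) :
    ‖a ⬝ᵥ b‖ ≤ √(∑ i, ‖a i‖ ^ 2) * √(∑ i, ‖b i‖ ^ 2) := by
  refine (norm_sum_le _ _).trans ?_
  simp_rw [norm_mul]
  exact Real.sum_mul_le_sqrt_mul_sqrt _ _ _

/-- Testing on a rank-one coefficient gives the polynomial d_k a·π_k(t)w, bounded by d_k |a| |w|
since π_k(t) is unitary. So p_k has operator norm at most C, independently of the dimension. -/
theorem norm_dotProduct_mulVec_le {C : ℝ} (hC : 0 ≤ C) {p : Coeff π}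
    (hp : ∀ x, ‖pairing π x p‖ ≤ C * ‖trigPoly π x‖) (k : κ) (a w : Fin (π k).dim → ℂ) :
    ‖a ⬝ᵥ (p k *ᵥ w)‖ ≤ C * (√(∑ i, ‖a i‖ ^ 2) * √(∑ i, ‖w i‖ ^ 2)) := by
  classical
  have hpair : ∀ y : Coeff π, pairing π (Pi.single k (vecMulVec w a)) y =
      (π k).dim * (a ⬝ᵥ (y k *ᵥ w)) := fun y => by
    rw [pairing, Finset.sum_eq_single k]
    · rw [Pi.single_eq_same, vecMulVec_mul, trace_vecMulVec, dotProduct_mulVec, dotProduct_comm]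
    · intro l _ hl
      simp [Pi.single_eq_of_ne hl]
    · simp
  rcases Nat.eq_zero_or_pos (π k).dim with h0 | h0
  · have : IsEmpty (Fin (π k).dim) := by rw [h0]; infer_instance
    simp [dotProduct]
  have hd : (0 : ℝ) < (π k).dim := by exact_mod_cast h0
  have h1 : ‖trigPoly π (Pi.single k (vecMulVec w a))‖ ≤
      (π k).dim * (√(∑ i, ‖a i‖ ^ 2) * √(∑ i, ‖w i‖ ^ 2)) := by
    refine (ContinuousMap.norm_le _ (by positivity)).2 fun t => ?_
    rw [trigPoly_apply, hpair, norm_mul, Complex.norm_natCast]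
    refine mul_le_mul_of_nonneg_left ((norm_dotProduct_le _ _).trans_eq ?_) hd.le
    rw [evalMat, sum_norm_sq_mulVec ((π k).mat_mem t)]
  have h2 := (hp (Pi.single k (vecMulVec w a))).trans (mul_le_mul_of_nonneg_left h1 hC)
  rw [hpair, norm_mul, Complex.norm_natCast, mul_left_comm] at h2
  exact le_of_mul_le_mul_left h2 hd

theorem sum_norm_sq_le_of_norm_dotProduct_le {n : Type*} [Fintype n] {v : n → ℂ} {C : ℝ}
    (h : ∀ w : n → ℂ, ‖w ⬝ᵥ v‖ ≤ C * √(∑ i, ‖w i‖ ^ 2)) : ∑ i, ‖v i‖ ^ 2 ≤ C ^ 2 := by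
  have h1 := h (star v)
  have h2 : star v ⬝ᵥ v = ((∑ i, ‖v i‖ ^ 2 : ℝ) : ℂ) := by
    simp [dotProduct, Complex.conj_mul']
  have h0 : 0 ≤ ∑ i, ‖v i‖ ^ 2 := Finset.sum_nonneg fun _ _ => sq_nonneg _
  rw [h2, Complex.norm_real, Real.norm_of_nonneg h0] at h1
  simp only [Pi.star_apply, norm_star] at h1
  set S := √(∑ i, ‖v i‖ ^ 2) with hS
  have h3 : S ^ 2 = ∑ i, ‖v i‖ ^ 2 := Real.sq_sqrt h0
  have hS0 : 0 ≤ S := Real.sqrt_nonneg _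
  rw [← h3] at h1 ⊢
  rcases hS0.eq_or_lt with h4 | h4
  · rw [← h4]; nlinarith [sq_nonneg C]
  · have h5 : S ≤ C := by nlinarith
    gcongr

theorem sum_norm_sq_row {n : Type*} [Fintype n] [DecidableEq n] {V : Matrix n n ℂ}
    (hV : V ∈ unitaryGroup n ℂ) (r : n) : ∑ i, ‖V r i‖ ^ 2 = 1 := by
  have h1 := congrFun (congrFun (mem_unitaryGroup_iff.1 hV) r) r
  rw [Matrix.mul_apply, one_apply_eq] at h1
  have h2 : ((∑ i, ‖V r i‖ ^ 2 : ℝ) : ℂ) = 1 := by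
    rw [← h1]
    simp [star_apply, Complex.mul_conj']
  exact_mod_cast h2

theorem sum_norm_sq_col {n : Type*} [Fintype n] [DecidableEq n] {U : Matrix n n ℂ}
    (hU : U ∈ unitaryGroup n ℂ) (r : n) : ∑ i, ‖U i r‖ ^ 2 = 1 := by
  have h1 := sum_norm_sq_row (Unitary.star_mem hU) r
  simpa [star_apply] using h1

theorem sum_norm_sq_mul_row_le {C : ℝ} (hC : 0 ≤ C) {p : Coeff π}
    (hp : ∀ x, ‖pairing π x p‖ ≤ C * ‖trigPoly π x‖) (k : κ)
    {V : Matrix (Fin (π k).dim) (Fin (π k).dim) ℂ} (hV : V ∈ unitaryGroup _ ℂ)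
    (r : Fin (π k).dim) : ∑ j, ‖(V * p k) r j‖ ^ 2 ≤ C ^ 2 := by
  refine sum_norm_sq_le_of_norm_dotProduct_le fun w => ?_
  have h1 := norm_dotProduct_mulVec_le hC hp k (V r) w
  rw [sum_norm_sq_row hV r, Real.sqrt_one, one_mul, dotProduct_mulVec, dotProduct_comm] at h1
  exact h1

theorem sum_norm_sq_mul_col_le {C : ℝ} (hC : 0 ≤ C) {p : Coeff π}
    (hp : ∀ x, ‖pairing π x p‖ ≤ C * ‖trigPoly π x‖) (k : κ)
    {U : Matrix (Fin (π k).dim) (Fin (π k).dim) ℂ} (hU : U ∈ unitaryGroup _ ℂ)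
    (r : Fin (π k).dim) : ∑ j, ‖(p k * U) j r‖ ^ 2 ≤ C ^ 2 := by
  refine sum_norm_sq_le_of_norm_dotProduct_le fun w => ?_
  have h1 := norm_dotProduct_mulVec_le hC hp k w fun i => U i r
  rw [sum_norm_sq_col hU r, Real.sqrt_one, mul_one] at h1
  exact h1

end RowBounds

/-! ### Randomly Sidon implies Sidon -/

section RandomToSidon

variable {G : Type*} [Group G] [TopologicalSpace G] [CompactSpace G]
  {κ : Type*} [Fintype κ] {π : κ → Irrep G}

open Matrix

theorem integral_mul_mul_apply {Ω n : Type*} [Fintype n] [MeasurableSpace Ω] {μ : Measure Ω}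
    {M : Ω → Matrix n n ℂ} {N : Matrix n n ℂ} (hM : ∀ i j, Integrable (fun ω => M ω i j) μ)
    (hN : ∀ i j, ∫ ω, M ω i j ∂μ = N i j) (V W : Matrix n n ℂ) (i j : n) :
    ∫ ω, (V * M ω * W) i j ∂μ = (V * N * W) i j := by
  have h1 : ∀ a b, Integrable (fun ω => V i a * M ω a b * W b j) μ :=
    fun a b => ((hM a b).const_mul _).mul_const _
  simp only [Matrix.mul_apply, Finset.sum_mul]
  rw [integral_finsetSum _ fun b _ => integrable_finsetSum _ fun a _ => h1 a b]
  refine Finset.sum_congr rfl fun b _ => ?_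
  rw [integral_finsetSum _ fun a _ => h1 a b]
  refine Finset.sum_congr rfl fun a _ => ?_
  rw [integral_mul_const, integral_const_mul, hN]

theorem memLp_two_entry (k : κ) (i j : Fin (π k).dim) :
    MemLp (fun g : Block π => g k i j) 2 (gaussianLaw π) :=
  memLp_gaussianProd (d := fun k => (π k).dim) (entryCLM k i j) 2 (by simp)

theorem integral_norm_sq_entry (k : κ) (i j : Fin (π k).dim) :
    ∫ g : Block π, ‖g k i j‖ ^ 2 ∂(gaussianLaw π) = ((π k).dim : ℝ)⁻¹ := by
  apply Complex.ofReal_injective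
  have h1 := integral_entry_mul_star_entry (d := fun k => (π k).dim) k i j i j
  rw [if_pos ⟨rfl, rfl⟩] at h1
  rw [← integral_complex_ofReal, Complex.ofReal_inv, Complex.ofReal_natCast, ← h1]
  refine integral_congr_ae (Filter.Eventually.of_forall fun g => ?_)
  simp [Complex.mul_conj']

/-- The adjoint of a sample, multiplied by the adjoints of the matrices `u`. -/
def adjointMul (u : Coeff π) (g : Block π) : Block π := blockMul (blockStar g) fun k => star (u k)

theorem measurePreserving_adjointMul {u : Coeff π} (hu : ∀ k, u k ∈ unitaryGroup _ ℂ) :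
    MeasurePreserving (adjointMul u) (gaussianLaw π) (gaussianLaw π) := by
  have h1 : MeasurePreserving (fun g : Block π => blockMul g fun k => star (u k)) (gaussianLaw π)
      (gaussianLaw π) := measurePreserving_blockMul fun k => Unitary.star_mem (hu k)
  exact h1.comp measurePreserving_blockStar

theorem of_adjointMul_mul {u : Coeff π} (hu : ∀ k, u k ∈ unitaryGroup _ ℂ) (g : Block π) (k : κ) :
    of (adjointMul u g k) * u k = (of (g k))ᴴ := by
  change (of (g k))ᴴ * star (u k) * u k = _
  rw [Matrix.mul_assoc, mem_unitaryGroup_iff'.1 (hu k), Matrix.mul_one]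

/-- The entries of `h* U`. -/
def adjointEntry (U : Coeff π) (k : κ) (r j : Fin (π k).dim) (h : Block π) : ℂ :=
  ∑ i, star (h k i j) * U k i r

theorem adjointEntry_eq (U : Coeff π) (k : κ) (r j : Fin (π k).dim) (h : Block π) :
    adjointEntry U k r j h = ((of (h k))ᴴ * U k) j r := by
  simp [adjointEntry, Matrix.mul_apply]

theorem memLp_adjointEntry (U : Coeff π) (k : κ) (r j : Fin (π k).dim) :
    MemLp (adjointEntry U k r j) 2 (gaussianLaw π) :=
  memLp_finsetSum _ fun i _ => (memLp_two_entry k i j).star.mul_const _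

theorem adjointEntry_mix (U : Coeff π) (k : κ) (r j : Fin (π k).dim) (c s : ℝ) (g h : Block π) :
    adjointEntry U k r j (c • g + s • h) =
      c * adjointEntry U k r j g + s * adjointEntry U k r j h := by
  simp only [adjointEntry, Finset.mul_sum, ← Finset.sum_add_distrib]
  refine Finset.sum_congr rfl fun i _ => ?_
  have h1 : ∀ (a : ℝ) (z : ℂ), a • z = (a : ℂ) * z := fun a z => rfl
  simp only [Pi.add_apply, Pi.smul_apply, h1, star_add, star_mul', Complex.star_def,
    Complex.conj_ofReal]
  ring

theorem integral_adjointEntry (U : Coeff π) (k : κ) (r j : Fin (π k).dim) :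
    ∫ h, adjointEntry U k r j h ∂(gaussianLaw π) = 0 := by
  have h1 : ∀ i, Integrable (fun h : Block π => star (h k i j) * U k i r) (gaussianLaw π) :=
    fun i => ((memLp_two_entry k i j).star.integrable (by norm_num)).mul_const _
  simp only [adjointEntry]
  rw [integral_finsetSum _ fun i _ => h1 i]
  refine Finset.sum_eq_zero fun i _ => ?_
  have h2 : ∫ h : Block π, star (h k i j) ∂(gaussianLaw π) = 0 := by
    have := integral_conj (𝕜 := ℂ) (f := fun h : Block π => h k i j) (μ := gaussianLaw π)
    rw [integral_entry (d := fun k => (π k).dim), map_zero] at this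
    exact this
  rw [integral_mul_const, h2, zero_mul]

theorem integral_norm_sq_adjointEntry {U : Coeff π} (hU : ∀ k, U k ∈ unitaryGroup _ ℂ) (k : κ)
    (r j : Fin (π k).dim) :
    ∫ h, ‖adjointEntry U k r j h‖ ^ 2 ∂(gaussianLaw π) = ((π k).dim : ℝ)⁻¹ := by
  have h1 : MeasurePreserving (fun g : Block π => blockMul g U) (gaussianLaw π)
      (gaussianLaw π) := measurePreserving_blockMul hU
  have h2 := h1.comp (measurePreserving_blockStar (d := fun k => (π k).dim))
  rw [← integral_norm_sq_entry k j r]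
  conv_rhs => rw [← h2.map_eq]
  have h3 : Continuous fun g : Block π => ‖g k j r‖ ^ 2 := by fun_prop
  rw [integral_map h2.measurable.aemeasurable h3.aestronglyMeasurable]
  rfl

variable {C : ℝ} {p : Block π → Coeff π}

theorem integral_mul_eq_one (hC : 0 ≤ C) (hm : ∀ k i j, Measurable fun g => p g k i j)
    (hb : ∀ g x, ‖pairing π x (p g)‖ ≤ C * ‖trigPoly π x‖)
    (hcov : ∀ k i j a b, ∫ g, p g k i j * g k a b ∂(gaussianLaw π) =
        if a = j ∧ b = i then ((π k).dim : ℂ)⁻¹ else 0) (k : κ) (i j : Fin (π k).dim) :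
    Integrable (fun g : Block π => (p g k * of (g k)) i j) (gaussianLaw π) ∧
    ∫ g, (p g k * of (g k)) i j ∂(gaussianLaw π) = (1 : Matrix _ _ ℂ) i j := by
  obtain ⟨K, hK⟩ := exists_entry_bound (π := π) hC
  have hd : ((π k).dim : ℂ) ≠ 0 := by
    have : 0 < (π k).dim := (Nat.zero_le _).trans_lt i.2
    exact_mod_cast this.ne'
  have hi : ∀ a, Integrable (fun g : Block π => p g k i a * g k a j) (gaussianLaw π) :=
    fun a => integrable_bounded_mul_entry (hm k i a) (fun g => hK _ (hb g) k i a) k a j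
  simp only [Matrix.mul_apply, of_apply]
  refine ⟨integrable_finsetSum _ fun a _ => hi a, ?_⟩
  rw [integral_finsetSum _ fun a _ => hi a]
  simp_rw [hcov]
  rw [one_apply]
  by_cases h : i = j
  · simp [h, hd]
  · have h' : j ≠ i := fun e => h e.symm
    simp [h, h']

/-- With g₁ = g* u*, this says that the diagonal of V E[p(g₁) p(c g + s h)] U is c + O(c²). It is
estimated entry by entry, so that the error carries no dimension factor. -/
theorem norm_integral_diag_sub_le (hC : 0 ≤ C) (hm : ∀ k i j, Measurable fun g => p g k i j)
    (hb : ∀ g x, ‖pairing π x (p g)‖ ≤ C * ‖trigPoly π x‖)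
    (hcov : ∀ k i j a b, ∫ g, p g k i j * g k a b ∂(gaussianLaw π) =
        if a = j ∧ b = i then ((π k).dim : ℂ)⁻¹ else 0)
    (h0 : ∀ k i j, ∫ g, (p g k i j - star (g k j i)) ∂(gaussianLaw π) = 0)
    (hL : ∀ (L : StrongDual ℝ (Block π)) k i j,
        ∫ g, (L g : ℂ) * (p g k i j - star (g k j i)) ∂(gaussianLaw π) = 0)
    {u U V : Coeff π} (hu : ∀ k, u k ∈ unitaryGroup _ ℂ) (hU : ∀ k, U k ∈ unitaryGroup _ ℂ)
    (hV : ∀ k, V k ∈ unitaryGroup _ ℂ) (k : κ) (hVuU : V k * u k * U k = 1) (r : Fin (π k).dim)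
    {c s : ℝ} (hc : c ∈ Set.Icc (0 : ℝ) 1) (hcs : c ^ 2 + s ^ 2 = 1) :
    Integrable (fun z : Block π × Block π =>
      (V k * (p (adjointMul u z.1) * p (c • z.1 + s • z.2)) k * U k) r r)
      ((gaussianLaw π).prod (gaussianLaw π)) ∧
    ‖∫ z, (V k * (p (adjointMul u z.1) * p (c • z.1 + s • z.2)) k * U k) r r
      ∂((gaussianLaw π).prod (gaussianLaw π)) - c‖ ≤ c ^ 2 * ((C ^ 2 + 2 * (C ^ 2 + 1)) / 2) := by
  have hμ : (gaussianLaw π)[id] = 0 := by simpa using integral_id_gaussianProd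
  have hT := measurePreserving_adjointMul hu
  have hd : (0 : ℝ) < (π k).dim := by
    have : 0 < (π k).dim := (Nat.zero_le _).trans_lt r.2
    exact_mod_cast this
  obtain ⟨K, hK⟩ := exists_entry_bound (π := π) hC
  have hp2 : ∀ i j, MemLp (fun g => p g k i j) 2 (gaussianLaw π) := fun i j =>
    MemLp.of_bound (hm k i j).aestronglyMeasurable K
      (Filter.Eventually.of_forall fun g => hK _ (hb g) k i j)
  let α : Fin (π k).dim → Block π → ℂ := fun j g => (V k * p (adjointMul u g) k) r j
  let η : Fin (π k).dim → Block π → ℂ := fun j g => (p g k * U k) j r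
  let γ : Fin (π k).dim → Block π → ℂ := adjointEntry U k r
  have hα : ∀ j, MemLp (α j) 2 (gaussianLaw π) := fun j => by
    simp only [α, Matrix.mul_apply]
    exact memLp_finsetSum _ fun i _ => ((hp2 i j).comp_measurePreserving hT).const_mul _
  have hη : ∀ j, MemLp (η j) 2 (gaussianLaw π) := fun j => by
    simp only [η, Matrix.mul_apply]
    exact memLp_finsetSum _ fun i _ => (hp2 j i).mul_const _
  have hγ : ∀ j, MemLp (γ j) 2 (gaussianLaw π) := memLp_adjointEntry U k r
  have hβ : ∀ j g, η j g - γ j g = ∑ i, (p g k j i - star (g k i j)) * U k i r := fun j g => by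
    simp only [η, γ, adjointEntry, Matrix.mul_apply, ← Finset.sum_sub_distrib, sub_mul]
  have hd2 : ∀ i j, MemLp (fun g : Block π => p g k j i - star (g k i j)) 2 (gaussianLaw π) :=
    fun i j => (hp2 j i).sub (memLp_two_entry k i j).star
  have hb0 : ∀ j, ∫ g, (η j g - γ j g) ∂(gaussianLaw π) = 0 := fun j => by
    simp_rw [hβ]
    rw [integral_finsetSum _ fun i _ => ((hd2 i j).integrable (by norm_num)).mul_const _]
    refine Finset.sum_eq_zero fun i _ => ?_
    rw [integral_mul_const, h0, zero_mul]
  have hbL : ∀ j (L : StrongDual ℝ (Block π)),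
      ∫ g, (L g : ℂ) * (η j g - γ j g) ∂(gaussianLaw π) = 0 := fun j L => by
    have hL2 : MemLp (fun g => (L g : ℂ)) 2 (gaussianLaw π) :=
      (L.comp_memLp' (IsGaussian.memLp_id (gaussianLaw π) 2 (by simp))).ofReal
    have hi : ∀ i, Integrable (fun g : Block π => (L g : ℂ) * (p g k j i - star (g k i j)) *
        U k i r) (gaussianLaw π) := fun i => (hL2.integrable_mul (hd2 i j)).mul_const _
    simp_rw [hβ, Finset.mul_sum, ← mul_assoc]
    rw [integral_finsetSum _ fun i _ => hi i]
    refine Finset.sum_eq_zero fun i _ => ?_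
    rw [integral_mul_const, hL, zero_mul]
  have h1 : ∑ j, ∫ g, α j g * γ j g ∂(gaussianLaw π) = 1 := by
    have hi : ∀ j, Integrable (fun g => α j g * γ j g) (gaussianLaw π) := fun j =>
      (hα j).integrable_mul (hγ j)
    rw [← integral_finsetSum _ fun j _ => hi j]
    -- Since g* = g₁ u and g₁ has the law of g, the linear term reduces to V E[p(h) h] u U = V u U =
    -- 1.
    let F : Block π → ℂ := fun h => (V k * (p h k * of (h k)) * (u k * U k)) r r
    have hM := integral_mul_eq_one hC hm hb hcov k
    have hF : ∀ g, ∑ j, α j g * γ j g = F (adjointMul u g) := fun g => by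
      simp only [α, γ, adjointEntry_eq, F]
      rw [← Matrix.mul_apply, ← of_adjointMul_mul hu]
      simp only [Matrix.mul_assoc]
    have hFm : AEStronglyMeasurable F (gaussianLaw π) := by
      simp only [F, Matrix.mul_apply (M := _ * _) (N := u k * U k),
        Matrix.mul_apply (M := V k)]
      exact Finset.aestronglyMeasurable_fun_sum _ fun b _ =>
        (Finset.aestronglyMeasurable_fun_sum _ fun a _ =>
          (hM a b).1.aestronglyMeasurable.const_mul _).mul_const _
    simp_rw [hF]
    rw [integral_comp_of_measurePreserving hT hFm,
      integral_mul_mul_apply (fun i j => (hM i j).1) (fun i j => (hM i j).2),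
      Matrix.mul_one, ← Matrix.mul_assoc, hVuU, one_apply_eq]
  have hA : ∑ j, ∫ g, ‖α j g‖ ^ 2 ∂(gaussianLaw π) ≤ C ^ 2 := by
    rw [← integral_finsetSum _ fun j _ => (hα j).integrable_norm_pow (by norm_num)]
    refine (integral_mono (integrable_finsetSum _ fun j _ =>
      (hα j).integrable_norm_pow (by norm_num)) (integrable_const (C ^ 2)) fun g =>
        sum_norm_sq_mul_row_le hC (hb _) k (hV k) r).trans_eq ?_
    simp
  have hE : ∑ j, ∫ g, ‖η j g‖ ^ 2 ∂(gaussianLaw π) ≤ C ^ 2 := by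
    rw [← integral_finsetSum _ fun j _ => (hη j).integrable_norm_pow (by norm_num)]
    refine (integral_mono (integrable_finsetSum _ fun j _ =>
      (hη j).integrable_norm_pow (by norm_num)) (integrable_const (C ^ 2)) fun g =>
        sum_norm_sq_mul_col_le hC (hb g) k (hU k) r).trans_eq ?_
    simp
  have hB : ∑ j, ∫ g, ‖η j g - γ j g‖ ^ 2 ∂(gaussianLaw π) ≤ 2 * (C ^ 2 + 1) := by
    have h2 : ∑ j, ∫ g, ‖γ j g‖ ^ 2 ∂(gaussianLaw π) = 1 := by
      simp_rw [γ, integral_norm_sq_adjointEntry hU]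
      simp [hd.ne']
    calc _ ≤ ∑ j, (2 * ∫ g, ‖η j g‖ ^ 2 ∂(gaussianLaw π) +
          2 * ∫ g, ‖γ j g‖ ^ 2 ∂(gaussianLaw π)) := by
          refine Finset.sum_le_sum fun j _ => ?_
          have i1 := ((hη j).integrable_norm_pow (by norm_num)).const_mul 2
          have i2 := ((hγ j).integrable_norm_pow (by norm_num)).const_mul 2
          rw [← integral_const_mul, ← integral_const_mul, ← integral_add i1 i2]
          refine integral_mono (((hη j).sub (hγ j)).integrable_norm_pow (by norm_num))
            (i1.fun_add i2) fun g => ?_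
          have h3 := norm_sub_le (η j g) (γ j g)
          have h4 : ‖η j g - γ j g‖ ^ 2 ≤ (‖η j g‖ + ‖γ j g‖) ^ 2 := by gcongr
          change ‖η j g - γ j g‖ ^ 2 ≤ 2 * ‖η j g‖ ^ 2 + 2 * ‖γ j g‖ ^ 2
          nlinarith [sq_nonneg (‖η j g‖ - ‖γ j g‖)]
      _ = 2 * (∑ j, ∫ g, ‖η j g‖ ^ 2 ∂(gaussianLaw π)) + 2 * 1 := by
          rw [Finset.sum_add_distrib, ← Finset.mul_sum, ← Finset.mul_sum, h2]
      _ ≤ _ := by linarith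
  have hsplit : ∀ z : Block π × Block π,
      (V k * (p (adjointMul u z.1) * p (c • z.1 + s • z.2)) k * U k) r r =
      ∑ j, α j z.1 * η j (c • z.1 + s • z.2) := fun z => by
    simp only [α, η]
    rw [← Matrix.mul_apply, Pi.mul_apply]
    simp only [Matrix.mul_assoc]
  simp_rw [hsplit]
  exact ⟨integrable_finsetSum _ fun j _ =>
    (memLp_comp_fst (hα j)).integrable_mul (memLp_comp_mix hμ hcs (hη j)),
    norm_integral_sum_mix_sub_le hμ hα hη hγ (adjointEntry_mix U k r) (integral_adjointEntry U k r)
      hb0 hbL h1 hA hB hc hcs⟩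

theorem sumTraceNorm_le_norm_trigPoly [IsTopologicalGroup G] [MeasurableSpace G] [BorelSpace G]
    (m : Measure G) [m.IsHaarMeasure] [IsProbabilityMeasure m]
    (hC : 0 ≤ C) (hπ : Function.Injective fun k => (π k).cls)
    (h : ∀ x : Coeff π, sumTraceNorm π x ≤ C * expNorm x) (x : Coeff π) :
    sumTraceNorm π x ≤ (6 * C ^ 2 + 4) * C ^ 2 * ‖trigPoly π x‖ := by
  obtain ⟨p, hm, hb, hcov, h0, hL⟩ := exists_dualMatrices_orthogonal m hC hπ h
  choose U hU V hV σ hσ hx hσx using fun k => exists_singularValue_decomposition (x k)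
  -- The adjoint of the unitary polar factor U V of x, so that tr(x u) = tr|x|.
  let u : Coeff π := fun k => star (V k) * star (U k)
  have hu : ∀ k, u k ∈ unitaryGroup _ ℂ := fun k =>
    mul_mem (Unitary.star_mem (hV k)) (Unitary.star_mem (hU k))
  have hVuU : ∀ k, V k * u k * U k = 1 := fun k => by
    change V k * (star (V k) * star (U k)) * U k = 1
    rw [← Matrix.mul_assoc, mem_unitaryGroup_iff.1 (hV k), Matrix.one_mul,
      mem_unitaryGroup_iff'.1 (hU k)]
  set R := sumTraceNorm π x with hR
  have hR0 : 0 ≤ R := Finset.sum_nonneg fun k _ =>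
    mul_nonneg (Nat.cast_nonneg _) (traceNorm_nonneg _)
  set K := (C ^ 2 + 2 * (C ^ 2 + 1)) / 2 with hK
  have hK1 : 1 ≤ K := by rw [hK]; nlinarith [sq_nonneg C]
  -- Chosen so that the error c² K R is half of the main term c R. The final constant is 2K · 2C² =
  -- (6C² + 4) C².
  let c : ℝ := 1 / (2 * K)
  have hcK : c * K = 1 / 2 := by simp only [c]; field_simp
  have hc0 : 0 < c := by simp only [c]; positivity
  have hc1 : c ≤ 1 := by nlinarith
  have hcs : c ^ 2 + √(1 - c ^ 2) ^ 2 = 1 := by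
    rw [Real.sq_sqrt (by nlinarith)]; ring
  have hkey := fun k r => norm_integral_diag_sub_le hC hm hb hcov h0 hL hu hU hV k (hVuU k) r
    ⟨hc0.le, hc1⟩ hcs
  set s := √(1 - c ^ 2)
  let ν := (gaussianLaw π).prod (gaussianLaw π)
  let D : ∀ k, Fin (π k).dim → Block π × Block π → ℂ := fun k r z =>
    (V k * (p (adjointMul u z.1) * p (c • z.1 + s • z.2)) k * U k) r r
  have hDi : ∀ k r, Integrable (D k r) ν := fun k r => (hkey k r).1
  have hpair : ∀ z : Block π × Block π, pairing π x (p (adjointMul u z.1) * p (c • z.1 + s • z.2)) =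
      ∑ k, ∑ r, (((π k).dim : ℂ) * σ k r) * D k r z := fun z => by
    refine Finset.sum_congr rfl fun k _ => ?_
    conv_lhs => rw [hx k, trace_mul_diagonal_mul, Finset.mul_sum]
    exact Finset.sum_congr rfl fun r _ => (mul_assoc _ _ _).symm
  have hint : ∫ z, pairing π x (p (adjointMul u z.1) * p (c • z.1 + s • z.2)) ∂ν =
      ∑ k, ∑ r, (((π k).dim : ℂ) * σ k r) * ∫ z, D k r z ∂ν := by
    simp_rw [hpair]
    rw [integral_finsetSum _ fun k _ => integrable_finsetSum _ fun r _ => (hDi k r).const_mul _]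
    refine Finset.sum_congr rfl fun k _ => ?_
    rw [integral_finsetSum _ fun r _ => (hDi k r).const_mul _]
    exact Finset.sum_congr rfl fun r _ => integral_const_mul _ _
  have hRsum : R = ∑ k, ∑ r, ((π k).dim : ℝ) * σ k r := by
    rw [hR, sumTraceNorm]
    exact Finset.sum_congr rfl fun k _ => by rw [hσx, Finset.mul_sum]
  have herr : ‖∫ z, pairing π x (p (adjointMul u z.1) * p (c • z.1 + s • z.2)) ∂ν - c * R‖ ≤
      c ^ 2 * K * R := by
    have h1 : ∫ z, pairing π x (p (adjointMul u z.1) * p (c • z.1 + s • z.2)) ∂ν - c * R =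
        ∑ k, ∑ r, (((π k).dim : ℂ) * σ k r) * (∫ z, D k r z ∂ν - c) := by
      rw [hint, hRsum]
      push_cast
      simp only [mul_sub, Finset.sum_sub_distrib, Finset.mul_sum]
      congr 1
      exact Finset.sum_congr rfl fun k _ => Finset.sum_congr rfl fun r _ => by ring
    rw [h1, hRsum, Finset.mul_sum]
    refine (norm_sum_le _ _).trans (Finset.sum_le_sum fun k _ => ?_)
    rw [Finset.mul_sum]
    refine (norm_sum_le _ _).trans (Finset.sum_le_sum fun r _ => ?_)
    rw [norm_mul, norm_mul, Complex.norm_natCast, Complex.norm_real,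
      Real.norm_of_nonneg (hσ k r), mul_comm]
    exact mul_le_mul_of_nonneg_right (hkey k r).2 (mul_nonneg (Nat.cast_nonneg _) (hσ k r))
  have hbound : ‖∫ z, pairing π x (p (adjointMul u z.1) * p (c • z.1 + s • z.2)) ∂ν‖ ≤
      C ^ 2 * ‖trigPoly π x‖ := by
    have h2 := norm_integral_le_of_norm_le_const (μ := ν)
      (f := fun z => pairing π x (p (adjointMul u z.1) * p (c • z.1 + s • z.2)))
      (Filter.Eventually.of_forall fun z => norm_pairing_mul_le hC (hb _) (hb _) x)
    rwa [probReal_univ, mul_one] at h2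
  have h3 : c * R ≤ C ^ 2 * ‖trigPoly π x‖ + c ^ 2 * K * R := by
    have h4 : ‖((c * R : ℝ) : ℂ)‖ = c * R := by
      rw [Complex.norm_real, Real.norm_of_nonneg (by positivity)]
    rw [← h4, Complex.ofReal_mul]
    have h5 := norm_sub_norm_le ((c : ℂ) * R)
      (∫ z, pairing π x (p (adjointMul u z.1) * p (c • z.1 + s • z.2)) ∂ν)
    rw [norm_sub_rev] at h5
    linarith
  have h6 : c * R ≤ 2 * (C ^ 2 * ‖trigPoly π x‖) := by
    have : c ^ 2 * K * R = c * R * (c * K) := by ring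
    rw [this, hcK] at h3
    linarith
  have h7 : R = 2 * K * (c * R) := by
    have : 2 * K * (c * R) = 2 * (c * K) * R := by ring
    rw [this, hcK]; ring
  rw [h7]
  calc 2 * K * (c * R) ≤ 2 * K * (2 * (C ^ 2 * ‖trigPoly π x‖)) := by gcongr
    _ = _ := by rw [hK]; ring

end RandomToSidon

/-! ### Rider's theorem and unions -/

section Rider

variable {G : Type*} [Group G] [TopologicalSpace G] [IsTopologicalGroup G] [CompactSpace G]
  [MeasurableSpace G] [BorelSpace G] (m : Measure G) [m.IsHaarMeasure] [IsProbabilityMeasure m]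

/-- Rider's theorem: inequivalent irreducible representations form a Sidon family if and only if
they form a randomly Sidon family. -/
theorem isSidon_iff_isRandomlySidon {ι : Type*} (π : ι → Irrep G)
    (hπ : Function.Injective fun i => (π i).cls) :
    IsSidon m (fun i => (π i).mat) ↔ IsRandomlySidon m (fun i => (π i).mat) := by
  rw [isSidon_iff, isRandomlySidon_iff]
  constructor
  · rintro ⟨C, hC⟩
    exact ⟨2 * C, fun s x => by
      simpa using sumTraceNorm_le_expNorm_of_forall (hC s) x⟩
  · rintro ⟨C, hC⟩
    exact ⟨(6 * C ^ 2 + 4) * C ^ 2, fun s x => by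
      simpa using sumTraceNorm_le_norm_trigPoly m C.coe_nonneg
        (hπ.comp Subtype.coe_injective) (hC s) x⟩

theorem isRandomlySidonSet_sUnion {F : Set (Set (DualObject G))} (hF : F.Finite)
    (h : ∀ Λ ∈ F, IsRandomlySidonSet m Λ) : IsRandomlySidonSet m (⋃₀ F) := by
  intro π hπ
  have := hF.fintype
  let j : ∀ Λ : F, ↥Λ.1 → ↥(⋃₀ F) :=
    fun Λ γ => ⟨γ, Set.mem_sUnion_of_mem γ.2 Λ.2⟩
  refine isRandomlySidon_of_finite_cover m π Finset.univ j (fun Λ γ δ hγδ => ?_) ?_ ?_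
  · have h1 := congrArg Subtype.val hγδ
    exact Subtype.ext h1
  · rintro ⟨γ, Λ, hΛ, hγ⟩
    exact ⟨⟨Λ, hΛ⟩, Finset.mem_univ _, ⟨γ, hγ⟩, rfl⟩
  · exact fun Λ _ => h Λ Λ.2 (fun γ => π (j Λ γ)) fun γ => hπ (j Λ γ)

theorem isSidonSet_iff_isRandomlySidonSet (Λ : Set (DualObject G)) :
    IsSidonSet m Λ ↔ IsRandomlySidonSet m Λ := by
  refine forall_congr' fun π => forall_congr' fun hπ => isSidon_iff_isRandomlySidon m π ?_
  intro γ δ hγδ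
  exact Subtype.ext (by rw [← hπ γ, ← hπ δ]; exact hγδ)

end Rider

end SidonRep

end

theorem mainTheorem6 {G : Type*} [Group G] [TopologicalSpace G] [IsTopologicalGroup G]
    [CompactSpace G] [T2Space G] [MeasurableSpace G] [BorelSpace G]
    (m : MeasureTheory.Measure G) [m.IsHaarMeasure] [MeasureTheory.IsProbabilityMeasure m] :
    (∀ {ι : Type*} (π : ι → SidonRep.Irrep G), Function.Injective (fun i => (π i).cls) →
      (SidonRep.IsSidon m (fun i => (π i).mat) ↔
        SidonRep.IsRandomlySidon m (fun i => (π i).mat))) ∧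
    (∀ F : Set (Set (SidonRep.DualObject G)), F.Finite →
      (∀ Λ ∈ F, SidonRep.IsRandomlySidonSet m Λ) → SidonRep.IsRandomlySidonSet m (⋃₀ F)) ∧
    (∀ Λ₁ Λ₂ : Set (SidonRep.DualObject G), SidonRep.IsSidonSet m Λ₁ → SidonRep.IsSidonSet m Λ₂ →
      SidonRep.IsSidonSet m (Λ₁ ∪ Λ₂)) := by
  refine ⟨fun π hπ => SidonRep.isSidon_iff_isRandomlySidon m π hπ,
    fun F hF h => SidonRep.isRandomlySidonSet_sUnion m hF h, fun Λ₁ Λ₂ h₁ h₂ => ?_⟩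
  -- The union theorem for Sidon sets is obtained through random Sidonicity, which is visibly stable
  -- under unions.
  rw [SidonRep.isSidonSet_iff_isRandomlySidonSet] at h₁ h₂ ⊢
  rw [← Set.sUnion_pair]
  refine SidonRep.isRandomlySidonSet_sUnion m (by simp) ?_
  rintro Λ (rfl | rfl)
  · exact h₁
  · exact h₂
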